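/- **Setting.** Let $\mathbb{T}=\mathbb{R}/\mathbb{Z}$, $H=L_2([0,1]\times\mathbb{T})$, and let $\xi=\{\xi(h):h\in H\}$ be an isonormal Gaussian process (a centred Gaussian family with $\mathbb{E}[\xi(g)\xi(h)]=\langle g,h\rangle_H$) on a complete probability space $(\Omega,\mathscr{F},\mathbb{P})$. Let $\mathscr{F}_t$ be the $\sigma$-algebra generated by $\xi(\mathbf 1_{[0,r)\times B})$, $r\in[0,t]$, $B\subseteq\mathbb{T}$ Borel, and by all $\mathbb{P}$-null sets; let $\mathscr{P}$ be the corresponding predictable $\sigma$-algebra on $\Omega\times[0,1]$. Stochastic integrals against $\xi(dy,dr)$ are Itô–Walsh integrals. Let $p^{\mathbb{R}}_t(x)=(4\pi t)^{-1/2}e^{-x^2/(4t)}$, $p_t(x,y)=\sum_{k\in\mathbb{Z}}p^{\mathbb{R}}_t(x-y+k)$, and $P_tg(x)=\int_{\mathbb{T}}p_t(x,y)g(y)\,dy$ for $t>0$, $P_0g=g$. For $\alpha<0$ a Schwartz distribution $f$ on $\mathbb{R}$ is of class $C^\alpha$ if $\|f\|_{C^\alpha}=\sup_{\varepsilon\in(0,1]}\varepsilon^{-\alpha/2}\sup_{x\in\mathbb{R}}|\langle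 f,p^{\mathbb{R}}_\varepsilon(x-\cdot)\rangle|<\infty$. $C^\infty$ denotes the bounded smooth functions on $\mathbb R$ with bounded derivatives, and $\|\sigma\|_{C^1}=\sup|\sigma|+\sup|\sigma'|$; $\sigma\in C^1$ means that $\sigma$ is continuously differentiable with $\|\sigma\|_{C^1}<\infty$. *Regularised solutions.* Let $b$ be of class $C^\alpha$, $\sigma\in C^1$, and $u_0:\mathbb{T}\to\mathbb{R}$ continuous and deterministic. A $\mathscr{P}\otimes\mathscr{B}(\mathbb{T})$-measurable random field $u:\Omega\times[0,1]\times\mathbb{T}\to\mathbb{R}$, continuous in $(t,x)$, is a regularised solution of $(\partial_t-\Delta)u=b(u)+\sigma(u)\xi$, $u|_{t=0}=u_0$, with drift $D^u$, if $D^u:\Omega\times[0,1]\times\mathbb{T}\to\mathbb{R}$ is $\mathscr{P}\otimes\mathscr{B}(\mathbb{T})$-measurable and 1. for every sequence $(b^n)\subset C^\infty$ with $b^n\to b$ in $C^\alpha$, $\sup_{(t,x)\in[0,1]\times\mathbb{T}}\big|D^u_t(x)-\int_0^t\int_{\mathbb{T}}p_{t-r}(x,y)b^n(u(r,y))\,dy\,dr\big|\to0$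 in probability; 2. for each $(t,x)\in[0,1]\times\mathbb{T}$, almost surely $u(t,x)=P_tu_0(x)+D^u_t(x)+\int_0^t\int_{\mathbb{T}}p_{t-r}(x,y)\sigma(u(r,y))\,\xi(dy,dr)$. *Norms and classes.* For a sub-$\sigma$-algebra $\mathscr{G}$ put $\|X\|_{L_{p,\infty}^{\mathscr{G}}}=\big\|(\mathbb{E}[|X|^p\,|\,\mathscr{G}])^{1/p}\big\|_{L_\infty}$, and for $0\le S\le T\le1$ $$[f]_{\mathscr{V}_p^\beta[S,T]}=\sup_{x\in\mathbb{T}}\ \sup_{S\le s<t\le T}\frac{\|f_t(x)-P_{t-s}f_s(x)\|_{L_{p,\infty}^{\mathscr{F}_s}}}{(t-s)^\beta}$$ (so the bracket is $0$ if $S=T$). The regularised solution $u$ with drift $D^u$ belongs to $\mathscr{U}_p^\beta$ if $\sup_{(t,x)}\|D^u_t(x)\|_{L_p(\Omega)}<\infty$ and $[D^u]_{\mathscr{V}_p^\beta[0,1]}<\infty$. *Driftless flow.* For $s\in[0,1]$ and such a $u$, $\phi^{u(s,\cdot),s}$ denotes the solution of $(\partial_t-\Delta)\phi=\sigma(\phi)\xi$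 on $[s,1]\times\mathbb{T}$ started from $u(s,\cdot)$ at time $s$, that is, the $\mathscr{P}\otimes\mathscr{B}(\mathbb{T})$-measurable, almost surely continuous random field on $[s,1]\times\mathbb{T}$ such that for all $(t,x)\in[s,1]\times\mathbb{T}$, almost surely $$\phi(t,x)=P_{t-s}\big(u(s,\cdot)\big)(x)+\int_s^t\int_{\mathbb{T}}p_{t-r}(x,y)\sigma(\phi(r,y))\,\xi(dy,dr).$$ **Lemma (Driftless approximation).** Let $\sigma\in C^1$, $\alpha\in(-1,0)$, $b\in C^\alpha$, $p\in[2,\infty)$, $\beta\in[0,1+\frac{\alpha}{4}]$, and let $u$ be a regularised solution of $(\partial_t-\Delta)u=b(u)+\sigma(u)\xi$, $u|_{t=0}=u_0$, with drift $D^u$, in the class $\mathscr{U}_p^\beta$. Then there exists a constant $N=N(p,\|\sigma\|_{C^1},\alpha,\beta)$, depending on nothing else, such that for all $0\le s\le t\le1$ $$\sup_{x\in\mathbb{T}}\big\|u(t,x)-\phi^{u(s,\cdot),s}(t,x)\big\|_{L_{p,\infty}^{\mathscr{F}_s}}\le N\,[D^u]_{\mathscr{V}_p^\beta[s,t]}\,(t-s)^\beta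 .$$ -/

import Mathlib

open MeasureTheory ProbabilityTheory Filter Topology
open scoped ENNReal NNReal SchwartzMap

noncomputable section

namespace SHE

/-! ### Heat kernels -/

/-- The heat kernel on `ℝ`, `p_t(x) = (4 π t)^{-1/2} exp (-x² / (4 t))`, for `t > 0`. -/
def heatKernelReal (t x : ℝ) : ℝ :=
  (Real.sqrt (4 * Real.pi * t))⁻¹ * Real.exp (-(x ^ 2 / (4 * t)))

theorem periodic_tsum_heatKernelReal (t : ℝ) :
    Function.Periodic (fun x : ℝ => ∑' k : ℤ, heatKernelReal t (x + k)) 1 := by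
  intro x
  refine Eq.trans ?_ ((Equiv.addRight (1 : ℤ)).tsum_eq
    (fun k : ℤ => heatKernelReal t (x + (k : ℝ))))
  refine tsum_congr fun k => ?_
  simp only [Equiv.coe_addRight, Int.cast_add, Int.cast_one]
  congr 1
  ring

/-- The periodic heat kernel on the torus `ℝ / ℤ` as a function of the difference of its two space
variables: `p_t(x, y) = ∑_{k ∈ ℤ} p_t(x - y + k)` is `torusKernel t (x - y)`. -/
def torusKernel (t : ℝ) : UnitAddCircle → ℝ :=
  (periodic_tsum_heatKernelReal t).lift

/-- The heat semigroup on the torus, `P_t g(x) = ∫ p_t(x, y) g(y) dy` for `t > 0`, and `P_0 g = g`. -/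
def heatSemigroup (t : ℝ) (g : UnitAddCircle → ℝ) (x : UnitAddCircle) : ℝ :=
  if 0 < t then ∫ y, torusKernel t (x - y) * g y else g x

/-! ### Distributions of negative Hölder regularity -/

/-- Real valued (tempered) Schwartz distributions on `ℝ`. -/
abbrev RealDistribution : Type := 𝓢(ℝ, ℝ) →L[ℝ] ℝ

theorem exists_bound_pow_mul_exp (k : ℕ) :
    ∃ C : ℝ, ∀ x : ℝ, |x| ^ k * Real.exp (-(x ^ 2 / 2)) ≤ C := by
  refine ⟨(k + 1).factorial * Real.exp (1 / 2), fun x => ?_⟩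
  have h1 : |x| ^ k / k.factorial ≤ Real.exp |x| :=
    Real.pow_div_factorial_le_exp |x| (abs_nonneg x) k
  have hk : (0 : ℝ) < k.factorial := by exact_mod_cast k.factorial_pos
  have hk' : (k.factorial : ℝ) ≤ (k + 1).factorial := by
    exact_mod_cast Nat.factorial_le (Nat.le_succ k)
  have h2 : |x| ^ k ≤ (k + 1).factorial * Real.exp |x| := by
    rw [div_le_iff₀ hk] at h1
    calc |x| ^ k ≤ Real.exp |x| * k.factorial := h1
      _ = k.factorial * Real.exp |x| := mul_comm _ _
      _ ≤ _ := by gcongr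
  calc |x| ^ k * Real.exp (-(x ^ 2 / 2))
      ≤ ((k + 1).factorial * Real.exp |x|) * Real.exp (-(x ^ 2 / 2)) := by gcongr
    _ = (k + 1).factorial * Real.exp (|x| + -(x ^ 2 / 2)) := by rw [mul_assoc, Real.exp_add]
    _ ≤ _ := by
      gcongr
      nlinarith [sq_abs x, sq_nonneg (|x| - 1)]

theorem exists_bound_aeval_mul_exp (q : Polynomial ℤ) :
    ∃ C : ℝ, ∀ x : ℝ, |Polynomial.aeval x q * Real.exp (-(x ^ 2 / 2))| ≤ C := by
  induction q using Polynomial.induction_on' with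
  | add q₁ q₂ h₁ h₂ =>
    obtain ⟨C₁, h₁⟩ := h₁
    obtain ⟨C₂, h₂⟩ := h₂
    refine ⟨C₁ + C₂, fun x => ?_⟩
    rw [map_add, add_mul]
    exact (abs_add_le _ _).trans (add_le_add (h₁ x) (h₂ x))
  | monomial n a =>
    obtain ⟨C, hC⟩ := exists_bound_pow_mul_exp n
    refine ⟨|(a : ℝ)| * C, fun x => ?_⟩
    rw [Polynomial.aeval_monomial, abs_mul, abs_mul, abs_pow, Real.abs_exp, mul_assoc]
    simpa using mul_le_mul_of_nonneg_left (hC x) (abs_nonneg (a : ℝ))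

/-- The function `exp (-x² / 2)` as a Schwartz function. -/
def stdGaussian : 𝓢(ℝ, ℝ) where
  toFun := fun x => Real.exp (-(x ^ 2 / 2))
  smooth' := by fun_prop
  decay' := by
    intro k n
    obtain ⟨C, hC⟩ := exists_bound_aeval_mul_exp (Polynomial.X ^ k * Polynomial.hermite n)
    refine ⟨C, fun x => ?_⟩
    rw [norm_iteratedFDeriv_eq_norm_iteratedDeriv, iteratedDeriv_eq_iterate,
      Polynomial.deriv_gaussian_eq_hermite_mul_gaussian]
    have := hC x
    simp only [map_mul, map_pow, Polynomial.aeval_X, abs_mul, abs_pow] at this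
    simpa [Real.norm_eq_abs, abs_mul, mul_assoc] using this

theorem hasTemperateGrowth_affine (x c : ℝ) :
    Function.HasTemperateGrowth (fun y : ℝ => c * (x - y)) := by
  fun_prop

theorem antilipschitz_affine (x : ℝ) {c : ℝ} (hc : 0 < c) :
    AntilipschitzWith (Real.toNNReal c⁻¹) (fun y : ℝ => c * (x - y)) := by
  refine AntilipschitzWith.of_le_mul_dist fun y z => ?_
  rw [Real.coe_toNNReal _ (inv_nonneg.2 hc.le), Real.dist_eq, Real.dist_eq,
    show c * (x - y) - c * (x - z) = c * (z - y) by ring, abs_mul, abs_of_pos hc,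
    ← mul_assoc, inv_mul_cancel₀ hc.ne', one_mul, abs_sub_comm]

/-- The Schwartz function `y ↦ p_ε(x - y)`, where `p` is the heat kernel on `ℝ`; see
`heatSchwartz_apply`. -/
def heatSchwartz (ε : Set.Ioc (0 : ℝ) 1) (x : ℝ) : 𝓢(ℝ, ℝ) :=
  (Real.sqrt (4 * Real.pi * ε))⁻¹ •
    SchwartzMap.compCLMOfAntilipschitz ℝ
      (hasTemperateGrowth_affine x (Real.sqrt (2 * ε))⁻¹)
      (antilipschitz_affine x (inv_pos.2 (Real.sqrt_pos.2 (mul_pos two_pos ε.2.1)))) stdGaussian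

theorem heatSchwartz_apply (ε : Set.Ioc (0 : ℝ) 1) (x y : ℝ) :
    heatSchwartz ε x y = heatKernelReal ε (x - y) := by
  have hε : (0 : ℝ) ≤ 2 * ε := (mul_pos two_pos ε.2.1).le
  have h : stdGaussian ((Real.sqrt (2 * ε))⁻¹ * (x - y))
      = Real.exp (-((x - y) ^ 2 / (4 * ε))) := by
    change Real.exp (-(((Real.sqrt (2 * ε))⁻¹ * (x - y)) ^ 2 / 2)) = _
    rw [mul_pow, inv_pow, Real.sq_sqrt hε]
    congr 2
    have := ε.2.1.ne'
    field_simp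
    ring
  change (Real.sqrt (4 * Real.pi * ε))⁻¹ * stdGaussian ((Real.sqrt (2 * ε))⁻¹ * (x - y)) = _
  rw [h, heatKernelReal]

/-- `P_ε f(x) = ⟨f, p_ε(x - ·)⟩` for a distribution `f` on `ℝ`. -/
def heatDistribution (f : RealDistribution) (ε : Set.Ioc (0 : ℝ) 1) (x : ℝ) : ℝ :=
  f (heatSchwartz ε x)

/-- For `α < 0`, the norm `‖f‖_{C^α} = sup_{ε ∈ (0, 1]} ε^{-α/2} sup_x |P_ε f(x)|`
(possibly infinite). -/
def negHolderNorm (α : ℝ) (f : RealDistribution) : ℝ≥0∞ :=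
  ⨆ ε : Set.Ioc (0 : ℝ) 1, ENNReal.ofReal ((ε : ℝ) ^ (-α / 2)) * ⨆ x : ℝ, ‖heatDistribution f ε x‖ₑ

/-- The class `C^∞` of bounded smooth functions with bounded derivatives. -/
def IsSmoothBounded (f : ℝ → ℝ) : Prop :=
  ContDiff ℝ (⊤ : ℕ∞) f ∧ ∀ k : ℕ, ∃ C : ℝ, ∀ x, |iteratedDeriv k f x| ≤ C

/-- The distribution `g ↦ ∫ f(y) g(y) dy` given by a smooth function `f` of temperate growth (in
particular by a bounded smooth function with bounded derivatives). -/
def toDistribution (f : ℝ → ℝ) : RealDistribution :=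
  (SchwartzMap.integralCLM ℝ (volume : Measure ℝ)).comp (SchwartzMap.smulLeftCLM ℝ f)

theorem IsSmoothBounded.hasTemperateGrowth {f : ℝ → ℝ} (hf : IsSmoothBounded f) :
    Function.HasTemperateGrowth f := by
  refine ⟨hf.1, fun n => ?_⟩
  obtain ⟨C, hC⟩ := hf.2 n
  refine ⟨0, C, fun x => ?_⟩
  rw [norm_iteratedFDeriv_eq_norm_iteratedDeriv]
  simpa using hC x

theorem toDistribution_apply {f : ℝ → ℝ} (hf : IsSmoothBounded f) (g : 𝓢(ℝ, ℝ)) :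
    toDistribution f g = ∫ y, f y * g y := by
  simp [toDistribution, SchwartzMap.integralCLM_apply,
    SchwartzMap.smulLeftCLM_apply_apply hf.hasTemperateGrowth]

/-- The `C^1` norm `sup |σ| + sup |σ'|` (possibly infinite). -/
def c1Norm (σ : ℝ → ℝ) : ℝ≥0∞ := (⨆ x, ‖σ x‖ₑ) + ⨆ x, ‖deriv σ x‖ₑ

/-! ### Space-time white noise, its filtration and the stochastic integral -/

/-- The Hilbert space `L_2([0, 1] × 𝕋)`. -/
abbrev NoiseSpace : Type := Lp ℝ 2 (volume : Measure (unitInterval × UnitAddCircle))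

/-- The indicator function of a measurable set `A ⊆ [0, 1] × 𝕋` as an element of
`L_2([0, 1] × 𝕋)`. -/
def ind {A : Set (unitInterval × UnitAddCircle)} (hA : MeasurableSet A) : NoiseSpace :=
  indicatorConstLp 2 hA (measure_ne_top volume A) (1 : ℝ)

variable {Ω : Type*} [mΩ : MeasurableSpace Ω]

/-- An isonormal Gaussian family over `L_2([0, 1] × 𝕋)`: a centred Gaussian family of random
variables with `E[ξ(g) ξ(h)] = ⟨g, h⟩`. -/
structure WhiteNoise (P : Measure Ω) where
  toFun : NoiseSpace → Ω → ℝ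
  measurable : ∀ h, Measurable (toFun h)
  gaussian : IsGaussianProcess toFun P
  mean : ∀ h, ∫ ω, toFun h ω ∂P = 0
  covariance : ∀ g h, ∫ ω, toFun g ω * toFun h ω ∂P = inner ℝ g h

variable {P : Measure Ω}

/-- The filtration generated by the white noise, augmented by the null sets:
`𝓕_t = σ(ξ(1_{[0, r) × B}) : r ≤ t, B Borel) ∨ σ(null sets)`. -/
def WhiteNoise.filtration [P.IsComplete] (ξ : WhiteNoise P) : Filtration unitInterval mΩ where
  seq t := (⨆ r : Set.Iic t, ⨆ B : {B : Set UnitAddCircle // MeasurableSet B},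
      MeasurableSpace.comap
        (ξ.toFun (ind ((measurableSet_Iio (a := (r : unitInterval))).prod B.2))) inferInstance) ⊔
    MeasurableSpace.generateFrom {A : Set Ω | P A = 0}
  mono' s t hst := by
    refine sup_le_sup (iSup_le fun r => ?_) le_rfl
    exact le_iSup (fun r : Set.Iic t => ⨆ B : {B : Set UnitAddCircle // MeasurableSet B},
      MeasurableSpace.comap
        (ξ.toFun (ind ((measurableSet_Iio (a := (r : unitInterval))).prod B.2))) inferInstance)
      ⟨r, r.2.trans hst⟩
  le' t := by
    refine sup_le (iSup_le fun r => iSup_le fun B => (ξ.measurable _).comap_le) ?_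
    exact MeasurableSpace.generateFrom_le fun A hA => measurableSet_of_null hA

section Field

variable [P.IsComplete] (ξ : WhiteNoise P)

/-- A random field `f : Ω × [0, 1] × 𝕋 → ℝ` is measurable with respect to the product of the
predictable σ-algebra and the Borel σ-algebra of the torus. -/
def IsPredictableField (f : Ω → unitInterval → UnitAddCircle → ℝ) : Prop :=
  Measurable[ξ.filtration.predictable.prod inferInstance]
    (fun q : (unitInterval × Ω) × UnitAddCircle => f q.1.2 q.1.1 q.2)

/-- An elementary integrand `X(ω) 1_{(a, b]}(r) 1_B(y)` with `X` bounded and `𝓕_a`-measurable. -/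
structure Elementary where
  a : unitInterval
  b : unitInterval
  B : Set UnitAddCircle
  measB : MeasurableSet B
  X : Ω → ℝ
  measX : Measurable[ξ.filtration a] X
  bddX : ∃ C : ℝ, ∀ ω, |X ω| ≤ C

variable {ξ}

open Classical in
/-- The random field `X(ω) 1_{(a, b]}(r) 1_B(y)`. -/
def Elementary.field (e : Elementary ξ) (ω : Ω) (r : unitInterval) (y : UnitAddCircle) : ℝ :=
  if r ∈ Set.Ioc e.a e.b ∧ y ∈ e.B then e.X ω else 0

/-- The stochastic integral `X ξ(1_{(a, b] × B})` of an elementary integrand. -/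
def Elementary.integral (e : Elementary ξ) (ω : Ω) : ℝ :=
  e.X ω * ξ.toFun (ind ((measurableSet_Ioc (a := e.a) (b := e.b)).prod e.measB)) ω

variable (ξ)

/-- `J` is (a version of) the stochastic integral `∫_0^1 ∫_𝕋 f(r, y) ξ(dy, dr)` of the square
integrable integrand `f`: the integrand `f` is the limit in `L_2(Ω × [0, 1] × 𝕋)` of simple
integrands (finite sums of elementary ones) whose integrals converge to `J` in `L_2(Ω)`. -/
def IsStochasticIntegral (f : Ω → unitInterval → UnitAddCircle → ℝ) (J : Ω → ℝ) : Prop :=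
  ∃ l : ℕ → List (Elementary ξ),
    Tendsto (fun n => eLpNorm (fun q : Ω × unitInterval × UnitAddCircle =>
      f q.1 q.2.1 q.2.2 - ((l n).map fun e => e.field q.1 q.2.1 q.2.2).sum) 2
        (P.prod (volume : Measure (unitInterval × UnitAddCircle)))) atTop (𝓝 0) ∧
    Tendsto (fun n => eLpNorm (fun ω => J ω - ((l n).map fun e => e.integral ω).sum) 2 P)
      atTop (𝓝 0)

/-- `J` is (a version of) the stochastic convolution
`∫_s^t ∫_𝕋 p_{t - r}(x, y) f(r, y) ξ(dy, dr)`. -/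
def IsStochasticConvolution (s t : unitInterval) (x : UnitAddCircle) (f : Ω → unitInterval → UnitAddCircle → ℝ)
    (J : Ω → ℝ) : Prop :=
  IsStochasticIntegral ξ
    (fun ω r y => if s < r ∧ r < t then torusKernel ((t : ℝ) - r) (x - y) * f ω r y else 0) J

/-! ### Regularised solutions and the driftless flow -/

/-- `u` is a regularised solution of `(∂_t - Δ) u = b(u) + σ(u) ξ`, `u(0, ·) = u₀`, where `b` is a
distribution of class `C^α`, and `D` is its drift `D^u`. -/
structure IsRegularisedSolution (α : ℝ) (b : RealDistribution) (σ : ℝ → ℝ)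
    (u₀ : C(UnitAddCircle, ℝ)) (u D : Ω → unitInterval → UnitAddCircle → ℝ) : Prop where
  predictable : IsPredictableField ξ u
  continuous : ∀ ω, Continuous fun q : unitInterval × UnitAddCircle => u ω q.1 q.2
  predictable_drift : IsPredictableField ξ D
  drift : ∀ bn : ℕ → ℝ → ℝ, (∀ n, IsSmoothBounded (bn n)) →
    Tendsto (fun n => negHolderNorm α (toDistribution (bn n) - b)) atTop (𝓝 0) →
    ∀ ε : ℝ, 0 < ε → Tendsto (fun n => P {ω | ENNReal.ofReal ε ≤
      ⨆ (t : unitInterval) (x : UnitAddCircle), ‖D ω t x -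
        ∫ r in Set.Iio t, ∫ y, torusKernel ((t : ℝ) - r) (x - y) * bn n (u ω r y)‖ₑ})
      atTop (𝓝 0)
  mild : ∀ (t : unitInterval) (x : UnitAddCircle), IsStochasticConvolution ξ 0 t x
    (fun ω r y => σ (u ω r y)) (fun ω => u ω t x - heatSemigroup t u₀ x - D ω t x)

/-- `φ` is the solution `φ^{Z, s}` of the driftless equation `(∂_t - Δ) φ = σ(φ) ξ` on
`[s, 1] × 𝕋` with `φ(s, ·) = Z`. Only the values of `φ` at times in `[s, 1]` matter (before `s`
it may for instance be extended by `0`). -/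
structure IsDriftlessFlow (σ : ℝ → ℝ) (s : unitInterval) (Z : Ω → UnitAddCircle → ℝ)
    (φ : Ω → unitInterval → UnitAddCircle → ℝ) : Prop where
  predictable : IsPredictableField ξ φ
  continuous : ∀ᵐ ω ∂P, ContinuousOn (fun q : unitInterval × UnitAddCircle => φ ω q.1 q.2)
    (Set.Ici s ×ˢ Set.univ)
  mild : ∀ t : unitInterval, s ≤ t → ∀ x : UnitAddCircle, IsStochasticConvolution ξ s t x
    (fun ω r y => σ (φ ω r y)) (fun ω => φ ω t x - heatSemigroup ((t : ℝ) - s) (Z ω) x)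

/-! ### Conditional norms and the spaces of random fields -/

/-- `‖X‖_{L_{p,q}^𝒢} = ‖ (E[|X|^p | 𝒢])^{1/p} ‖_{L_q}`, with values in `[0, ∞]`. -/
def condNorm (P : Measure Ω) (𝒢 : MeasurableSpace Ω) (p : ℝ) (q : ℝ≥0∞) (X : Ω → ℝ) : ℝ≥0∞ :=
  eLpNorm (fun ω => condLExp 𝒢 P (fun ω' => ‖X ω'‖ₑ ^ p) ω ^ (1 / p)) q P

/-- The bracket `[f]_{𝒱_p^β[S, T]}`, the supremum over `x ∈ 𝕋` and `S ≤ s < t ≤ T` of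
`‖f_t(x) - P_{t-s} f_s(x)‖_{L_{p,∞}^{𝓕_s}} / (t - s)^β`. -/
def bracketV (p β : ℝ) (S T : unitInterval) (f : Ω → unitInterval → UnitAddCircle → ℝ) : ℝ≥0∞ :=
  ⨆ (x : UnitAddCircle) (s : unitInterval) (t : unitInterval) (_ : S ≤ s) (_ : s < t) (_ : t ≤ T),
    condNorm P (ξ.filtration s) p ∞
      (fun ω => f ω t x - heatSemigroup ((t : ℝ) - s) (f ω s) x) /
        ENNReal.ofReal (((t : ℝ) - s) ^ β)

/-- The space `𝒱_p^β[0, 1]`. -/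
structure MemV (p β : ℝ) (f : Ω → unitInterval → UnitAddCircle → ℝ) : Prop where
  predictable : IsPredictableField ξ f
  bounded : (⨆ (t : unitInterval) (x : UnitAddCircle), eLpNorm (fun ω => f ω t x) (ENNReal.ofReal p) P) < ∞
  bracket : bracketV ξ p β 0 1 f < ∞

/-- `u` is a regularised solution with drift `D` which lies in the class `𝒰_p^β`. -/
structure MemU (p β α : ℝ) (b : RealDistribution) (σ : ℝ → ℝ)
    (u₀ : C(UnitAddCircle, ℝ)) (u D : Ω → unitInterval → UnitAddCircle → ℝ) : Prop where
  solution : IsRegularisedSolution ξ α b σ u₀ u D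
  drift_mem : MemV ξ p β D

end Field

end SHE

end

set_option linter.unusedSectionVars false
set_option linter.unusedVariables false

namespace SHE

/-! ### The heat kernel on the torus -/

/-! Applying P_{t-s} to the mild equation of u at time s turns its noise term into the integral of
p_{t-r}(x,y) σ(u(r,y)) over r < s, by Chapman-Kolmogorov and a stochastic Fubini theorem.
Subtracting this from the mild equation at time t, and then subtracting the equation of the
driftless flow φ, leaves u(t,x) - φ(t,x) = (D_t(x) - P_{t-s} D_s(x)) + ∫_s^t ∫ p_{t-r}(x,y) (σ(u) -
σ(φ))(r,y) ξ(dy,dr), which is `isStochasticConvolution_sub_driftless`. The distributional drift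
enters only through the first term, and that term is what the bracket of D measures.

The second term is handled by a Burkholder-type inequality with the L_p norms inside the integral:
given 𝓕_s, the squared L_p norm of a stochastic convolution is at most a constant c_p times ∫∫
p_{t-r}(x,y)² ‖w(r,y)‖² dy dr (`condBound_convolution`). It rests on one elementary fact. If a
Gaussian variable Z of variance v is independent of (S, X), then ‖S + XZ‖_p² ≤ ‖S‖_p² + c_p v ‖X‖_p²
(`eLpNorm_add_mul_sq_le`). Iterating over the disjoint, time-ordered rectangles of a simple
integrand gives the bound for simple integrals. The Itô isometry and Fatou's lemma carry it to the
limit. Conditioning on 𝓕_s is expressed by restricting to events A ∈ 𝓕_s, whose indicators can be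
absorbed into the integrand (`condNorm_le_iff`, `eLpNorm_gridList_sq_le`).

Since σ is Lipschitz with constant M, this is a Volterra inequality for the conditional norm of u -
φ, with kernel ∫ p_{t-r}(x,y)² dy ≤ C (t-r)^{-1/2}. It is solved with the weighted supremum G of
e^{-l(r-s)} ‖u(r,y) - φ(r,y)‖. The weight contributes a factor of order l^{-1/4}, so a large l,
depending only on p and M, gives G ≤ K + G/2, where K is the bracket of D times (t-s)^β. Boundedness
of σ makes G finite, so G ≤ 2K, and the constant is N = 2e^l (`condNorm_sub_driftless_le_exp`). -/

theorem heatKernelReal_nonneg (t x : ℝ) : 0 ≤ heatKernelReal t x := by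
  unfold heatKernelReal; positivity

theorem measurable_heatKernelReal (t : ℝ) : Measurable (heatKernelReal t) := by
  unfold heatKernelReal; fun_prop

/-- With the parameter 1/(4πt), the sum over images is a Jacobi theta function. Its functional
equation and its continuity then yield the regularity and the size of the heat kernel. -/
theorem hasSum_heatKernelReal {t : ℝ} (ht : 0 < t) (x : ℝ) :
    HasSum (fun k : ℤ => heatKernelReal t (x + k))
      ((Real.sqrt (4 * Real.pi * t))⁻¹ * HurwitzZeta.evenKernel x (1 / (4 * Real.pi * t))) := by
  have hpi := Real.pi_pos
  have h := (HurwitzZeta.hasSum_int_evenKernel x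
    (t := 1 / (4 * Real.pi * t)) (by positivity)).mul_left (Real.sqrt (4 * Real.pi * t))⁻¹
  refine h.congr_fun fun k => ?_
  unfold heatKernelReal
  congr 2
  field_simp
  ring

/-- Poisson summation, in the guise of the functional equation of the theta kernel: the sum over
images becomes a Fourier series, and the Gaussian prefactor cancels the square root from the
functional equation. -/
theorem torusKernel_eq_cosKernel {t : ℝ} (ht : 0 < t) (a : UnitAddCircle) :
    torusKernel t a = HurwitzZeta.cosKernel a (4 * Real.pi * t) := by
  induction a using QuotientAddGroup.induction_on with | H x =>
  have h := HurwitzZeta.evenKernel_functional_equation x (1 / (4 * Real.pi * t))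
  refine (hasSum_heatKernelReal ht x).tsum_eq.trans ?_
  have hp : 0 < 4 * Real.pi * t := by positivity
  rw [h, one_div_one_div, ← Real.sqrt_eq_rpow, Real.sqrt_div zero_le_one, Real.sqrt_one,
    one_div_one_div, ← mul_assoc, inv_mul_cancel₀ (Real.sqrt_pos.2 hp).ne', one_mul]

/-- For nonpositive times the real square root is 0 and so is its inverse. Hence the kernel extends
by zero and can be used at all times without a side condition. -/
theorem torusKernel_of_nonpos {t : ℝ} (ht : t ≤ 0) (a : UnitAddCircle) : torusKernel t a = 0 := by
  induction a using QuotientAddGroup.induction_on with | H x =>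
  have : Real.sqrt (4 * Real.pi * t) = 0 :=
    Real.sqrt_eq_zero_of_nonpos (mul_nonpos_of_nonneg_of_nonpos (by positivity) ht)
  refine (tsum_congr fun k => ?_).trans tsum_zero
  simp [heatKernelReal, this]

theorem torusKernel_nonneg (t : ℝ) (a : UnitAddCircle) : 0 ≤ torusKernel t a := by
  induction a using QuotientAddGroup.induction_on with | H x =>
  exact tsum_nonneg fun k => heatKernelReal_nonneg _ _

/-- The quotient map ℝ × ℝ → ℝ × 𝕋 is open, so continuity may be checked upstairs. There the kernel
is the real part of `jacobiTheta₂` at a point whose second argument i·t lies in the upper half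
plane. -/
theorem continuousAt_cosKernel (q : ℝ × UnitAddCircle) (hq : 0 < q.1) :
    ContinuousAt (fun q : ℝ × UnitAddCircle => HurwitzZeta.cosKernel q.2 q.1) q := by
  obtain ⟨t, a⟩ := q
  induction a using QuotientAddGroup.induction_on with | H x =>
  have hom : IsOpenQuotientMap (Prod.map (id : ℝ → ℝ) (fun x : ℝ => (x : UnitAddCircle))) :=
    IsOpenQuotientMap.id.prodMap QuotientAddGroup.isOpenQuotientMap_mk
  rw [show (t, (QuotientAddGroup.mk x : UnitAddCircle))
    = Prod.map (id : ℝ → ℝ) (fun x : ℝ => (x : UnitAddCircle)) (t, x) from rfl,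
    ← hom.continuousAt_comp_iff]
  have : ((fun q : ℝ × UnitAddCircle => HurwitzZeta.cosKernel q.2 q.1) ∘
      (Prod.map (id : ℝ → ℝ) (fun x : ℝ => (x : UnitAddCircle))))
      = fun q : ℝ × ℝ => (jacobiTheta₂ (q.2 : ℂ) (Complex.I * (q.1 : ℂ))).re := by
    ext q
    rw [← HurwitzZeta.cosKernel_def, Complex.ofReal_re]
    rfl
  rw [this]
  refine Complex.continuous_re.continuousAt.comp ?_
  refine ContinuousAt.comp (g := fun p : ℂ × ℂ => jacobiTheta₂ p.1 p.2)
    (f := fun q : ℝ × ℝ => ((q.2 : ℂ), Complex.I * (q.1 : ℂ))) ?_ (by fun_prop)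
  exact continuousAt_jacobiTheta₂ _ (by simpa using hq)

theorem continuousAt_torusKernel (q : ℝ × UnitAddCircle) (hq : 0 < q.1) :
    ContinuousAt (fun q : ℝ × UnitAddCircle => torusKernel q.1 q.2) q := by
  have h : ContinuousAt (fun q : ℝ × UnitAddCircle =>
      HurwitzZeta.cosKernel q.2 (4 * Real.pi * q.1)) q :=
    ContinuousAt.comp (f := fun q : ℝ × UnitAddCircle => (4 * Real.pi * q.1, q.2))
      (continuousAt_cosKernel (4 * Real.pi * q.1, q.2) (by simp only; positivity)) (by fun_prop)
  refine h.congr ?_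
  filter_upwards [(isOpen_Ioi.preimage continuous_fst).mem_nhds (show q ∈ Prod.fst ⁻¹' Set.Ioi 0
    from hq)] with r hr
  exact (torusKernel_eq_cosKernel hr _).symm

theorem continuous_torusKernel {t : ℝ} (ht : 0 < t) : Continuous (torusKernel t) :=
  continuous_iff_continuousAt.2 fun a =>
    ContinuousAt.comp (f := fun a : UnitAddCircle => (t, a)) (continuousAt_torusKernel (t, a) ht)
      (by fun_prop)

open Classical in
theorem measurable_torusKernel : Measurable fun q : ℝ × UnitAddCircle => torusKernel q.1 q.2 := by
  have : (fun q : ℝ × UnitAddCircle => torusKernel q.1 q.2)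
      = (Set.Ioi (0 : ℝ) ×ˢ Set.univ).piecewise (fun q => torusKernel q.1 q.2) 0 := by
    ext q
    by_cases hq : 0 < q.1
    · rw [Set.piecewise_eq_of_mem _ _ _ (by simpa using hq)]
    · rw [Set.piecewise_eq_of_notMem _ _ _ (by simpa using hq), torusKernel_of_nonpos (not_lt.1 hq)]
      rfl
  rw [this]
  have ho : IsOpen (Set.Ioi (0 : ℝ) ×ˢ (Set.univ : Set UnitAddCircle)) :=
    isOpen_Ioi.prod isOpen_univ
  exact ContinuousOn.measurable_piecewise
    (fun q hq => (continuousAt_torusKernel q hq.1).continuousWithinAt)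
    continuous_zero.continuousOn ho.measurableSet

/-- The Fourier coefficients are positive, so the kernel is largest at the origin. There the
functional equation gives (4πt)^{-1/2} times a theta sum at 1/(4πt), every term of which is
nonincreasing in that argument. For t ≤ 1 the sum is thus at most its value at 1/(4π). -/
theorem exists_torusKernel_le : ∃ C : ℝ, 0 ≤ C ∧ ∀ t : ℝ, 0 < t → t ≤ 1 → ∀ a : UnitAddCircle,
    torusKernel t a ≤ C * t ^ (-(1 / 2) : ℝ) := by
  have hpi := Real.pi_pos
  set t₁ : ℝ := 1 / (4 * Real.pi) with ht₁
  have ht₁0 : 0 < t₁ := by positivity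
  have hE := HurwitzZeta.hasSum_int_evenKernel 0 ht₁0
  refine ⟨(Real.sqrt (4 * Real.pi))⁻¹ * HurwitzZeta.evenKernel ((0 : ℝ) : UnitAddCircle) t₁,
    by have := hE.nonneg (fun n => (Real.exp_pos _).le); positivity, fun t ht ht1 a => ?_⟩
  have h4 : 0 < 4 * Real.pi * t := by positivity
  have h1 : torusKernel t a ≤ HurwitzZeta.cosKernel ((0 : ℝ) : UnitAddCircle) (4 * Real.pi * t) := by
    rw [torusKernel_eq_cosKernel ht]
    induction a using QuotientAddGroup.induction_on with | H x =>
    have hx := HurwitzZeta.hasSum_int_cosKernel x h4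
    have h0 := HurwitzZeta.hasSum_int_cosKernel 0 h4
    have h0' := Complex.hasSum_re h0
    have hx' := Complex.hasSum_re hx
    refine hasSum_le (fun n => ?_) hx' h0'
    refine (Complex.re_le_norm _).trans ?_
    rw [norm_mul, show 2 * (Real.pi : ℂ) * Complex.I * x * n
      = ((2 * Real.pi * x * n : ℝ) : ℂ) * Complex.I by push_cast; ring,
      Complex.norm_exp_ofReal_mul_I]
    rw [one_mul, Complex.norm_real, Real.norm_of_nonneg (Real.exp_pos _).le, Complex.ofReal_zero,
      mul_zero, zero_mul, Complex.exp_zero, one_mul, Complex.ofReal_re]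
  have h2 : HurwitzZeta.cosKernel ((0 : ℝ) : UnitAddCircle) (4 * Real.pi * t)
      = (Real.sqrt (4 * Real.pi * t))⁻¹
        * HurwitzZeta.evenKernel ((0 : ℝ) : UnitAddCircle) (1 / (4 * Real.pi * t)) := by
    rw [← torusKernel_eq_cosKernel ht]
    exact (hasSum_heatKernelReal ht 0).tsum_eq
  have h3 : HurwitzZeta.evenKernel ((0 : ℝ) : UnitAddCircle) (1 / (4 * Real.pi * t))
      ≤ HurwitzZeta.evenKernel ((0 : ℝ) : UnitAddCircle) t₁ := by
    refine hasSum_le (fun n => ?_) (HurwitzZeta.hasSum_int_evenKernel 0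
      (t := 1 / (4 * Real.pi * t)) (by positivity)) hE
    have : t₁ ≤ 1 / (4 * Real.pi * t) := by
      rw [ht₁]
      exact one_div_le_one_div_of_le h4 (by nlinarith)
    refine Real.exp_le_exp.2 ?_
    have h5 : 0 ≤ Real.pi * ((n : ℝ) + 0) ^ 2 := by positivity
    nlinarith
  refine h1.trans (h2.trans_le ?_)
  rw [Real.sqrt_mul (by positivity), mul_inv, Real.rpow_neg ht.le, ← Real.sqrt_eq_rpow,
    mul_right_comm _ _ (Real.sqrt t)⁻¹]
  gcongr

theorem lintegral_heatKernelReal {t : ℝ} (ht : 0 < t) (m : ℝ) :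
    ∫⁻ z, ENNReal.ofReal (heatKernelReal t (z - m)) = 1 := by
  rw [← lintegral_gaussianPDFReal_eq_one m (v := Real.toNNReal (2 * t))
    (by simpa using ht)]
  refine lintegral_congr fun z => ?_
  congr 1
  simp only [heatKernelReal, gaussianPDFReal]
  rw [Real.coe_toNNReal _ (by positivity)]
  rw [show 2 * Real.pi * (2 * t) = 4 * Real.pi * t by ring, show 2 * (2 * t) = 4 * t by ring,
    neg_div]

/-- Completing the square in z: the product of two Gaussians is their convolution at (x, w) times a
normalised Gaussian in z with time parameter ts/(t+s), which later integrates to one. -/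
theorem heatKernelReal_mul {s t : ℝ} (hs : 0 < s) (ht : 0 < t) (x w z : ℝ) :
    heatKernelReal t (x - z) * heatKernelReal s (z - w)
      = heatKernelReal (t + s) (x - w)
        * heatKernelReal (t * s / (t + s)) (z - (s * x + t * w) / (t + s)) := by
  have hpi := Real.pi_pos
  have hts : 0 < t + s := by positivity
  simp only [heatKernelReal]
  rw [mul_mul_mul_comm, mul_mul_mul_comm (Real.sqrt (4 * Real.pi * (t + s)))⁻¹, ← mul_inv,
    ← mul_inv, ← Real.sqrt_mul (by positivity), ← Real.sqrt_mul (by positivity), ← Real.exp_add,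
    ← Real.exp_add]
  congr 1
  · congr 2
    field_simp
  · congr 1
    field_simp
    ring

theorem lintegral_heatKernelReal_mul {s t : ℝ} (hs : 0 < s) (ht : 0 < t) (x w : ℝ) :
    ∫⁻ z, ENNReal.ofReal (heatKernelReal t (x - z)) * ENNReal.ofReal (heatKernelReal s (z - w))
      = ENNReal.ofReal (heatKernelReal (t + s) (x - w)) := by
  simp_rw [← ENNReal.ofReal_mul (heatKernelReal_nonneg _ _), heatKernelReal_mul hs ht,
    ENNReal.ofReal_mul (heatKernelReal_nonneg _ _)]
  rw [lintegral_const_mul _ (by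
      have := measurable_heatKernelReal (t * s / (t + s)); fun_prop),
    lintegral_heatKernelReal (by positivity), mul_one]

theorem lintegral_tsum_add_intCast {f : ℝ → ℝ≥0∞} (hf : Measurable f) :
    ∫⁻ x in Set.Ioc (0 : ℝ) 1, ∑' k : ℤ, f (x + k) = ∫⁻ x, f x := by
  rw [lintegral_tsum (fun k => by fun_prop), ← setLIntegral_univ f, ← iUnion_Ioc_intCast ℝ,
    lintegral_iUnion (fun _ => measurableSet_Ioc) (Set.pairwise_disjoint_Ioc_intCast ℝ)]
  refine tsum_congr fun k => ?_
  have := (measurePreserving_add_right volume (k : ℝ)).setLIntegral_comp_preimage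
    (s := Set.Ioc (k : ℝ) (k + 1)) measurableSet_Ioc hf
  rw [← this]
  simp

theorem ofReal_torusKernel {t : ℝ} (ht : 0 < t) (x : ℝ) :
    ENNReal.ofReal (torusKernel t x) = ∑' k : ℤ, ENNReal.ofReal (heatKernelReal t (x + k)) :=
  ENNReal.ofReal_tsum_of_nonneg (fun _ => heatKernelReal_nonneg _ _)
    (hasSum_heatKernelReal ht x).summable

/-- Unfolding: summing over images on a fundamental domain is integrating over the line. The
summation index changes sign because x - z + k = x - (z - k). -/
theorem lintegral_torusKernel_mul {t : ℝ} (ht : 0 < t) (x : ℝ) {g : UnitAddCircle → ℝ≥0∞}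
    (hg : Measurable g) :
    ∫⁻ z, ENNReal.ofReal (torusKernel t (x - z)) * g z
      = ∫⁻ z : ℝ, ENNReal.ofReal (heatKernelReal t (x - z)) * g z := by
  have hh := measurable_heatKernelReal t
  have hm : Measurable fun z : ℝ => (z : UnitAddCircle) := AddCircle.measurable_mk'
  rw [← UnitAddCircle.lintegral_preimage 0, zero_add,
    ← lintegral_tsum_add_intCast (by fun_prop)]
  refine lintegral_congr fun z => ?_
  rw [← AddCircle.coe_sub, ofReal_torusKernel ht, ← ENNReal.tsum_mul_right,
    ← (Equiv.neg ℤ).tsum_eq]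
  refine tsum_congr fun k => ?_
  have : ((z + k : ℝ) : UnitAddCircle) = z := by
    rw [AddCircle.coe_add]; simp
  rw [this]
  simp only [Equiv.neg_apply, Int.cast_neg]
  congr 3
  ring

/-- The heat kernel on the torus has mass one. -/
theorem lintegral_torusKernel {t : ℝ} (ht : 0 < t) (x : UnitAddCircle) :
    ∫⁻ z, ENNReal.ofReal (torusKernel t (x - z)) = 1 := by
  induction x using QuotientAddGroup.induction_on with | H x =>
  have h := lintegral_torusKernel_mul ht x (g := fun _ => 1) measurable_const
  simp only [mul_one] at h
  refine h.trans ((lintegral_congr fun z => ?_).trans (lintegral_heatKernelReal ht x))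
  congr 1
  unfold heatKernelReal
  rw [← neg_sq, neg_sub]

/-- The Chapman-Kolmogorov equation. -/
theorem lintegral_torusKernel_mul_torusKernel {s t : ℝ} (hs : 0 < s) (ht : 0 < t)
    (x y : UnitAddCircle) :
    ∫⁻ z, ENNReal.ofReal (torusKernel t (x - z)) * ENNReal.ofReal (torusKernel s (z - y))
      = ENNReal.ofReal (torusKernel (t + s) (x - y)) := by
  induction x using QuotientAddGroup.induction_on with | H x =>
  induction y using QuotientAddGroup.induction_on with | H y =>
  have hK := (continuous_torusKernel hs).measurable
  have hh := measurable_heatKernelReal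
  refine (lintegral_torusKernel_mul ht x (by fun_prop)).trans ?_
  have h1 : ∀ z : ℝ, ENNReal.ofReal (torusKernel s ((z : UnitAddCircle) - (y : UnitAddCircle)))
      = ∑' k : ℤ, ENNReal.ofReal (heatKernelReal s (z - (y - k))) := fun z => by
    rw [← AddCircle.coe_sub, ofReal_torusKernel hs]
    refine tsum_congr fun k => ?_
    congr 2; ring
  have h2 := ofReal_torusKernel (show 0 < t + s by positivity) (x - y)
  rw [AddCircle.coe_sub] at h2
  refine Eq.trans ?_ h2.symm
  calc _ = ∫⁻ z : ℝ, ∑' k : ℤ, ENNReal.ofReal (heatKernelReal t (x - z)) *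
        ENNReal.ofReal (heatKernelReal s (z - (y - k))) :=
        lintegral_congr fun z => by rw [ENNReal.tsum_mul_left, ← h1]
    _ = _ := by
        rw [lintegral_tsum (fun k => by have := hh t; have := hh s; fun_prop)]
        refine tsum_congr fun k => ?_
        rw [lintegral_heatKernelReal_mul hs ht]
        ring_nf

/-! ### The white noise -/

section Noise

theorem inner_ind {A B : Set (unitInterval × UnitAddCircle)} (hA : MeasurableSet A)
    (hB : MeasurableSet B) : inner ℝ (ind hA) (ind hB) = volume.real (A ∩ B) := by
  unfold ind
  rw [MeasureTheory.L2.inner_indicatorConstLp_indicatorConstLp]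
  simp

variable {Ω : Type*} [mΩ : MeasurableSpace Ω] {P : Measure Ω} (ξ : WhiteNoise P)

namespace WhiteNoise

theorem memLp (h : NoiseSpace) {q : ℝ≥0∞} (hq : q ≠ ∞) : MemLp (ξ.toFun h) q P :=
  (ξ.gaussian.hasGaussianLaw_eval h).memLp hq

/-- The law of `ξ(h)` is centred Gaussian with variance `‖h‖²`. -/
theorem map_eq (h : NoiseSpace) :
    P.map (ξ.toFun h) = gaussianReal 0 (Real.toNNReal (inner ℝ h h)) := by
  rw [(ξ.gaussian.hasGaussianLaw_eval h).map_eq_gaussianReal, ξ.mean,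
    variance_of_integral_eq_zero (ξ.measurable h).aemeasurable (ξ.mean h), ← ξ.covariance]
  simp only [pow_two]

/-- Linearity follows from the covariance alone: the second moment of ξ(g+h) - ξ(g) - ξ(h) expands
to ‖(g+h) - g - h‖² = 0. -/
theorem add_ae (g h : NoiseSpace) :
    ξ.toFun (g + h) =ᵐ[P] fun ω => ξ.toFun g ω + ξ.toFun h ω := by
  have hi : ∀ a b, Integrable (fun ω => ξ.toFun a ω * ξ.toFun b ω) P := fun a b =>
    (ξ.memLp a (q := 2) ENNReal.ofNat_ne_top).integrable_mul
      (ξ.memLp b (q := 2) ENNReal.ofNat_ne_top)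
  have h0 : ∫ ω, (ξ.toFun (g + h) ω - (ξ.toFun g ω + ξ.toFun h ω)) ^ 2 ∂P = 0 := by
    have : ∀ ω, (ξ.toFun (g + h) ω - (ξ.toFun g ω + ξ.toFun h ω)) ^ 2
        = ξ.toFun (g + h) ω * ξ.toFun (g + h) ω - 2 * (ξ.toFun (g + h) ω * ξ.toFun g ω)
          - 2 * (ξ.toFun (g + h) ω * ξ.toFun h ω) + ξ.toFun g ω * ξ.toFun g ω
          + 2 * (ξ.toFun g ω * ξ.toFun h ω) + ξ.toFun h ω * ξ.toFun h ω := fun ω => by ring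
    simp_rw [this]
    rw [integral_add, integral_add, integral_add, integral_sub, integral_sub, integral_const_mul,
      integral_const_mul, integral_const_mul]
    · simp only [ξ.covariance, inner_add_left, inner_add_right, real_inner_comm g h]
      ring
    all_goals
      repeat' first | exact hi _ _ | exact (hi _ _).const_mul _ | refine Integrable.sub ?_ ?_ |
        refine Integrable.add ?_ ?_
  have hint : Integrable (fun ω => (ξ.toFun (g + h) ω - (ξ.toFun g ω + ξ.toFun h ω)) ^ 2) P :=
    ((ξ.memLp (g + h) ENNReal.ofNat_ne_top).sub ((ξ.memLp g ENNReal.ofNat_ne_top).add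
      (ξ.memLp h ENNReal.ofNat_ne_top))).integrable_sq
  filter_upwards [(integral_eq_zero_iff_of_nonneg (fun ω => sq_nonneg _) hint).1 h0] with ω hω
  have := pow_eq_zero_iff two_ne_zero |>.1 hω
  linarith

theorem union_ae {A B : Set (unitInterval × UnitAddCircle)} (hA : MeasurableSet A)
    (hB : MeasurableSet B) (hAB : Disjoint A B) :
    ξ.toFun (ind (hA.union hB)) =ᵐ[P] fun ω => ξ.toFun (ind hA) ω + ξ.toFun (ind hB) ω := by
  have : ind (hA.union hB) = ind hA + ind hB :=
    indicatorConstLp_disjoint_union hA hB (measure_ne_top _ _) (measure_ne_top _ _) hAB 1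
  rw [this]
  exact ξ.add_ae _ _

/-- The σ-algebra generated by `ξ(h)`, `h ∈ K`, and by the null sets. -/
@[reducible]
def sigmaAlg (K : Set NoiseSpace) : MeasurableSpace Ω :=
  (⨆ h : K, MeasurableSpace.comap (ξ.toFun h) inferInstance) ⊔
    MeasurableSpace.generateFrom {A : Set Ω | P A = 0}

theorem sigmaAlg_le [P.IsComplete] (K : Set NoiseSpace) : ξ.sigmaAlg K ≤ mΩ :=
  sup_le (iSup_le fun _ => (ξ.measurable _).comap_le)
    (MeasurableSpace.generateFrom_le fun _ hA => measurableSet_of_null hA)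

theorem measurable_sigmaAlg {K : Set NoiseSpace} {h : NoiseSpace} (hh : h ∈ K) :
    Measurable[ξ.sigmaAlg K] (ξ.toFun h) := by
  rw [measurable_iff_comap_le]
  exact (le_iSup (fun h : K => MeasurableSpace.comap (ξ.toFun h) inferInstance) ⟨h, hh⟩).trans
    le_sup_left

theorem filtration_le_sigmaAlg [P.IsComplete] {K : Set NoiseSpace} {t : unitInterval}
    (hK : ∀ r ≤ t, ∀ (B : Set UnitAddCircle) (hB : MeasurableSet B),
      ind ((measurableSet_Iio (a := r)).prod hB) ∈ K) :
    ξ.filtration t ≤ ξ.sigmaAlg K := by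
  refine sup_le (iSup_le fun r => iSup_le fun B => ?_) le_sup_right
  exact (ξ.measurable_sigmaAlg (hK r r.2 B B.2)).comap_le

/-- The sets that agree almost everywhere with a set of the unaugmented σ-algebra form a σ-algebra,
and it contains the null sets. So augmentation does not affect independence. -/
theorem exists_ae_eq_of_measurableSet_sigmaAlg {K : Set NoiseSpace} {A : Set Ω}
    (hA : MeasurableSet[ξ.sigmaAlg K] A) :
    ∃ A', MeasurableSet[⨆ h : K, MeasurableSpace.comap (ξ.toFun h) inferInstance] A' ∧
      A =ᵐ[P] A' := by
  have hle : ξ.sigmaAlg K ≤ eventuallyMeasurableSpace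
      (⨆ h : K, MeasurableSpace.comap (ξ.toFun h) inferInstance) (ae P) := by
    refine sup_le (fun A hA => ⟨A, hA, EventuallyEq.rfl⟩)
      (MeasurableSpace.generateFrom_le fun A hA => ⟨∅, @MeasurableSet.empty _ (_), ?_⟩)
    exact ae_eq_empty.2 hA
  exact hle A hA

/-- Jointly Gaussian families that are uncorrelated are independent. The null sets are removed by
passing to almost everywhere equal sets. -/
theorem indep_sigmaAlg {K K' : Set NoiseSpace}
    (h : ∀ g ∈ K, ∀ g' ∈ K', inner ℝ g g' = 0) : Indep (ξ.sigmaAlg K) (ξ.sigmaAlg K') P := by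
  have hG : IsGaussianProcess (Sum.elim (fun g : K => ξ.toFun g) (fun g : K' => ξ.toFun g)) P := by
    have := ξ.gaussian.comp_right (Sum.elim (fun g : K => (g : NoiseSpace))
      (fun g : K' => (g : NoiseSpace)))
    rwa [Sum.comp_elim] at this
  have hI := hG.indepFun_of_covariance_eq_zero (fun s => (ξ.measurable _).aemeasurable)
    (fun s => (ξ.measurable _).aemeasurable) (fun s t => by
      have := ξ.gaussian.isProbabilityMeasure
      rw [covariance_eq_sub (ξ.memLp _ ENNReal.ofNat_ne_top) (ξ.memLp _ ENNReal.ofNat_ne_top)]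
      simp only [ξ.mean, Pi.mul_apply, ξ.covariance, h s s.2 t t.2]
      simp)
  rw [Indep_iff]
  intro A B hA hB
  obtain ⟨A', hA', hAA'⟩ := ξ.exists_ae_eq_of_measurableSet_sigmaAlg hA
  obtain ⟨B', hB', hBB'⟩ := ξ.exists_ae_eq_of_measurableSet_sigmaAlg hB
  rw [measure_congr hAA', measure_congr hBB', measure_congr (hAA'.inter hBB')]
  rw [IndepFun_iff] at hI
  have key : ∀ L : Set NoiseSpace, (⨆ h : L, MeasurableSpace.comap (ξ.toFun h) inferInstance)
      = MeasurableSpace.comap (fun ω (g : L) => ξ.toFun g ω) MeasurableSpace.pi := fun L => by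
    simp only [MeasurableSpace.pi, MeasurableSpace.comap_iSup, MeasurableSpace.comap_comp]
    rfl
  rw [key] at hA' hB'
  exact hI _ _ hA' hB'

end WhiteNoise

end Noise

/-! ### The isometry property of the stochastic integral -/

section Isometry

variable {Ω : Type*} [mΩ : MeasurableSpace Ω] {P : Measure Ω} [IsProbabilityMeasure P]
  [P.IsComplete] {ξ : WhiteNoise P}

theorem integral_mul_of_indep {m m' : MeasurableSpace Ω} (hm : m ≤ mΩ) (hm' : m' ≤ mΩ)
    (h : Indep m m' P) {X Y : Ω → ℝ} (hX : Measurable[m] X) (hY : Measurable[m'] Y) :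
    ∫ ω, X ω * Y ω ∂P = (∫ ω, X ω ∂P) * ∫ ω, Y ω ∂P := by
  have hXY : IndepFun X Y P := by
    rw [IndepFun_iff_Indep]
    exact indep_of_indep_of_le_left (indep_of_indep_of_le_right h hY.comap_le) hX.comap_le
  exact hXY.integral_fun_mul_eq_mul_integral
    (hX.mono hm le_rfl).aestronglyMeasurable (hY.mono hm' le_rfl).aestronglyMeasurable

variable (ξ) in
/-- The part of the Gaussian space that is generated by the noise up to time `a`. -/
noncomputable def pastSet (a : unitInterval) : Set NoiseSpace :=
  {h | ∀ (Q : Set (unitInterval × UnitAddCircle)) (hQ : MeasurableSet Q),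
    Q ⊆ Set.Ioi a ×ˢ Set.univ → inner ℝ h (ind hQ) = 0}

/-- The part of the Gaussian space that is generated by the noise after time `a`. -/
noncomputable def futureSet (a : unitInterval) : Set NoiseSpace :=
  {h | ∃ (Q : Set (unitInterval × UnitAddCircle)) (hQ : MeasurableSet Q),
    Q ⊆ Set.Ioi a ×ˢ Set.univ ∧ h = ind hQ}

theorem ind_mem_pastSet {a : unitInterval} {Q : Set (unitInterval × UnitAddCircle)}
    (hQ : MeasurableSet Q) (h : Q ⊆ Set.Iic a ×ˢ Set.univ) : ind hQ ∈ pastSet a := by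
  intro R hR hRa
  have : Q ∩ R = ∅ := by
    ext x
    simp only [Set.mem_inter_iff, Set.mem_empty_iff_false, iff_false, not_and]
    intro hx hx'
    exact absurd (Set.mem_Ioi.1 (hRa hx').1) (not_lt.2 (h hx).1)
  rw [inner_ind, this]
  simp

theorem indep_past_future (a : unitInterval) :
    Indep (ξ.sigmaAlg (pastSet a)) (ξ.sigmaAlg (futureSet a)) P := by
  refine ξ.indep_sigmaAlg fun g hg g' hg' => ?_
  obtain ⟨Q, hQ, hQa, rfl⟩ := hg'
  exact hg Q hQ hQa

theorem filtration_le_past (a : unitInterval) : ξ.filtration a ≤ ξ.sigmaAlg (pastSet a) :=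
  ξ.filtration_le_sigmaAlg fun r hr B hB => ind_mem_pastSet _ fun x hx =>
    ⟨(le_of_lt (Set.mem_Iio.1 hx.1)).trans hr, trivial⟩

namespace Elementary

/-- The rectangle `(a, b] × B` of an elementary integrand. -/
noncomputable def rect (e : Elementary ξ) : Set (unitInterval × UnitAddCircle) := Set.Ioc e.a e.b ×ˢ e.B

theorem measurableSet_rect (e : Elementary ξ) : MeasurableSet e.rect :=
  measurableSet_Ioc.prod e.measB

theorem field_eq (e : Elementary ξ) (ω : Ω) (r : unitInterval) (y : UnitAddCircle) :
    e.field ω r y = e.X ω * e.rect.indicator (fun _ => 1) (r, y) := by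
  classical
  by_cases h : r ∈ Set.Ioc e.a e.b ∧ y ∈ e.B
  · rw [field, if_pos h, Set.indicator_of_mem (show (r, y) ∈ e.rect from h), mul_one]
  · rw [field, if_neg h, Set.indicator_of_notMem (show (r, y) ∉ e.rect from h), mul_zero]

theorem integral_eq (e : Elementary ξ) (ω : Ω) :
    e.integral ω = e.X ω * ξ.toFun (ind e.measurableSet_rect) ω := rfl

theorem measurable_X (e : Elementary ξ) : Measurable e.X :=
  e.measX.mono (ξ.filtration.le e.a) le_rfl

theorem memLp_X (e : Elementary ξ) (q : ℝ≥0∞) : MemLp e.X q P := by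
  obtain ⟨C, hC⟩ := e.bddX
  exact MemLp.of_bound e.measurable_X.aestronglyMeasurable C (.of_forall hC)

theorem measurable_integral (e : Elementary ξ) : Measurable e.integral :=
  e.measurable_X.mul (ξ.measurable _)

theorem memLp_integral (e : Elementary ξ) {q : ℝ≥0∞} (hq : q ≠ ∞) : MemLp e.integral q P :=
  MemLp.mul' (q := q) (p := ∞) (r := q) (ξ.memLp _ hq) (e.memLp_X ∞)

theorem measurable_field (e : Elementary ξ) :
    Measurable fun q : Ω × unitInterval × UnitAddCircle => e.field q.1 q.2.1 q.2.2 := by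
  simp_rw [field_eq]
  exact (e.measurable_X.comp measurable_fst).mul
    ((measurable_const.indicator e.measurableSet_rect).comp measurable_snd)

theorem exists_field_le (e : Elementary ξ) : ∃ C : ℝ, ∀ ω r y, |e.field ω r y| ≤ C := by
  obtain ⟨C, hC⟩ := e.bddX
  refine ⟨C, fun ω r y => ?_⟩
  have h0 := (abs_nonneg _).trans (hC ω)
  unfold field
  split_ifs
  · exact hC ω
  · simpa using h0

/-- The earlier rectangle is cut at the start a of the later one. The noise of the part before a and
both coefficients are past, so this part pairs to zero with the centred noise of the later
rectangle. The part after a contributes the covariance of the two noises, the volume of the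
intersection, and it is independent of the coefficients. -/
theorem integral_mul_integral_aux (e e' : Elementary ξ) (h : e.a ≤ e'.a) :
    ∫ ω, e.integral ω * e'.integral ω ∂P
      = (∫ ω, e.X ω * e'.X ω ∂P) * volume.real (e.rect ∩ e'.rect) := by
  set a := e'.a with ha
  have hS : MeasurableSet (Set.Iic a ×ˢ (Set.univ : Set UnitAddCircle)) :=
    measurableSet_Iic.prod MeasurableSet.univ
  have h1 := e.measurableSet_rect.inter hS
  have h2 := e.measurableSet_rect.diff hS
  have hQ' : e'.rect ⊆ Set.Ioi a ×ˢ Set.univ := fun x hx => ⟨hx.1.1, trivial⟩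
  have h2a : e.rect \ Set.Iic a ×ˢ (Set.univ : Set UnitAddCircle) ⊆ Set.Ioi a ×ˢ Set.univ := by
    intro x hx
    exact ⟨Set.mem_Ioi.2 (not_le.1 fun hxa => hx.2 ⟨hxa, trivial⟩), trivial⟩
  have hsplit : ξ.toFun (ind e.measurableSet_rect)
      =ᵐ[P] fun ω => ξ.toFun (ind h1) ω + ξ.toFun (ind h2) ω := by
    have := ξ.union_ae h1 h2 (Set.disjoint_sdiff_right.mono_left Set.inter_subset_right)
    have he : ind (h1.union h2) = ind e.measurableSet_rect := by
      simp only [ind, Set.inter_union_sdiff]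
    rwa [he] at this
  have hX : Measurable[ξ.sigmaAlg (pastSet a)] fun ω => e.X ω * e'.X ω :=
    (e.measX.mono ((ξ.filtration.mono h).trans (filtration_le_past a)) le_rfl).mul
      (e'.measX.mono (filtration_le_past a) le_rfl)
  have hξ1 : Measurable[ξ.sigmaAlg (pastSet a)] (ξ.toFun (ind h1)) :=
    ξ.measurable_sigmaAlg (ind_mem_pastSet h1 Set.inter_subset_right)
  have hξ2 : Measurable[ξ.sigmaAlg (futureSet a)] (ξ.toFun (ind h2)) :=
    ξ.measurable_sigmaAlg ⟨_, h2, h2a, rfl⟩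
  have hξ' : Measurable[ξ.sigmaAlg (futureSet a)] (ξ.toFun (ind e'.measurableSet_rect)) :=
    ξ.measurable_sigmaAlg ⟨_, _, hQ', rfl⟩
  have hXX : MemLp (fun ω => e.X ω * e'.X ω) ∞ P :=
    MemLp.mul' (p := ∞) (q := ∞) (r := ∞) (e'.memLp_X ∞) (e.memLp_X ∞)
  have hint : ∀ {A : Set (unitInterval × UnitAddCircle)} (hA : MeasurableSet A), Integrable
      (fun ω => (e.X ω * e'.X ω) * (ξ.toFun (ind hA) ω * ξ.toFun (ind e'.measurableSet_rect) ω))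
      P := fun hA => by
    rw [← memLp_one_iff_integrable]
    refine MemLp.mul' (p := ∞) (q := 1) (r := 1) ?_ hXX
    exact MemLp.mul' (p := 2) (q := 2) (r := 1) (ξ.memLp _ ENNReal.ofNat_ne_top)
      (ξ.memLp _ ENNReal.ofNat_ne_top)
  have hind := indep_past_future (ξ := ξ) a
  have hle := ξ.sigmaAlg_le
  calc ∫ ω, e.integral ω * e'.integral ω ∂P
      = ∫ ω, ((e.X ω * e'.X ω) * (ξ.toFun (ind h1) ω * ξ.toFun (ind e'.measurableSet_rect) ω)
        + (e.X ω * e'.X ω) * (ξ.toFun (ind h2) ω * ξ.toFun (ind e'.measurableSet_rect) ω)) ∂P := by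
        refine integral_congr_ae ?_
        filter_upwards [hsplit] with ω hω
        rw [integral_eq, integral_eq, hω]
        ring
    _ = 0 + (∫ ω, e.X ω * e'.X ω ∂P) * volume.real
          ((e.rect \ Set.Iic a ×ˢ (Set.univ : Set UnitAddCircle)) ∩ e'.rect) := by
        rw [integral_add (hint h1) (hint h2)]
        congr 1
        · simp_rw [← mul_assoc]
          refine (integral_mul_of_indep (hle _) (hle _) hind (hX.mul hξ1) hξ').trans ?_
          rw [ξ.mean, mul_zero]
        · refine (integral_mul_of_indep (hle _) (hle _) hind hX (hξ2.mul hξ')).trans ?_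
          simp only [Pi.mul_apply, ξ.covariance, inner_ind]
    _ = _ := by
        rw [zero_add]
        congr 2
        ext x
        constructor
        · exact fun hx => ⟨hx.1.1, hx.2⟩
        · exact fun hx => ⟨⟨hx.1, fun hxa => absurd (Set.mem_Ioi.1 (hQ' hx.2).1)
            (not_lt.2 hxa.1)⟩, hx.2⟩

theorem integral_mul_integral (e e' : Elementary ξ) :
    ∫ ω, e.integral ω * e'.integral ω ∂P
      = ∫ q, e.field q.1 q.2.1 q.2.2 * e'.field q.1 q.2.1 q.2.2
        ∂(P.prod (volume : Measure (unitInterval × UnitAddCircle))) := by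
  have hR : ∫ q, e.field q.1 q.2.1 q.2.2 * e'.field q.1 q.2.1 q.2.2
        ∂(P.prod (volume : Measure (unitInterval × UnitAddCircle)))
      = (∫ ω, e.X ω * e'.X ω ∂P) * volume.real (e.rect ∩ e'.rect) := by
    have : ∀ q : Ω × unitInterval × UnitAddCircle,
        e.field q.1 q.2.1 q.2.2 * e'.field q.1 q.2.1 q.2.2
        = (e.X q.1 * e'.X q.1) * (e.rect ∩ e'.rect).indicator (fun _ => (1 : ℝ)) q.2 := fun q => by
      rw [field_eq, field_eq, mul_mul_mul_comm]
      congr 1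
      have := Set.inter_indicator_mul (s := e.rect) (t := e'.rect) (fun _ => (1 : ℝ))
        (fun _ => (1 : ℝ)) q.2
      rw [← this]
      simp
    simp_rw [this]
    refine (integral_prod_mul (fun ω => e.X ω * e'.X ω)
      ((e.rect ∩ e'.rect).indicator (fun _ => (1 : ℝ)))).trans ?_
    rw [integral_indicator_const _
      (e.measurableSet_rect.inter e'.measurableSet_rect), smul_eq_mul, mul_one]
  rw [hR]
  rcases le_total e.a e'.a with h | h
  · exact integral_mul_integral_aux e e' h
  · simp_rw [mul_comm (e.integral _), mul_comm (e.X _)]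
    rw [integral_mul_integral_aux e' e h, Set.inter_comm]

end Elementary

/-- The simple integrand given by a list of elementary ones. -/
noncomputable def fieldSum (l : List (Elementary ξ)) (q : Ω × unitInterval × UnitAddCircle) : ℝ :=
  (l.map fun e => e.field q.1 q.2.1 q.2.2).sum

/-- The stochastic integral of the simple integrand given by a list of elementary ones. -/
noncomputable def integralSum (l : List (Elementary ξ)) (ω : Ω) : ℝ := (l.map fun e => e.integral ω).sum

theorem fieldSum_nil : fieldSum ([] : List (Elementary ξ)) = 0 := rfl

theorem fieldSum_cons (e : Elementary ξ) (l : List (Elementary ξ)) :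
    fieldSum (e :: l) = (fun q => e.field q.1 q.2.1 q.2.2) + fieldSum l := by
  ext q; simp [fieldSum]

theorem integralSum_cons (e : Elementary ξ) (l : List (Elementary ξ)) :
    integralSum (e :: l) = e.integral + integralSum l := by
  ext q; simp [integralSum]

theorem fieldSum_append (l l' : List (Elementary ξ)) :
    fieldSum (l ++ l') = fieldSum l + fieldSum l' := by
  ext q; simp [fieldSum]

theorem integralSum_append (l l' : List (Elementary ξ)) :
    integralSum (l ++ l') = integralSum l + integralSum l' := by
  ext q; simp [integralSum]

theorem measurable_fieldSum (l : List (Elementary ξ)) : Measurable (fieldSum l) := by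
  induction l with
  | nil => exact measurable_const
  | cons e l ih => rw [fieldSum_cons]; exact e.measurable_field.add ih

theorem measurable_integralSum (l : List (Elementary ξ)) : Measurable (integralSum l) := by
  induction l with
  | nil => exact measurable_const
  | cons e l ih => rw [integralSum_cons]; exact e.measurable_integral.add ih

theorem Elementary.memLp_field (e : Elementary ξ) (q : ℝ≥0∞) :
    MemLp (fun q : Ω × unitInterval × UnitAddCircle => e.field q.1 q.2.1 q.2.2) q
      (P.prod (volume : Measure (unitInterval × UnitAddCircle))) := by
  obtain ⟨C, hC⟩ := e.exists_field_le
  exact MemLp.of_bound e.measurable_field.aestronglyMeasurable C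
    (.of_forall fun q => hC q.1 q.2.1 q.2.2)

theorem memLp_fieldSum (l : List (Elementary ξ)) (q : ℝ≥0∞) :
    MemLp (fieldSum l) q (P.prod (volume : Measure (unitInterval × UnitAddCircle))) := by
  induction l with
  | nil => exact MemLp.zero
  | cons e l ih => rw [fieldSum_cons]; exact (e.memLp_field q).add ih

theorem memLp_integralSum (l : List (Elementary ξ)) {q : ℝ≥0∞} (hq : q ≠ ∞) :
    MemLp (integralSum l) q P := by
  induction l with
  | nil => exact MemLp.zero
  | cons e l ih => rw [integralSum_cons]; exact (e.memLp_integral hq).add ih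

theorem integrable_fun_mul {α : Type*} [MeasurableSpace α] {μ : Measure α} {g g' : α → ℝ}
    (hg : MemLp g 2 μ) (hg' : MemLp g' 2 μ) : Integrable (fun x => g x * g' x) μ :=
  hg.integrable_mul hg'

theorem integral_integralSum_mul (l l' : List (Elementary ξ)) :
    ∫ ω, integralSum l ω * integralSum l' ω ∂P
      = ∫ q, fieldSum l q * fieldSum l' q
        ∂(P.prod (volume : Measure (unitInterval × UnitAddCircle))) := by
  have two : (2 : ℝ≥0∞) ≠ ∞ := ENNReal.ofNat_ne_top
  induction l with
  | nil => simp [integralSum, fieldSum]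
  | cons e l ih =>
    simp only [integralSum_cons, fieldSum_cons, Pi.add_apply, add_mul]
    rw [integral_add (integrable_fun_mul (e.memLp_integral two) (memLp_integralSum l' two))
      (integrable_fun_mul (memLp_integralSum l two) (memLp_integralSum l' two)),
      integral_add (integrable_fun_mul (e.memLp_field 2) (memLp_fieldSum l' 2))
      (integrable_fun_mul (memLp_fieldSum l 2) (memLp_fieldSum l' 2)), ih]
    congr 1
    clear ih
    induction l' with
    | nil => simp [integralSum, fieldSum]
    | cons e' l' ih =>
      simp only [integralSum_cons, fieldSum_cons, Pi.add_apply, mul_add]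
      rw [integral_add (integrable_fun_mul (e.memLp_integral two) (e'.memLp_integral two))
        (integrable_fun_mul (e.memLp_integral two) (memLp_integralSum l' two)),
        integral_add (integrable_fun_mul (e.memLp_field 2) (e'.memLp_field 2))
        (integrable_fun_mul (e.memLp_field 2) (memLp_fieldSum l' 2)), ih,
        e.integral_mul_integral]

/-- The elementary integrand with the opposite sign. -/
def Elementary.neg (e : Elementary ξ) : Elementary ξ where
  a := e.a
  b := e.b
  B := e.B
  measB := e.measB
  X := fun ω => -e.X ω
  measX := e.measX.neg
  bddX := by simpa using e.bddX

theorem Elementary.neg_field (e : Elementary ξ) (ω : Ω) (r : unitInterval) (y : UnitAddCircle) :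
    e.neg.field ω r y = -e.field ω r y := by
  rw [field_eq, field_eq, ← neg_mul]; rfl

theorem Elementary.neg_integral (e : Elementary ξ) (ω : Ω) :
    e.neg.integral ω = -e.integral ω := by
  rw [integral_eq, integral_eq, ← neg_mul]; rfl

theorem fieldSum_neg (l : List (Elementary ξ)) :
    fieldSum (l.map Elementary.neg) = -fieldSum l := by
  induction l with
  | nil => simp [fieldSum_nil]
  | cons e l ih =>
    rw [List.map_cons, fieldSum_cons, fieldSum_cons, ih]
    ext q
    simp only [Pi.add_apply, Pi.neg_apply, Elementary.neg_field]
    ring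

theorem integralSum_neg (l : List (Elementary ξ)) :
    integralSum (l.map Elementary.neg) = -integralSum l := by
  induction l with
  | nil => ext; simp [integralSum]
  | cons e l ih =>
    rw [List.map_cons, integralSum_cons, integralSum_cons, ih]
    ext q
    simp only [Pi.add_apply, Pi.neg_apply, Elementary.neg_integral]
    ring

/-- The integrand of a stochastic integral as a function of one variable. -/
def uncurryField (f : Ω → unitInterval → UnitAddCircle → ℝ)
    (q : Ω × unitInterval × UnitAddCircle) : ℝ := f q.1 q.2.1 q.2.2

theorem isStochasticIntegral_iff (f : Ω → unitInterval → UnitAddCircle → ℝ) (J : Ω → ℝ) :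
    IsStochasticIntegral ξ f J ↔ ∃ l : ℕ → List (Elementary ξ),
      Tendsto (fun n => eLpNorm (uncurryField f - fieldSum (l n)) 2
        (P.prod (volume : Measure (unitInterval × UnitAddCircle)))) atTop (𝓝 0) ∧
      Tendsto (fun n => eLpNorm (J - integralSum (l n)) 2 P) atTop (𝓝 0) := Iff.rfl

theorem isStochasticIntegral_fieldSum (l : List (Elementary ξ)) :
    IsStochasticIntegral ξ (fun ω r y => fieldSum l (ω, r, y)) (integralSum l) := by
  refine (isStochasticIntegral_iff _ _).2 ⟨fun _ => l, ?_, ?_⟩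
  · have : uncurryField (fun ω r y => fieldSum l (ω, r, y)) - fieldSum l = 0 := sub_self _
    simp [this]
  · simp

namespace IsStochasticIntegral

variable {f f' : Ω → unitInterval → UnitAddCircle → ℝ} {J J' : Ω → ℝ}

theorem congr_ae (h : IsStochasticIntegral ξ f J)
    (hf : uncurryField f =ᵐ[P.prod (volume : Measure (unitInterval × UnitAddCircle))]
      uncurryField f') (hJ : J =ᵐ[P] J') : IsStochasticIntegral ξ f' J' := by
  obtain ⟨l, h1, h2⟩ := (isStochasticIntegral_iff _ _).1 h
  refine (isStochasticIntegral_iff _ _).2 ⟨l, h1.congr fun n => ?_, h2.congr fun n => ?_⟩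
  · exact eLpNorm_congr_ae (hf.sub EventuallyEq.rfl)
  · exact eLpNorm_congr_ae (hJ.sub EventuallyEq.rfl)

/-- Concatenating one approximating list with the negated other one approximates the difference. -/
theorem sub (h : IsStochasticIntegral ξ f J) (h' : IsStochasticIntegral ξ f' J')
    (hf : Measurable (uncurryField f)) (hf' : Measurable (uncurryField f'))
    (hJ : Measurable J) (hJ' : Measurable J') :
    IsStochasticIntegral ξ (fun ω r y => f ω r y - f' ω r y) (fun ω => J ω - J' ω) := by
  obtain ⟨l, h1, h2⟩ := (isStochasticIntegral_iff _ _).1 h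
  obtain ⟨l', h1', h2'⟩ := (isStochasticIntegral_iff _ _).1 h'
  refine (isStochasticIntegral_iff _ _).2 ⟨fun n => l n ++ (l' n).map Elementary.neg, ?_, ?_⟩
  · refine tendsto_of_tendsto_of_tendsto_of_le_of_le tendsto_const_nhds
      (by simpa using h1.add h1') (fun _ => zero_le) fun n => ?_
    have : uncurryField (fun ω r y => f ω r y - f' ω r y)
        - fieldSum (l n ++ (l' n).map Elementary.neg)
        = (uncurryField f - fieldSum (l n)) - (uncurryField f' - fieldSum (l' n)) := by
      rw [fieldSum_append, fieldSum_neg]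
      ext q
      simp only [uncurryField, Pi.sub_apply, Pi.add_apply, Pi.neg_apply]
      ring
    rw [this]
    exact eLpNorm_sub_le (hf.sub (measurable_fieldSum _)).aestronglyMeasurable
      (hf'.sub (measurable_fieldSum _)).aestronglyMeasurable (by norm_num)
  · refine tendsto_of_tendsto_of_tendsto_of_le_of_le tendsto_const_nhds
      (by simpa using h2.add h2') (fun _ => zero_le) fun n => ?_
    have : (fun ω => J ω - J' ω) - integralSum (l n ++ (l' n).map Elementary.neg)
        = (J - integralSum (l n)) - (J' - integralSum (l' n)) := by
      rw [integralSum_append, integralSum_neg]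
      ext q
      simp only [Pi.sub_apply, Pi.add_apply, Pi.neg_apply]
      ring
    rw [this]
    exact eLpNorm_sub_le (hJ.sub (measurable_integralSum _)).aestronglyMeasurable
      (hJ'.sub (measurable_integralSum _)).aestronglyMeasurable (by norm_num)

theorem memLp_of_tendsto {α : Type*} [MeasurableSpace α] {μ : Measure α} {g : α → ℝ}
    {gn : ℕ → α → ℝ} (hg : Measurable g) (hgn : ∀ n, MemLp (gn n) 2 μ)
    (h : Tendsto (fun n => eLpNorm (g - gn n) 2 μ) atTop (𝓝 0)) : MemLp g 2 μ := by
  obtain ⟨n, hn⟩ := (h.eventually (gt_mem_nhds (zero_lt_one' ℝ≥0∞))).exists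
  have h1 : MemLp (g - gn n) 2 μ :=
    ⟨hg.aestronglyMeasurable.sub (hgn n).1, hn.trans ENNReal.one_lt_top⟩
  simpa using h1.add (hgn n)

theorem memLp (h : IsStochasticIntegral ξ f J) (hJ : Measurable J) : MemLp J 2 P := by
  obtain ⟨l, h1, h2⟩ := (isStochasticIntegral_iff _ _).1 h
  exact memLp_of_tendsto hJ (fun n => memLp_integralSum _ ENNReal.ofNat_ne_top) h2

theorem memLp_field (h : IsStochasticIntegral ξ f J) (hf : Measurable (uncurryField f)) :
    MemLp (uncurryField f) 2 (P.prod (volume : Measure (unitInterval × UnitAddCircle))) := by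
  obtain ⟨l, h1, h2⟩ := (isStochasticIntegral_iff _ _).1 h
  exact memLp_of_tendsto hf (fun n => memLp_fieldSum _ 2) h1

theorem tendsto_integral_mul {α : Type*} [MeasurableSpace α] {μ : Measure α} {g g' : α → ℝ}
    {gn gn' : ℕ → α → ℝ} (hg : MemLp g 2 μ) (hg' : MemLp g' 2 μ)
    (hgn : ∀ n, MemLp (gn n) 2 μ) (hgn' : ∀ n, MemLp (gn' n) 2 μ)
    (h : Tendsto (fun n => eLpNorm (g - gn n) 2 μ) atTop (𝓝 0))
    (h' : Tendsto (fun n => eLpNorm (g' - gn' n) 2 μ) atTop (𝓝 0)) :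
    Tendsto (fun n => ∫ x, gn n x * gn' n x ∂μ) atTop (𝓝 (∫ x, g x * g' x ∂μ)) := by
  have key : ∀ {a b : α → ℝ} (ha : MemLp a 2 μ) (hb : MemLp b 2 μ),
      ∫ x, a x * b x ∂μ = inner ℝ (ha.toLp a) (hb.toLp b) := fun ha hb => by
    rw [L2.inner_def]
    refine integral_congr_ae ?_
    filter_upwards [ha.coeFn_toLp, hb.coeFn_toLp] with x hx hy
    rw [hx, hy]
    simp [mul_comm]
  have lim : ∀ {a : α → ℝ} {an : ℕ → α → ℝ} (ha : MemLp a 2 μ) (han : ∀ n, MemLp (an n) 2 μ),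
      Tendsto (fun n => eLpNorm (a - an n) 2 μ) atTop (𝓝 0) →
      Tendsto (fun n => (han n).toLp (an n)) atTop (𝓝 (ha.toLp a)) := fun ha han hl => by
    rw [Lp.tendsto_Lp_iff_tendsto_eLpNorm'']
    exact hl.congr fun n => eLpNorm_sub_comm _ _ _ _
  simp_rw [fun n => key (hgn n) (hgn' n)]
  rw [key hg hg']
  exact (lim hg hgn h).inner (lim hg' hgn' h')

/-- The Itô isometry. -/
theorem integral_mul (h : IsStochasticIntegral ξ f J) (h' : IsStochasticIntegral ξ f' J')
    (hf : Measurable (uncurryField f)) (hf' : Measurable (uncurryField f'))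
    (hJ : Measurable J) (hJ' : Measurable J') :
    ∫ ω, J ω * J' ω ∂P = ∫ q, uncurryField f q * uncurryField f' q
      ∂(P.prod (volume : Measure (unitInterval × UnitAddCircle))) := by
  have m1 := h.memLp hJ
  have m2 := h'.memLp hJ'
  have m3 := h.memLp_field hf
  have m4 := h'.memLp_field hf'
  obtain ⟨l, h1, h2⟩ := (isStochasticIntegral_iff _ _).1 h
  obtain ⟨l', h1', h2'⟩ := (isStochasticIntegral_iff _ _).1 h'
  have two : (2 : ℝ≥0∞) ≠ ∞ := ENNReal.ofNat_ne_top
  have t1 := tendsto_integral_mul m1 m2 (fun n => memLp_integralSum (l n) two)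
    (fun n => memLp_integralSum (l' n) two) h2 h2'
  have t2 := tendsto_integral_mul m3 m4 (fun n => memLp_fieldSum (l n) 2)
    (fun n => memLp_fieldSum (l' n) 2) h1 h1'
  simp_rw [integral_integralSum_mul] at t1
  exact tendsto_nhds_unique t1 t2

theorem eLpNorm_eq (h : IsStochasticIntegral ξ f J) (hf : Measurable (uncurryField f))
    (hJ : Measurable J) : eLpNorm J 2 P
      = eLpNorm (uncurryField f) 2 (P.prod (volume : Measure (unitInterval × UnitAddCircle))) := by
  rw [(h.memLp hJ).eLpNorm_eq_integral_rpow_norm two_ne_zero ENNReal.ofNat_ne_top,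
    (h.memLp_field hf).eLpNorm_eq_integral_rpow_norm two_ne_zero ENNReal.ofNat_ne_top]
  have := h.integral_mul h hf hf hJ hJ
  simp only [ENNReal.toReal_ofNat, Real.rpow_ofNat, Real.norm_eq_abs, sq_abs]
  simp only [pow_two, this]

/-- Approximations of the integrand yield approximations of the stochastic integral. -/
theorem tendsto_integralSum (h : IsStochasticIntegral ξ f J) (hf : Measurable (uncurryField f))
    (hJ : Measurable J) {l : ℕ → List (Elementary ξ)}
    (hl : Tendsto (fun n => eLpNorm (uncurryField f - fieldSum (l n)) 2
        (P.prod (volume : Measure (unitInterval × UnitAddCircle)))) atTop (𝓝 0)) :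
    Tendsto (fun n => eLpNorm (J - integralSum (l n)) 2 P) atTop (𝓝 0) := by
  refine hl.congr fun n => ?_
  -- The error of the integral is itself the stochastic integral of the error of the integrand, so
  -- by the isometry the two errors are equal, not just comparable.
  have := (h.sub (isStochasticIntegral_fieldSum (l n)) hf (measurable_fieldSum _) hJ
    (measurable_integralSum _)).eLpNorm_eq (hf.sub (measurable_fieldSum _))
    (hJ.sub (measurable_integralSum _))
  exact this.symm

end IsStochasticIntegral

end Isometry

/-! ### Moments of simple stochastic integrals -/

/-- Taylor's formula with the linear term kept exact, since it is the one that averages out. For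
small x one uses 1 + x ≤ e^x and the second-order remainder of the exponential; for |x| ≥ 1/2 one
has |1 + x| ≤ 3|x|, and a negative linear term is absorbed by 2p x². -/
theorem exists_abs_one_add_rpow_le {p : ℝ} (hp : 2 ≤ p) :
    ∃ C : ℝ, 0 ≤ C ∧ ∀ x : ℝ, |1 + x| ^ p ≤ 1 + p * x + C * (x ^ 2 + |x| ^ p) := by
  have hp0 : 0 < p := by linarith
  refine ⟨p ^ 2 * Real.exp p + 2 * p + 3 ^ p, by positivity, fun x => ?_⟩
  have hxp : 0 ≤ |x| ^ p := by positivity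
  have h3 : (0 : ℝ) ≤ 3 ^ p := by positivity
  rcases le_total |x| (1 / 2) with hx | hx
  · obtain ⟨hx1, hx2⟩ := abs_le.1 hx
    have h1 : |1 + x| ^ p ≤ Real.exp (p * x) := by
      rw [abs_of_nonneg (by linarith), mul_comm, Real.exp_mul]
      exact Real.rpow_le_rpow (by linarith) (by linarith [Real.add_one_le_exp x]) hp0.le
    have h2 : Real.exp (p * x) ≤ 1 + p * x + p ^ 2 * Real.exp p * x ^ 2 := by
      have h4 := Complex.norm_exp_sub_sum_le_norm_mul_exp ((p * x : ℝ) : ℂ) 2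
      rw [Complex.norm_real] at h4
      have h5 : ‖p * x‖ ≤ p := by
        rw [Real.norm_eq_abs, abs_mul, abs_of_pos hp0]; nlinarith
      have h6 : ‖p * x‖ ^ 2 = p ^ 2 * x ^ 2 := by
        rw [Real.norm_eq_abs, sq_abs]; ring
      have h7 : Complex.exp ((p * x : ℝ) : ℂ) - ∑ m ∈ Finset.range 2,
          ((p * x : ℝ) : ℂ) ^ m / (m.factorial : ℂ) = ((Real.exp (p * x) - (1 + p * x) : ℝ) : ℂ) := by
        simp [Finset.sum_range_succ]
      rw [h7, Complex.norm_real, h6] at h4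
      have h8 := (Real.le_norm_self _).trans h4
      have h9 : p ^ 2 * x ^ 2 * Real.exp ‖p * x‖ ≤ p ^ 2 * x ^ 2 * Real.exp p := by gcongr
      linarith
    nlinarith [mul_nonneg (by positivity : 0 ≤ p ^ 2 * Real.exp p) hxp, mul_nonneg hp0.le hxp,
      mul_nonneg hp0.le (sq_nonneg x), mul_nonneg h3 hxp, mul_nonneg h3 (sq_nonneg x)]
  · have h1 : |1 + x| ^ p ≤ 3 ^ p * |x| ^ p := by
      rw [← Real.mul_rpow (by norm_num) (abs_nonneg _)]
      refine Real.rpow_le_rpow (abs_nonneg _) ?_ hp0.le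
      have := abs_add_le 1 x
      rw [abs_one] at this
      linarith
    have h2 : -(p * x) ≤ 2 * p * x ^ 2 := by
      have : -x ≤ 2 * x ^ 2 := by
        have := neg_abs_le x
        rw [← sq_abs]; nlinarith
      nlinarith
    nlinarith [mul_nonneg (by positivity : 0 ≤ p ^ 2 * Real.exp p) hxp, mul_nonneg hp0.le hxp,
      mul_nonneg (by positivity : 0 ≤ p ^ 2 * Real.exp p) (sq_nonneg x),
      mul_nonneg h3 (sq_nonneg x)]

theorem integrable_abs_rpow_gaussian {p : ℝ} (hp : 0 < p) :
    Integrable (fun z : ℝ => |z| ^ p) (gaussianReal 0 1) := by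
  have := (memLp_id_gaussianReal (μ := 0) (v := 1) (Real.toNNReal p)).integrable_norm_rpow
    (by simpa using hp) ENNReal.coe_ne_top
  simpa [Real.coe_toNNReal _ hp.le] using this

/-- The average of two lower bounds for (1 + cy)^q: Bernoulli's inequality supplies the term linear
in y, superadditivity of the q-th power the term y^q. This averaging is why c ≥ 2m is required. -/
theorem add_one_rpow_bound {q c y m : ℝ} (hq : 1 ≤ q) (hc : 1 ≤ c) (hy : 0 ≤ y)
    (hm : 2 * m ≤ c) : 1 + m * (y + y ^ q) ≤ (1 + c * y) ^ q := by
  have hcy : 0 ≤ c * y := by positivity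
  have h1 : 1 + q * (c * y) ≤ (1 + c * y) ^ q :=
    one_add_mul_self_le_rpow_one_add (by linarith) hq
  have h2 : 1 + (c * y) ^ q ≤ (1 + c * y) ^ q := by
    simpa using Real.add_rpow_le_rpow_add zero_le_one hcy hq
  have h3 : c * y ^ q ≤ (c * y) ^ q := by
    rw [Real.mul_rpow (by linarith) hy]
    gcongr
    simpa using Real.rpow_le_rpow_of_exponent_le hc hq
  have h4 : 0 ≤ y ^ q := by positivity
  nlinarith

/-- After factoring out s, the expansion of |1 + hz|^p is integrated; the linear term vanishes
because the Gaussian is centred. The outcome is regrouped as a power of s² + Cvx², the form to which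
Minkowski's inequality applies. -/
theorem exists_gaussian_moment_le {p : ℝ} (hp : 2 ≤ p) :
    ∃ C : ℝ, 0 ≤ C ∧ ∀ (v : ℝ≥0) (s x : ℝ),
      ∫⁻ z, ENNReal.ofReal (|s + x * z| ^ p) ∂(gaussianReal 0 v)
        ≤ ENNReal.ofReal ((s ^ 2 + C * v * x ^ 2) ^ (p / 2)) := by
  have hp0 : 0 < p := by linarith
  obtain ⟨C₁, hC₁, hT⟩ := exists_abs_one_add_rpow_le hp
  set m : ℝ := ∫ z, |z| ^ p ∂(gaussianReal 0 1) with hm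
  set m₂ : ℝ := ∫ z, z ^ 2 ∂(gaussianReal 0 1) with hm₂
  have hm0 : 0 ≤ m := integral_nonneg fun z => by positivity
  have hm20 : 0 ≤ m₂ := integral_nonneg fun z => by positivity
  have hi := integrable_abs_rpow_gaussian hp0
  have hi2 : Integrable (fun z : ℝ => z ^ 2) (gaussianReal 0 1) := by
    simpa using integrable_abs_rpow_gaussian two_pos
  have hi1 : Integrable (fun z : ℝ => z) (gaussianReal 0 1) :=
    (memLp_id_gaussianReal (μ := 0) (v := 1) 1).integrable le_rfl
  -- The summand 1 gives C ≥ 1, the doubled one feeds `add_one_rpow_bound`, and m covers the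
  -- degenerate case s = 0.
  set C := 1 + 2 * (C₁ * (m₂ + m)) + m with hC
  have hC1 : 1 ≤ C := by
    have : 0 ≤ C₁ * (m₂ + m) := by positivity
    linarith
  have unit : ∀ s x : ℝ, ∫⁻ z, ENNReal.ofReal (|s + x * z| ^ p) ∂(gaussianReal 0 1)
        ≤ ENNReal.ofReal ((s ^ 2 + C * x ^ 2) ^ (p / 2)) := by
    intro s x
    rcases eq_or_ne s 0 with rfl | hs
    · have : ∀ z : ℝ, ENNReal.ofReal (|0 + x * z| ^ p) = ENNReal.ofReal (|x| ^ p * |z| ^ p) :=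
        fun z => by rw [zero_add, abs_mul, Real.mul_rpow (abs_nonneg _) (abs_nonneg _)]
      simp_rw [this]
      rw [← ofReal_integral_eq_lintegral_ofReal (hi.const_mul _)
        (.of_forall fun z => by positivity), integral_const_mul]
      refine ENNReal.ofReal_le_ofReal ?_
      rw [zero_pow two_ne_zero, zero_add, Real.mul_rpow (by positivity) (by positivity),
        ← sq_abs x, ← Real.rpow_natCast, ← Real.rpow_mul (abs_nonneg _),
        show ((2 : ℕ) : ℝ) * (p / 2) = p by push_cast; ring, mul_comm]
      gcongr
      have h1 : m ≤ C := by
        have : 0 ≤ C₁ * (m₂ + m) := by positivity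
        linarith
      have h2 := Real.rpow_le_rpow_of_exponent_le hC1 (show (1 : ℝ) ≤ p / 2 by linarith)
      rw [Real.rpow_one] at h2
      exact h1.trans h2
    · set h := x / s with hh
      have hx : x = s * h := by rw [hh]; field_simp
      have hb : ∀ z : ℝ, |s + x * z| ^ p
          ≤ |s| ^ p * (1 + p * (h * z) + C₁ * (h ^ 2 * z ^ 2 + |h| ^ p * |z| ^ p)) := fun z => by
        rw [show s + x * z = s * (1 + h * z) by rw [hx]; ring, abs_mul,
          Real.mul_rpow (abs_nonneg _) (abs_nonneg _)]
        gcongr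
        have := hT (h * z)
        rwa [mul_pow, abs_mul, Real.mul_rpow (abs_nonneg _) (abs_nonneg _)] at this
      have i1 : Integrable (fun z : ℝ => p * (h * z)) (gaussianReal 0 1) :=
        (hi1.const_mul h).const_mul p
      have i2 : Integrable (fun z : ℝ => 1 + p * (h * z)) (gaussianReal 0 1) :=
        (integrable_const _).add i1
      have i3 : Integrable (fun z : ℝ => h ^ 2 * z ^ 2) (gaussianReal 0 1) := hi2.const_mul _
      have i4 : Integrable (fun z : ℝ => |h| ^ p * |z| ^ p) (gaussianReal 0 1) := hi.const_mul _
      have i5 : Integrable (fun z : ℝ => C₁ * (h ^ 2 * z ^ 2 + |h| ^ p * |z| ^ p))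
          (gaussianReal 0 1) := (i3.add i4).const_mul C₁
      have hint : Integrable (fun z : ℝ =>
          |s| ^ p * (1 + p * (h * z) + C₁ * (h ^ 2 * z ^ 2 + |h| ^ p * |z| ^ p)))
          (gaussianReal 0 1) := (i2.add i5).const_mul _
      calc ∫⁻ z, ENNReal.ofReal (|s + x * z| ^ p) ∂(gaussianReal 0 1)
          ≤ ∫⁻ z, ENNReal.ofReal (|s| ^ p * (1 + p * (h * z)
            + C₁ * (h ^ 2 * z ^ 2 + |h| ^ p * |z| ^ p))) ∂(gaussianReal 0 1) :=
            lintegral_mono fun z => ENNReal.ofReal_le_ofReal (hb z)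
        _ = ENNReal.ofReal (|s| ^ p * (1 + C₁ * (h ^ 2 * m₂ + |h| ^ p * m))) := by
            rw [← ofReal_integral_eq_lintegral_ofReal hint
              (.of_forall fun z => le_trans (by positivity) (hb z)), integral_const_mul,
              integral_add i2 i5, integral_add (integrable_const _) i1,
              integral_const_mul, integral_const_mul, integral_const_mul,
              integral_add i3 i4, integral_const_mul,
              integral_const_mul, integral_id_gaussianReal]
            simp [hm, hm₂]
        _ ≤ _ := by
            refine ENNReal.ofReal_le_ofReal ?_
            have e1 : s ^ 2 + C * x ^ 2 = |s| ^ 2 * (1 + C * h ^ 2) := by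
              rw [hx, sq_abs]; ring
            rw [e1, Real.mul_rpow (by positivity) (by positivity), ← Real.rpow_natCast |s|,
              ← Real.rpow_mul (abs_nonneg _), show ((2 : ℕ) : ℝ) * (p / 2) = p by push_cast; ring]
            gcongr
            have e2 : |h| ^ p = (h ^ 2) ^ (p / 2) := by
              rw [← sq_abs h, ← Real.rpow_natCast |h|, ← Real.rpow_mul (abs_nonneg _),
                show ((2 : ℕ) : ℝ) * (p / 2) = p by push_cast; ring]
            have e3 := add_one_rpow_bound (q := p / 2) (c := C) (y := h ^ 2)
              (m := C₁ * (m₂ + m)) (by linarith) hC1 (sq_nonneg h) (by linarith)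
            refine le_trans ?_ e3
            rw [e2]
            have e4 : 0 ≤ (h ^ 2) ^ (p / 2) := by positivity
            have e5 := sq_nonneg h
            have e6 : h ^ 2 * m₂ + (h ^ 2) ^ (p / 2) * m
                ≤ (m₂ + m) * (h ^ 2 + (h ^ 2) ^ (p / 2)) := by nlinarith [mul_nonneg e5 hm0, mul_nonneg e4 hm20]
            nlinarith [mul_le_mul_of_nonneg_left e6 hC₁]
  refine ⟨C, by linarith, fun v s x => ?_⟩
  -- A general variance reduces to the standard one by scaling with √v.
  have hmap : gaussianReal 0 v = (gaussianReal 0 1).map (fun z => Real.sqrt v * z) := by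
    rw [gaussianReal_map_const_mul]
    simp
  rw [hmap, lintegral_map (by fun_prop) (by fun_prop)]
  have := unit s (x * Real.sqrt v)
  rw [mul_pow, Real.sq_sqrt v.coe_nonneg] at this
  simpa [mul_assoc, mul_comm, mul_left_comm] using this

section Moments

variable {Ω : Type*} [mΩ : MeasurableSpace Ω] {P : Measure Ω} [IsProbabilityMeasure P]

/-- The constant in the moment bound for Gaussian sums. -/
noncomputable def momentConst (p : ℝ) : ℝ :=
  open Classical in if hp : 2 ≤ p then (exists_gaussian_moment_le hp).choose else 0

theorem momentConst_nonneg (p : ℝ) : 0 ≤ momentConst p := by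
  unfold momentConst
  split_ifs with hp
  · exact (exists_gaussian_moment_le hp).choose_spec.1
  · exact le_rfl

theorem gaussian_moment_le {p : ℝ} (hp : 2 ≤ p) (v : ℝ≥0) (s x : ℝ) :
    ∫⁻ z, ENNReal.ofReal (|s + x * z| ^ p) ∂(gaussianReal 0 v)
      ≤ ENNReal.ofReal ((s ^ 2 + momentConst p * v * x ^ 2) ^ (p / 2)) := by
  unfold momentConst
  rw [dif_pos hp]
  exact (exists_gaussian_moment_le hp).choose_spec.2 v s x

/-- The squared L_p norm is the L_{p/2} norm of the square; since p/2 ≥ 1 it obeys a triangle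
inequality in the squares. -/
theorem eLpNorm_ofReal_sq {p : ℝ} (hp : 2 ≤ p) (X : Ω → ℝ) :
    eLpNorm X (ENNReal.ofReal p) P ^ 2
      = (∫⁻ ω, ENNReal.ofReal ((X ω ^ 2) ^ (p / 2)) ∂P) ^ (1 / (p / 2)) := by
  have hp0 : 0 < p := by linarith
  rw [eLpNorm_eq_lintegral_rpow_enorm_toReal (by simpa using hp0) ENNReal.ofReal_ne_top,
    ENNReal.toReal_ofReal hp0.le, ← ENNReal.rpow_natCast, ← ENNReal.rpow_mul]
  congr 1
  · refine lintegral_congr fun ω => ?_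
    rw [Real.enorm_eq_ofReal_abs, ENNReal.ofReal_rpow_of_nonneg (abs_nonneg _) hp0.le,
      ← sq_abs (X ω), ← Real.rpow_natCast |X ω|, ← Real.rpow_mul (abs_nonneg _),
      show ((2 : ℕ) : ℝ) * (p / 2) = p by push_cast; ring]
  · push_cast
    field_simp

/-- The moment bound for adding an independent Gaussian variable with a random coefficient. -/
theorem eLpNorm_add_mul_sq_le {Ω : Type*} {m m' : MeasurableSpace Ω} {mΩ : MeasurableSpace Ω}
    {P : Measure Ω} [IsProbabilityMeasure P] {p : ℝ} (hp : 2 ≤ p) (hm : m ≤ mΩ)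
    (hm' : m' ≤ mΩ) (h : Indep m m' P) {S X Z : Ω → ℝ} (hS : Measurable[m] S)
    (hX : Measurable[m] X) (hZ : Measurable[m'] Z) {v : ℝ≥0} (hv : P.map Z = gaussianReal 0 v) :
    eLpNorm (fun ω => S ω + X ω * Z ω) (ENNReal.ofReal p) P ^ 2
      ≤ eLpNorm S (ENNReal.ofReal p) P ^ 2
        + ENNReal.ofReal (momentConst p) * (v * eLpNorm X (ENNReal.ofReal p) P ^ 2) := by
  have hp0 : 0 < p := by linarith
  have hc := momentConst_nonneg p
  have hS' := hS.mono hm le_rfl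
  have hX' := hX.mono hm le_rfl
  have hZ' := hZ.mono hm' le_rfl
  have hSX : IndepFun (fun ω => (S ω, X ω)) Z P := by
    rw [IndepFun_iff_Indep]
    exact indep_of_indep_of_le_left (indep_of_indep_of_le_right h hZ.comap_le)
      (hS.prodMk hX).comap_le
  have hmap := (indepFun_iff_map_prod_eq_prod_map_map (hS'.prodMk hX').aemeasurable
    hZ'.aemeasurable).1 hSX
  have hSXm : Measurable fun ω => (S ω, X ω) := hS'.prodMk hX'
  -- By independence, Z is integrated first, with (S, X) frozen.
  have key : ∫⁻ ω, ENNReal.ofReal (((S ω + X ω * Z ω) ^ 2) ^ (p / 2)) ∂P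
      ≤ ∫⁻ ω, (ENNReal.ofReal (S ω ^ 2)
        + ENNReal.ofReal (momentConst p * v * X ω ^ 2)) ^ (p / 2) ∂P := by
    have hg : Measurable fun q : (ℝ × ℝ) × ℝ => ENNReal.ofReal (|q.1.1 + q.1.2 * q.2| ^ p) := by
      fun_prop
    calc ∫⁻ ω, ENNReal.ofReal (((S ω + X ω * Z ω) ^ 2) ^ (p / 2)) ∂P
        = ∫⁻ ω, ENNReal.ofReal (|S ω + X ω * Z ω| ^ p) ∂P := by
          refine lintegral_congr fun ω => ?_
          rw [← sq_abs (S ω + X ω * Z ω), ← Real.rpow_natCast |S ω + X ω * Z ω|,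
            ← Real.rpow_mul (abs_nonneg _), show ((2 : ℕ) : ℝ) * (p / 2) = p by push_cast; ring]
      _ = ∫⁻ q, ENNReal.ofReal (|q.1.1 + q.1.2 * q.2| ^ p)
            ∂(P.map fun ω => ((S ω, X ω), Z ω)) := by
          rw [lintegral_map hg (hSXm.prodMk hZ')]
      _ = ∫⁻ w, ∫⁻ z, ENNReal.ofReal (|w.1 + w.2 * z| ^ p) ∂(gaussianReal 0 v)
            ∂(P.map fun ω => (S ω, X ω)) := by
          rw [hmap, hv, lintegral_prod _ hg.aemeasurable]
      _ ≤ ∫⁻ w, (ENNReal.ofReal (w.1 ^ 2)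
            + ENNReal.ofReal (momentConst p * v * w.2 ^ 2)) ^ (p / 2)
            ∂(P.map fun ω => (S ω, X ω)) := by
          refine lintegral_mono fun w => (gaussian_moment_le hp v w.1 w.2).trans_eq ?_
          rw [← ENNReal.ofReal_add (by positivity) (by positivity),
            ENNReal.ofReal_rpow_of_nonneg (by positivity) (by positivity)]
      _ = _ := by rw [lintegral_map (by fun_prop) hSXm]
  rw [eLpNorm_ofReal_sq hp, eLpNorm_ofReal_sq hp, eLpNorm_ofReal_sq hp]
  refine (ENNReal.rpow_le_rpow key (by positivity)).trans ?_
  -- Minkowski in L_{p/2}, which is where p ≥ 2 matters: squared norms add, so iterating the step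
  -- does not multiply constants.
  refine (ENNReal.lintegral_Lp_add_le (by fun_prop) (by fun_prop) (by linarith)).trans ?_
  refine add_le_add (le_of_eq ?_) (le_of_eq ?_)
  · congr 1
    exact lintegral_congr fun ω => ENNReal.ofReal_rpow_of_nonneg (by positivity) (by positivity)
  · have : ∀ ω, ENNReal.ofReal (momentConst p * v * X ω ^ 2) ^ (p / 2)
        = (ENNReal.ofReal (momentConst p) * v) ^ (p / 2) * ENNReal.ofReal ((X ω ^ 2) ^ (p / 2)) :=
      fun ω => by
        rw [ENNReal.ofReal_mul (by positivity), ENNReal.mul_rpow_of_nonneg _ _ (by positivity),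
          ENNReal.ofReal_mul hc, ENNReal.ofReal_coe_nnreal,
          ENNReal.ofReal_rpow_of_nonneg (sq_nonneg (X ω)) (by positivity)]
    simp_rw [this]
    rw [lintegral_const_mul _ (by fun_prop), ENNReal.mul_rpow_of_nonneg _ _ (by positivity),
      ← ENNReal.rpow_mul, mul_one_div_cancel (by positivity), ENNReal.rpow_one, mul_assoc]

variable [P.IsComplete] {ξ : WhiteNoise P}

/-- The moment bound for simple stochastic integrals whose rectangles are disjoint and ordered
in time. -/
theorem eLpNorm_integralSum_sq_le {p : ℝ} (hp : 2 ≤ p) (l : List (Elementary ξ))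
    (hl : l.Pairwise fun e e' => e'.a ≤ e.a ∧ Disjoint e'.rect e.rect) :
    eLpNorm (integralSum l) (ENNReal.ofReal p) P ^ 2
      ≤ ENNReal.ofReal (momentConst p) * (l.map fun e =>
        volume e.rect * eLpNorm e.X (ENNReal.ofReal p) P ^ 2).sum := by
  induction l with
  | nil =>
    have : integralSum ([] : List (Elementary ξ)) = 0 := rfl
    simp [this]
  | cons e l ih =>
    obtain ⟨h1, h2⟩ := List.pairwise_cons.1 hl
    specialize ih h2
    -- Independence is taken from orthogonality to the head rectangle and not from time order alone:
    -- earlier list entries may occupy the same time slab and be disjoint only in space. The noise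
    -- up to the starting time of the head and the noises of all other entries lie in K.
    set K : Set NoiseSpace := {h | inner ℝ h (ind e.measurableSet_rect) = 0} with hK
    have hind : Indep (ξ.sigmaAlg K) (ξ.sigmaAlg {ind e.measurableSet_rect}) P :=
      ξ.indep_sigmaAlg fun g hg g' hg' => by
        rw [Set.mem_singleton_iff.1 hg']; exact hg
    have hmem : ∀ {Q : Set (unitInterval × UnitAddCircle)} (hQ : MeasurableSet Q),
        Disjoint Q e.rect → ind hQ ∈ K := fun hQ hd => by
      rw [hK, Set.mem_ofPred_eq, inner_ind, hd.inter_eq]; simp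
    have hF : ξ.filtration e.a ≤ ξ.sigmaAlg K := ξ.filtration_le_sigmaAlg fun r hr B hB =>
      hmem _ (Set.disjoint_left.2 fun x hx hx' => absurd (Set.mem_Iio.1 hx.1)
        (not_lt.2 (hr.trans hx'.1.1.le)))
    have hS : ∀ l' : List (Elementary ξ), (∀ e' ∈ l', e'.a ≤ e.a ∧ Disjoint e'.rect e.rect) →
        Measurable[ξ.sigmaAlg K] (integralSum l') := by
      intro l'
      induction l' with
      | nil => intro _; exact measurable_const
      | cons e' l' ih' =>
        intro h
        rw [integralSum_cons]
        have he' := h e' (by simp)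
        refine Measurable.add (Measurable.mul ?_ ?_) (ih' fun e'' he'' => h e'' (by simp [he'']))
        · exact e'.measX.mono ((ξ.filtration.mono he'.1).trans hF) le_rfl
        · exact ξ.measurable_sigmaAlg (hmem _ he'.2)
    have hv := ξ.map_eq (ind e.measurableSet_rect)
    have step := eLpNorm_add_mul_sq_le hp (ξ.sigmaAlg_le _) (ξ.sigmaAlg_le _) hind (hS l h1)
      (e.measX.mono hF le_rfl) (ξ.measurable_sigmaAlg (Set.mem_singleton _)) hv
    have hvol : ((Real.toNNReal (inner ℝ (ind e.measurableSet_rect) (ind e.measurableSet_rect)) :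
        ℝ≥0) : ℝ≥0∞) = volume e.rect := by
      rw [inner_ind, Set.inter_self]
      exact ENNReal.ofReal_toReal (measure_ne_top _ _)
    rw [hvol] at step
    have heq : integralSum (e :: l)
        = fun ω => integralSum l ω + e.X ω * ξ.toFun (ind e.measurableSet_rect) ω := by
      rw [integralSum_cons]
      ext ω
      rw [Pi.add_apply, add_comm, e.integral_eq]
    rw [heq, List.map_cons, List.sum_cons, mul_add, add_comm (ENNReal.ofReal _ * _)]
    exact step.trans (add_le_add_left ih _)

end Moments

/-! ### Approximation of integrands on a grid -/

section Grid

/-- The points `i / (n + 1)` of the time grid. -/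
noncomputable def gridPt (n i : ℕ) : unitInterval :=
  Set.projIcc (0 : ℝ) 1 zero_le_one (i / (n + 1))

theorem gridPt_mono (n : ℕ) : Monotone (gridPt n) := fun i j hij => by
  refine Set.monotone_projIcc _ ?_
  gcongr

theorem coe_gridPt {n i : ℕ} (h : i ≤ n + 1) : (gridPt n i : ℝ) = i / (n + 1) := by
  have hn : (0 : ℝ) < n + 1 := by positivity
  have hi : (i : ℝ) ≤ n + 1 := by exact_mod_cast h
  rw [gridPt, Set.projIcc_of_mem zero_le_one ⟨by positivity, (div_le_one hn).2 hi⟩]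

/-- The largest grid point that is smaller than `r`. -/
noncomputable def gridIdx (n : ℕ) (r : unitInterval) : ℕ := ⌈((n : ℝ) + 1) * r⌉₊ - 1

theorem gridIdx_lt (n : ℕ) (r : unitInterval) : gridIdx n r < n + 1 := by
  have : ⌈((n : ℝ) + 1) * r⌉₊ ≤ n + 1 := by
    rw [Nat.ceil_le]
    push_cast
    have := r.2.2
    have hn : (0 : ℝ) < n + 1 := by positivity
    nlinarith
  unfold gridIdx
  omega

/-- For r > 0 the ceiling is at least 1, so the truncated subtraction in `gridIdx` is a true one.
The point r = 0 lies in no half-open cell, and is a null set. -/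
theorem mem_Ioc_gridPt_iff {n i : ℕ} (hi : i < n + 1) {r : unitInterval} (hr : 0 < r) :
    r ∈ Set.Ioc (gridPt n i) (gridPt n (i + 1)) ↔ i = gridIdx n r := by
  have hn : (0 : ℝ) < n + 1 := by positivity
  have hr' : (0 : ℝ) < r := hr
  have hc : 0 < ⌈((n : ℝ) + 1) * r⌉₊ := Nat.ceil_pos.2 (by positivity)
  rw [Set.mem_Ioc, ← Subtype.coe_lt_coe, ← Subtype.coe_le_coe, coe_gridPt hi.le, coe_gridPt hi,
    div_lt_iff₀ hn, le_div_iff₀ hn, mul_comm (r : ℝ), ← Nat.lt_ceil, ← Nat.ceil_le]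
  unfold gridIdx
  omega

theorem tendsto_gridPt_gridIdx {r : unitInterval} (hr : 0 < r) :
    Tendsto (fun n => gridPt n (gridIdx n r)) atTop (𝓝 r) := by
  rw [tendsto_subtype_rng]
  have hlim : Tendsto (fun n : ℕ => (r : ℝ) - 1 / ((n : ℝ) + 1)) atTop (𝓝 (r - 0)) :=
    tendsto_const_nhds.sub tendsto_one_div_add_atTop_nhds_zero_nat
  rw [sub_zero] at hlim
  refine tendsto_of_tendsto_of_tendsto_of_le_of_le hlim tendsto_const_nhds (fun n => ?_)
    fun n => ?_
  · have h := ((mem_Ioc_gridPt_iff (gridIdx_lt n r) hr).2 rfl).2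
    have hn : (0 : ℝ) < n + 1 := by positivity
    rw [← Subtype.coe_le_coe, coe_gridPt (gridIdx_lt n r)] at h
    simp only
    rw [coe_gridPt (gridIdx_lt n r).le]
    push_cast at h
    rw [add_div] at h
    linarith
  · exact ((mem_Ioc_gridPt_iff (gridIdx_lt n r) hr).2 rfl).1.le

theorem measurable_gridPt_gridIdx (n : ℕ) : Measurable fun r => gridPt n (gridIdx n r) := by
  have h1 : Measurable (gridIdx n) := by
    unfold gridIdx
    have : Measurable fun r : unitInterval => ⌈((n : ℝ) + 1) * r⌉₊ :=
      Nat.measurable_ceil.comp (by fun_prop)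
    exact (measurable_from_top (f := fun k : ℕ => k - 1)).comp this
  exact (measurable_from_top (f := gridPt n)).comp h1

/-- Simple functions with values in the torus that approximate the identity. -/
noncomputable def torusApprox (n : ℕ) : SimpleFunc UnitAddCircle UnitAddCircle :=
  SimpleFunc.nearestPt (TopologicalSpace.denseSeq UnitAddCircle) n

theorem tendsto_torusApprox (y : UnitAddCircle) :
    Tendsto (fun n => torusApprox n y) atTop (𝓝 y) :=
  SimpleFunc.tendsto_nearestPt (TopologicalSpace.denseRange_denseSeq _ y)

/-- The value of a field at the grid point attached to a given point. -/
noncomputable def gridVal (n : ℕ) (q : unitInterval × UnitAddCircle) :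
    unitInterval × UnitAddCircle := (gridPt n (gridIdx n q.1), torusApprox n q.2)

theorem tendsto_gridVal {q : unitInterval × UnitAddCircle} (hq : 0 < q.1) :
    Tendsto (fun n => gridVal n q) atTop (𝓝 q) :=
  (tendsto_gridPt_gridIdx hq).prodMk_nhds (tendsto_torusApprox q.2)

theorem measurable_gridVal (n : ℕ) : Measurable (gridVal n) :=
  ((measurable_gridPt_gridIdx n).comp measurable_fst).prodMk
    ((torusApprox n).measurable.comp measurable_snd)

theorem ae_pos_fst : ∀ᵐ q : unitInterval × UnitAddCircle, 0 < q.1 := by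
  have h1 : ∀ᵐ r : unitInterval, 0 < r := by
    have : ∀ᵐ r : unitInterval, r ≠ 0 := by
      simp [ae_iff, measure_singleton]
    filter_upwards [this] with r hr using unitInterval.pos_iff_ne_zero.2 hr
  exact Measure.quasiMeasurePreserving_fst.ae h1

end Grid

/-! ### Simple integrands sampled at left grid points, and their conditional moments -/

section Approx

variable {Ω : Type*} [mΩ : MeasurableSpace Ω] {P : Measure Ω} [IsProbabilityMeasure P]
  [P.IsComplete] {ξ : WhiteNoise P} {F : Ω → unitInterval → UnitAddCircle → ℝ}

variable (ξ) in
/-- Bounded adapted random fields. -/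
structure IsBoundedAdapted (F : Ω → unitInterval → UnitAddCircle → ℝ) : Prop where
  adapted : ∀ r y, Measurable[ξ.filtration r] fun ω => F ω r y
  bounded : ∃ C : ℝ, ∀ ω r y, |F ω r y| ≤ C

/-- The elementary integrand that equals `F` at a grid point on the corresponding rectangle. -/
noncomputable def gridElem (hF : IsBoundedAdapted ξ F) (n i : ℕ) (z : UnitAddCircle) :
    Elementary ξ where
  a := gridPt n i
  b := gridPt n (i + 1)
  B := torusApprox n ⁻¹' {z}
  measB := (torusApprox n).measurableSet_fiber z
  X := fun ω => F ω (gridPt n i) z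
  measX := hF.adapted _ _
  bddX := hF.bounded.imp fun _ hC ω => hC ω _ _

/-- The approximation of a field by a simple integrand on a grid. -/
noncomputable def gridList (hF : IsBoundedAdapted ξ F) (n : ℕ) : List (Elementary ξ) :=
  (List.range (n + 1)).reverse.flatMap fun i =>
    (torusApprox n).range.toList.map fun z => gridElem hF n i z

theorem sum_map_gridList {M : Type*} [AddCommMonoid M] (hF : IsBoundedAdapted ξ F) (n : ℕ)
    (g : Elementary ξ → M) :
    ((gridList hF n).map g).sum
      = ∑ i ∈ Finset.range (n + 1), ∑ z ∈ (torusApprox n).range, g (gridElem hF n i z) := by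
  have h : ∀ l : List ℕ, ((l.flatMap fun i =>
      (torusApprox n).range.toList.map fun z => gridElem hF n i z).map g).sum
      = (l.map fun i => ∑ z ∈ (torusApprox n).range, g (gridElem hF n i z)).sum := fun l => by
    induction l with
    | nil => rfl
    | cons i l ih =>
      rw [List.flatMap_cons, List.map_append, List.sum_append, ih, List.map_cons, List.sum_cons,
        List.map_map, ← Finset.sum_map_toList]
      rfl
  rw [gridList, h, List.map_reverse, List.sum_reverse]
  rfl

/-- The time index is enumerated backwards because the moment bound peels off the latest rectangle
first. Cells of one time slab are separated by the fibres of the spatial approximation. -/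
theorem pairwise_gridList (hF : IsBoundedAdapted ξ F) (n : ℕ) :
    (gridList hF n).Pairwise fun e e' => e'.a ≤ e.a ∧ Disjoint e'.rect e.rect := by
  rw [gridList, List.pairwise_flatMap]
  constructor
  · intro i _
    rw [List.pairwise_map]
    refine (Finset.nodup_toList _).imp fun {z z'} hzz' => ⟨le_rfl, ?_⟩
    refine Set.disjoint_left.2 fun x hx hx' => hzz' ?_
    exact (show torusApprox n x.2 = z from hx'.2).symm.trans
      (show torusApprox n x.2 = z' from hx.2)
  · rw [List.pairwise_reverse]
    refine (List.pairwise_lt_range).imp fun {i j} hij => ?_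
    simp only [List.mem_map]
    rintro _ ⟨z, _, rfl⟩ _ ⟨z', _, rfl⟩
    refine ⟨gridPt_mono n hij.le, Set.disjoint_left.2 fun x hx hx' => ?_⟩
    exact absurd hx'.1.1 (not_lt.2 (hx.1.2.trans (gridPt_mono n hij)))

/-- The cells partition the positive times, so only the cell containing q contributes. -/
theorem sum_grid {M : Type*} [AddCommMonoid M] {n : ℕ} {q : unitInterval × UnitAddCircle}
    (hq : 0 < q.1) (g : unitInterval → UnitAddCircle → M) :
    (open Classical in ∑ i ∈ Finset.range (n + 1), ∑ z ∈ (torusApprox n).range,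
      if q.1 ∈ Set.Ioc (gridPt n i) (gridPt n (i + 1)) ∧ q.2 ∈ torusApprox n ⁻¹' {z}
      then g (gridPt n i) z else 0) = g (gridVal n q).1 (gridVal n q).2 := by
  rw [Finset.sum_eq_single (gridIdx n q.1), Finset.sum_eq_single (torusApprox n q.2)]
  · rw [if_pos ⟨(mem_Ioc_gridPt_iff (gridIdx_lt n q.1) hq).2 rfl, rfl⟩]
    rfl
  · intro z _ hz
    rw [if_neg fun h => hz h.2.symm]
  · intro h
    exact absurd (SimpleFunc.mem_range_self _ _) h
  · intro i hi hne
    refine Finset.sum_eq_zero fun z _ => if_neg fun h => hne ?_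
    exact (mem_Ioc_gridPt_iff (Finset.mem_range.1 hi) hq).1 h.1
  · intro h
    exact absurd (Finset.mem_range.2 (gridIdx_lt n q.1)) h

theorem fieldSum_gridList (hF : IsBoundedAdapted ξ F) (n : ℕ) (ω : Ω)
    {q : unitInterval × UnitAddCircle} (hq : 0 < q.1) :
    fieldSum (gridList hF n) (ω, q) = F ω (gridVal n q).1 (gridVal n q).2 := by
  rw [fieldSum, sum_map_gridList]
  exact sum_grid hq fun r y => F ω r y

theorem sum_volume_gridList_le (hF : IsBoundedAdapted ξ F) (n : ℕ)
    (h : unitInterval → UnitAddCircle → ℝ≥0∞) :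
    ∑ i ∈ Finset.range (n + 1), ∑ z ∈ (torusApprox n).range,
      volume (gridElem hF n i z).rect * h (gridPt n i) z
    = ∫⁻ q, h (gridVal n q).1 (gridVal n q).2 := by
  classical
  have h1 : ∀ i z, volume (gridElem hF n i z).rect * h (gridPt n i) z
      = ∫⁻ q, (gridElem hF n i z).rect.indicator (fun _ => h (gridPt n i) z) q := fun i z => by
    rw [lintegral_indicator_const (gridElem hF n i z).measurableSet_rect, mul_comm]
  have hm : ∀ i z, Measurable
      ((gridElem hF n i z).rect.indicator (fun _ => h (gridPt n i) z)) := fun i z =>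
    measurable_const.indicator (gridElem hF n i z).measurableSet_rect
  simp_rw [h1]
  rw [Finset.sum_congr rfl fun i _ => (lintegral_finsetSum _ fun z _ => hm i z).symm,
    ← lintegral_finsetSum _ fun i _ => Finset.measurable_fun_sum _ fun z _ => hm i z]
  refine lintegral_congr_ae ?_
  filter_upwards [ae_pos_fst] with q hq
  rw [← sum_grid hq h]
  refine Finset.sum_congr rfl fun i _ => Finset.sum_congr rfl fun z _ => ?_
  rw [Set.indicator_apply]
  exact if_congr Iff.rfl rfl rfl

theorem tendsto_eLpNorm_of_dominated {α : Type*} [MeasurableSpace α] {μ : Measure α}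
    {f g : α → ℝ} {fn : ℕ → α → ℝ} (hg : MemLp g 2 μ) (hf : AEStronglyMeasurable f μ)
    (hfn : ∀ n, AEStronglyMeasurable (fn n) μ)
    (hb : ∀ n, ∀ᵐ x ∂μ, |f x - fn n x| ≤ g x)
    (hlim : ∀ᵐ x ∂μ, Tendsto (fun n => fn n x) atTop (𝓝 (f x))) :
    Tendsto (fun n => eLpNorm (f - fn n) 2 μ) atTop (𝓝 0) := by
  have h : Tendsto (fun n => ∫⁻ x, ‖(f - fn n) x‖ₑ ^ (2 : ℝ) ∂μ) atTop (𝓝 (∫⁻ x, 0 ∂μ)) := by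
    refine tendsto_lintegral_of_dominated_convergence' (fun x => ‖g x‖ₑ ^ (2 : ℝ))
      (fun n => ((hf.sub (hfn n)).enorm.pow_const _)) (fun n => ?_) ?_ ?_
    · filter_upwards [hb n] with x hx
      gcongr
      rw [Pi.sub_apply, enorm_le_iff_norm_le]
      exact hx.trans (le_abs_self _)
    · have := lintegral_rpow_enorm_lt_top_of_eLpNorm_lt_top two_ne_zero ENNReal.ofNat_ne_top hg.2
      simpa using this.ne
    · filter_upwards [hlim] with x hx
      have h1 : Tendsto (fun n => (f - fn n) x) atTop (𝓝 (f x - f x)) :=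
        tendsto_const_nhds.sub hx
      rw [sub_self] at h1
      have h2 := (continuous_enorm.tendsto _).comp h1
      have h3 := (ENNReal.continuous_rpow_const (y := 2)).tendsto _ |>.comp h2
      simpa [Function.comp_def] using h3
  simp_rw [eLpNorm_eq_lintegral_rpow_enorm_toReal two_ne_zero ENNReal.ofNat_ne_top]
  rw [lintegral_zero] at h
  have h2 := (ENNReal.continuous_rpow_const (y := 1 / (2 : ℝ≥0∞).toReal)).tendsto _ |>.comp h
  simpa [Function.comp_def] using h2

theorem tendsto_fieldSum_gridList (hF : IsBoundedAdapted ξ F)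
    (hFm : Measurable (uncurryField F))
    (hFc : ∀ᵐ q ∂(P.prod (volume : Measure (unitInterval × UnitAddCircle))),
      ContinuousAt (fun q' : unitInterval × UnitAddCircle => F q.1 q'.1 q'.2) q.2) :
    Tendsto (fun n => eLpNorm (uncurryField F - fieldSum (gridList hF n)) 2
      (P.prod (volume : Measure (unitInterval × UnitAddCircle)))) atTop (𝓝 0) := by
  obtain ⟨C, hC⟩ := hF.bounded
  have hpos : ∀ᵐ q ∂(P.prod (volume : Measure (unitInterval × UnitAddCircle))), 0 < q.2.1 :=
    Measure.quasiMeasurePreserving_snd.ae ae_pos_fst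
  refine tendsto_eLpNorm_of_dominated (g := fun _ => C + C) (memLp_const _)
    hFm.aestronglyMeasurable (fun n => (measurable_fieldSum _).aestronglyMeasurable)
    (fun n => ?_) ?_
  · filter_upwards [hpos] with q hq
    have : fieldSum (gridList hF n) q = _ := fieldSum_gridList hF n q.1 hq
    rw [this]
    exact (abs_sub _ _).trans (add_le_add (hC _ _ _) (hC _ _ _))
  · filter_upwards [hpos, hFc] with q hq hc
    have : ∀ n, fieldSum (gridList hF n) q = _ := fun n => fieldSum_gridList hF n q.1 hq
    simp_rw [this]
    exact hc.tendsto.comp (tendsto_gridVal hq)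

theorem tendsto_lintegral_gridVal {H : unitInterval → UnitAddCircle → ℝ}
    (hHm : Measurable fun q : unitInterval × UnitAddCircle => H q.1 q.2)
    (hHb : ∃ C : ℝ, ∀ r y, |H r y| ≤ C)
    (hHc : ∀ᵐ q : unitInterval × UnitAddCircle,
      ContinuousAt (fun q' : unitInterval × UnitAddCircle => H q'.1 q'.2) q) :
    Tendsto (fun n => ∫⁻ q, ENNReal.ofReal (H (gridVal n q).1 (gridVal n q).2) ^ 2) atTop
      (𝓝 (∫⁻ q : unitInterval × UnitAddCircle, ENNReal.ofReal (H q.1 q.2) ^ 2)) := by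
  obtain ⟨C, hC⟩ := hHb
  refine tendsto_lintegral_of_dominated_convergence (fun _ => ENNReal.ofReal C ^ 2) (fun n => ?_)
    (fun n => .of_forall fun q => ?_) ?_ ?_
  · exact ((hHm.comp (measurable_gridVal n)).ennreal_ofReal).pow_const _
  · dsimp only
    gcongr
    exact (le_abs_self _).trans (hC _ _)
  · simpa using ENNReal.mul_ne_top (ENNReal.pow_ne_top ENNReal.ofReal_ne_top)
      (measure_ne_top (volume : Measure (unitInterval × UnitAddCircle)) _)
  · filter_upwards [ae_pos_fst, hHc] with q hq hc
    have := hc.tendsto.comp (tendsto_gridVal hq)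
    exact ENNReal.Tendsto.pow ((ENNReal.continuous_ofReal.tendsto _).comp this)

/-- The conditional `L_p` norm of `X` given the σ-algebra at time `s` is bounded by `c`, expressed
through the `L_p` norms on the events of that σ-algebra. -/
def CondBound (P : Measure Ω) [P.IsComplete] (ξ : WhiteNoise P) (p : ℝ) (s : unitInterval)
    (X : Ω → ℝ) (c : ℝ≥0∞) : Prop :=
  ∀ A, MeasurableSet[ξ.filtration s] A →
    eLpNorm X (ENNReal.ofReal p) (P.restrict A) ≤ c * P A ^ (1 / p)

/-- The indicator of A ∈ 𝓕_s commutes with the simple integral and may be moved into the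
coefficients. The unconditional bound for the new coefficients is then a conditional bound for the
old ones. -/
theorem eLpNorm_gridList_sq_le {p : ℝ} (hp : 2 ≤ p) (hF : IsBoundedAdapted ξ F)
    {s : unitInterval} (hs : ∀ ω r y, r < s → F ω r y = 0) {H : unitInterval → UnitAddCircle → ℝ}
    (hFH : ∀ r y, CondBound P ξ p s (fun ω => F ω r y) (ENNReal.ofReal (H r y))) (n : ℕ)
    {A : Set Ω} (hA : MeasurableSet[ξ.filtration s] A) :
    eLpNorm (integralSum (gridList hF n)) (ENNReal.ofReal p) (P.restrict A) ^ 2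
      ≤ ENNReal.ofReal (momentConst p) * (P A ^ (1 / p)) ^ 2 *
        ∫⁻ q, ENNReal.ofReal (H (gridVal n q).1 (gridVal n q).2) ^ 2 := by
  have hA' : MeasurableSet A := ξ.filtration.le s A hA
  -- Multiplying by the indicator keeps the field adapted: before s the field vanishes, and from s
  -- on A belongs to the σ-algebra.
  have hFA : IsBoundedAdapted ξ fun ω r y => A.indicator (fun ω => F ω r y) ω := by
    constructor
    · intro r y
      rcases lt_or_ge r s with hr | hr
      · have : (A.indicator fun ω => F ω r y) = fun _ => 0 := by
          ext ω
          by_cases hω : ω ∈ A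
          · rw [Set.indicator_of_mem hω, hs _ _ _ hr]
          · rw [Set.indicator_of_notMem hω]
        rw [this]
        exact measurable_const
      · exact (hF.adapted r y).indicator (ξ.filtration.mono hr A hA)
    · obtain ⟨C, hC⟩ := hF.bounded
      refine ⟨C, fun ω r y => ?_⟩
      by_cases hω : ω ∈ A
      · rw [Set.indicator_of_mem hω]
        exact hC _ _ _
      · rw [Set.indicator_of_notMem hω, abs_zero]
        exact (abs_nonneg _).trans (hC ω r y)
  have hind : A.indicator (integralSum (gridList hF n)) = integralSum (gridList hFA n) := by
    ext ω
    rw [integralSum, sum_map_gridList]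
    by_cases hω : ω ∈ A
    · rw [Set.indicator_of_mem hω, integralSum, sum_map_gridList]
      refine Finset.sum_congr rfl fun i _ => Finset.sum_congr rfl fun z _ => ?_
      rw [Elementary.integral_eq, Elementary.integral_eq]
      congr 1
      exact (Set.indicator_of_mem hω _).symm
    · rw [Set.indicator_of_notMem hω]
      refine (Finset.sum_eq_zero fun i _ => Finset.sum_eq_zero fun z _ => ?_).symm
      rw [Elementary.integral_eq]
      have h0 : (gridElem hFA n i z).X ω = 0 :=
        Set.indicator_of_notMem hω fun ω => F ω (gridPt n i) z
      rw [h0, zero_mul]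
  rw [← eLpNorm_indicator_eq_eLpNorm_restrict hA', hind]
  refine (eLpNorm_integralSum_sq_le hp _ (pairwise_gridList hFA n)).trans ?_
  rw [mul_assoc]
  gcongr
  rw [sum_map_gridList, ← sum_volume_gridList_le hFA n fun r y => ENNReal.ofReal (H r y) ^ 2,
    Finset.mul_sum]
  refine Finset.sum_le_sum fun i _ => ?_
  rw [Finset.mul_sum]
  refine Finset.sum_le_sum fun z _ => ?_
  have := hFH (gridPt n i) z A hA
  rw [← eLpNorm_indicator_eq_eLpNorm_restrict hA'] at this
  calc _ ≤ volume (gridElem hFA n i z).rect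
        * (ENNReal.ofReal (H (gridPt n i) z) * P A ^ (1 / p)) ^ 2 := by
        gcongr
        exact this
    _ = _ := by ring

/-- Approximation of bounded fields by simple integrands with moment bounds. -/
theorem exists_simple_approx {p : ℝ} (hp : 2 ≤ p) (hF : IsBoundedAdapted ξ F)
    (hFm : Measurable (uncurryField F))
    (hFc : ∀ᵐ q ∂(P.prod (volume : Measure (unitInterval × UnitAddCircle))),
      ContinuousAt (fun q' : unitInterval × UnitAddCircle => F q.1 q'.1 q'.2) q.2)
    {s : unitInterval} (hs : ∀ ω r y, r < s → F ω r y = 0) {H : unitInterval → UnitAddCircle → ℝ}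
    (hHm : Measurable fun q : unitInterval × UnitAddCircle => H q.1 q.2)
    (hHb : ∃ C : ℝ, ∀ r y, |H r y| ≤ C)
    (hHc : ∀ᵐ q : unitInterval × UnitAddCircle,
      ContinuousAt (fun q' : unitInterval × UnitAddCircle => H q'.1 q'.2) q)
    (hFH : ∀ r y, CondBound P ξ p s (fun ω => F ω r y) (ENNReal.ofReal (H r y)))
    {ε : ℝ≥0∞} (hε : 0 < ε) :
    ∃ l : List (Elementary ξ), eLpNorm (uncurryField F - fieldSum l) 2
        (P.prod (volume : Measure (unitInterval × UnitAddCircle))) ≤ ε ∧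
      ∀ A, MeasurableSet[ξ.filtration s] A →
        eLpNorm (integralSum l) (ENNReal.ofReal p) (P.restrict A) ^ 2
          ≤ ENNReal.ofReal (momentConst p) * (P A ^ (1 / p)) ^ 2 *
            ((∫⁻ q : unitInterval × UnitAddCircle, ENNReal.ofReal (H q.1 q.2) ^ 2) + ε) := by
  have h1 := (tendsto_fieldSum_gridList hF hFm hFc).eventually (ge_mem_nhds hε)
  have hfin : ∫⁻ q : unitInterval × UnitAddCircle, ENNReal.ofReal (H q.1 q.2) ^ 2 ≠ ∞ := by
    obtain ⟨C, hC⟩ := hHb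
    refine ((lintegral_mono fun q => ?_).trans_lt
      (lintegral_const_lt_top (μ := volume) (c := ENNReal.ofReal C ^ 2) (by simp))).ne
    gcongr
    exact (le_abs_self _).trans (hC _ _)
  have h2 := (tendsto_lintegral_gridVal hHm hHb hHc).eventually
    (ge_mem_nhds (ENNReal.lt_add_right hfin hε.ne'))
  obtain ⟨n, hn1, hn2⟩ := (h1.and h2).exists
  refine ⟨gridList hF n, hn1, fun A hA => ?_⟩
  exact (eLpNorm_gridList_sq_le hp hF hs hFH n hA).trans (by gcongr)

/-- The moment bound for stochastic integrals whose integrands are approximated by simple ones. -/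
theorem eLpNorm_stochasticIntegral_sq_le {p : ℝ} (hp : 2 ≤ p) (hFm : Measurable (uncurryField F))
    {J : Ω → ℝ} (hJ : IsStochasticIntegral ξ F J) (hJm : Measurable J) {s : unitInterval}
    {K : ℝ≥0∞} (happ : ∀ ε : ℝ≥0∞, 0 < ε → ∃ l : List (Elementary ξ),
      eLpNorm (uncurryField F - fieldSum l) 2
        (P.prod (volume : Measure (unitInterval × UnitAddCircle))) ≤ ε ∧
      ∀ A, MeasurableSet[ξ.filtration s] A →
        eLpNorm (integralSum l) (ENNReal.ofReal p) (P.restrict A) ^ 2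
          ≤ ENNReal.ofReal (momentConst p) * (P A ^ (1 / p)) ^ 2 * (K + ε))
    {A : Set Ω} (hA : MeasurableSet[ξ.filtration s] A) :
    eLpNorm J (ENNReal.ofReal p) (P.restrict A) ^ 2
      ≤ ENNReal.ofReal (momentConst p) * (P A ^ (1 / p)) ^ 2 * K := by
  have hε : ∀ n : ℕ, (0 : ℝ≥0∞) < (n : ℝ≥0∞)⁻¹ := fun n => by simp
  choose l hl1 hl2 using fun n : ℕ => happ _ (hε n)
  have hl : Tendsto (fun n => eLpNorm (uncurryField F - fieldSum (l n)) 2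
      (P.prod (volume : Measure (unitInterval × UnitAddCircle)))) atTop (𝓝 0) :=
    tendsto_of_tendsto_of_tendsto_of_le_of_le tendsto_const_nhds
      ENNReal.tendsto_inv_nat_nhds_zero (fun _ => zero_le) hl1
  have hI := hJ.tendsto_integralSum hFm hJm hl
  simp_rw [eLpNorm_sub_comm J] at hI
  -- The isometry gives convergence of the integrals only in L_2. A subsequence converges almost
  -- surely, and lower semicontinuity of the L_p norm then passes the moment bound to the limit.
  obtain ⟨ns, hns, hae⟩ := (tendstoInMeasure_of_tendsto_eLpNorm two_ne_zero
    (fun n => (measurable_integralSum (l n)).aestronglyMeasurable)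
    hJm.aestronglyMeasurable hI).exists_seq_tendsto_ae
  have hF := Lp.eLpNorm_lim_le_liminf_eLpNorm (p := ENNReal.ofReal p) (μ := P.restrict A)
    (f := fun n => integralSum (l (ns n)))
    (fun n => (measurable_integralSum _).aestronglyMeasurable) J (ae_restrict_of_ae hae)
  set c := ENNReal.ofReal (momentConst p) * (P A ^ (1 / p)) ^ 2 with hc
  have hctop : c ≠ ∞ := by
    refine ENNReal.mul_ne_top ENNReal.ofReal_ne_top (ENNReal.pow_ne_top ?_)
    exact ENNReal.rpow_ne_top_of_nonneg (by positivity) (measure_ne_top _ _)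
  have hlim : Tendsto (fun n => (c * (K + ((ns n : ℕ) : ℝ≥0∞)⁻¹)) ^ (1 / 2 : ℝ)) atTop
      (𝓝 ((c * K) ^ (1 / 2 : ℝ))) := by
    refine ((ENNReal.continuous_rpow_const (y := 1 / 2)).tendsto _).comp ?_
    refine ENNReal.Tendsto.const_mul ?_ (Or.inr hctop)
    have := (ENNReal.tendsto_inv_nat_nhds_zero.comp hns.tendsto_atTop).const_add K
    simpa using this
  have hle : eLpNorm J (ENNReal.ofReal p) (P.restrict A) ≤ (c * K) ^ (1 / 2 : ℝ) := by
    refine hF.trans ?_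
    rw [← hlim.liminf_eq]
    refine liminf_le_liminf (.of_forall fun n => ?_)
    have := ENNReal.rpow_le_rpow (hl2 (ns n) A hA) (show (0 : ℝ) ≤ 1 / 2 by norm_num)
    rwa [← ENNReal.rpow_natCast, ← ENNReal.rpow_mul, show ((2 : ℕ) : ℝ) * (1 / 2) = 1 by norm_num,
      ENNReal.rpow_one] at this
  calc _ ≤ ((c * K) ^ (1 / 2 : ℝ)) ^ 2 := by gcongr
    _ = c * K := by
      rw [← ENNReal.rpow_natCast, ← ENNReal.rpow_mul, show (1 / 2 : ℝ) * ((2 : ℕ) : ℝ) = 1 by norm_num,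
        ENNReal.rpow_one]

end Approx

/-! ### Square integrals of the heat kernel -/

section KernelSquare

theorem lintegral_rpow_mul_exp {l : ℝ} (hl : 0 < l) :
    ∫⁻ r in Set.Ioi (0 : ℝ), ENNReal.ofReal (r ^ (-(1 / 2) : ℝ) * Real.exp (-(l * r)))
      = ENNReal.ofReal (Real.sqrt Real.pi * l ^ (-(1 / 2) : ℝ)) := by
  have h := Real.integral_rpow_mul_exp_neg_mul_Ioi (a := 1 / 2) (r := l) (by norm_num) hl
  rw [show (1 / 2 - 1 : ℝ) = -(1 / 2) by norm_num, Real.Gamma_one_half_eq] at h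
  have hpos : 0 < (1 / l) ^ (1 / 2 : ℝ) * Real.sqrt Real.pi := by positivity
  have hint : IntegrableOn (fun r : ℝ => r ^ (-(1 / 2) : ℝ) * Real.exp (-(l * r)))
      (Set.Ioi 0) := by
    -- A function that is not integrable would have Bochner integral 0, whereas the Gamma formula
    -- gives a positive value.
    by_contra hn
    rw [integral_undef hn] at h
    exact hpos.ne h
  rw [← ofReal_integral_eq_lintegral_ofReal hint, h]
  · rw [one_div l, Real.inv_rpow hl.le, Real.rpow_neg hl.le, mul_comm]
  · filter_upwards [ae_restrict_mem measurableSet_Ioi] with r hr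
    have : (0 : ℝ) < r := hr
    positivity

theorem lintegral_unitInterval_le (f : ℝ → ℝ≥0∞) :
    ∫⁻ r : unitInterval, f r ≤ ∫⁻ r, f r := by
  have : ∫⁻ r : unitInterval, f r = ∫⁻ r in unitInterval, f r :=
    lintegral_subtype_comap measurableSet_Icc f
  rw [this]
  exact setLIntegral_le_lintegral _ _

/-- One factor of the kernel is bounded by C τ^{-1/2} and the other has mass one. The time integral
is then a Γ(1/2) integral of order l^{-1/2}, the smallness in l on which the Gronwall argument
depends; only one of the two exponential factors is needed. -/
theorem exists_lintegral_torusKernel_sq_le : ∃ C : ℝ, 0 ≤ C ∧ ∀ (l : ℝ), 0 < l →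
    ∀ (t : unitInterval) (x : UnitAddCircle),
      ∫⁻ q : unitInterval × UnitAddCircle, ENNReal.ofReal
        (torusKernel ((t : ℝ) - q.1) (x - q.2) * Real.exp (-(l * ((t : ℝ) - q.1)))) ^ 2
      ≤ ENNReal.ofReal (C * l ^ (-(1 / 2) : ℝ)) := by
  obtain ⟨C, hC0, hC⟩ := exists_torusKernel_le
  refine ⟨C * Real.sqrt Real.pi, by positivity, fun l hl t x => ?_⟩
  have hm : Measurable fun q : unitInterval × UnitAddCircle =>
      torusKernel ((t : ℝ) - q.1) (x - q.2) :=
    measurable_torusKernel.comp (f := fun q : unitInterval × UnitAddCircle =>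
      ((t : ℝ) - q.1, x - q.2)) (by fun_prop)
  -- Extension by zero to the whole line makes the integral invariant under r ↦ t - r.
  set g : ℝ → ℝ≥0∞ := (Set.Ioi (0 : ℝ)).indicator
    fun r => ENNReal.ofReal C * ENNReal.ofReal (r ^ (-(1 / 2) : ℝ) * Real.exp (-(l * r))) with hg
  have key : ∀ r : unitInterval, ∫⁻ y, ENNReal.ofReal
      (torusKernel ((t : ℝ) - r) (x - y) * Real.exp (-(l * ((t : ℝ) - r)))) ^ 2
      ≤ g ((t : ℝ) - r) := fun r => by
    rcases le_or_gt ((t : ℝ) - r) 0 with h0 | h0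
    · simp [torusKernel_of_nonpos h0]
    · have h1 : (t : ℝ) - r ≤ 1 := by linarith [t.2.2, r.2.1]
      rw [hg, Set.indicator_of_mem (Set.mem_Ioi.2 h0)]
      set τ := (t : ℝ) - r
      have hK := (continuous_torusKernel h0).measurable
      have hE : Real.exp (-(l * τ)) ≤ 1 := Real.exp_le_one_iff.2 (by nlinarith)
      calc ∫⁻ y, ENNReal.ofReal (torusKernel τ (x - y) * Real.exp (-(l * τ))) ^ 2
          ≤ ∫⁻ y, (ENNReal.ofReal C * ENNReal.ofReal (τ ^ (-(1 / 2) : ℝ) * Real.exp (-(l * τ))))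
              * ENNReal.ofReal (torusKernel τ (x - y)) := by
            refine lintegral_mono fun y => ?_
            rw [← ENNReal.ofReal_mul hC0, ← ENNReal.ofReal_mul (by positivity),
              ← ENNReal.ofReal_pow (mul_nonneg (torusKernel_nonneg _ _) (Real.exp_pos _).le)]
            refine ENNReal.ofReal_le_ofReal ?_
            have h2 := hC τ h0 h1 (x - y)
            have h3 := torusKernel_nonneg τ (x - y)
            have h4 := Real.exp_pos (-(l * τ))
            calc (torusKernel τ (x - y) * Real.exp (-(l * τ))) ^ 2
                = torusKernel τ (x - y) * Real.exp (-(l * τ)) *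
                  (torusKernel τ (x - y) * Real.exp (-(l * τ))) := by ring
              _ ≤ (C * τ ^ (-(1 / 2) : ℝ)) * Real.exp (-(l * τ)) *
                  (torusKernel τ (x - y) * 1) := by gcongr
              _ = _ := by ring
        _ = _ := by
            rw [lintegral_const_mul _ (by fun_prop), lintegral_torusKernel h0, mul_one]
  calc _ = ∫⁻ r : unitInterval, ∫⁻ y, ENNReal.ofReal
        (torusKernel ((t : ℝ) - r) (x - y) * Real.exp (-(l * ((t : ℝ) - r)))) ^ 2 := by
        refine lintegral_prod _ (Measurable.aemeasurable ?_)
        fun_prop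
    _ ≤ ∫⁻ r : unitInterval, g ((t : ℝ) - r) := lintegral_mono key
    _ ≤ ∫⁻ r, g ((t : ℝ) - r) := lintegral_unitInterval_le fun r => g ((t : ℝ) - r)
    _ = ∫⁻ r, g r := lintegral_sub_left_eq_self g _
    _ = ENNReal.ofReal (C * Real.sqrt Real.pi * l ^ (-(1 / 2) : ℝ)) := by
        rw [hg, lintegral_indicator measurableSet_Ioi, lintegral_const_mul _ (by fun_prop),
          lintegral_rpow_mul_exp hl, ← ENNReal.ofReal_mul hC0, mul_assoc]

/-- The weight with l = 1 is bounded below on the unit interval, so it can be removed at the cost of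
the factor e². -/
theorem lintegral_torusKernel_sq_ne_top (t : unitInterval) (x : UnitAddCircle) :
    ∫⁻ q : unitInterval × UnitAddCircle,
      ENNReal.ofReal (torusKernel ((t : ℝ) - q.1) (x - q.2)) ^ 2 ≠ ∞ := by
  obtain ⟨C, hC0, hC⟩ := exists_lintegral_torusKernel_sq_le
  have h := hC 1 one_pos t x
  have hle : ∫⁻ q : unitInterval × UnitAddCircle,
      ENNReal.ofReal (torusKernel ((t : ℝ) - q.1) (x - q.2)) ^ 2
      ≤ ENNReal.ofReal (Real.exp 1) ^ 2 * ENNReal.ofReal (C * 1 ^ (-(1 / 2) : ℝ)) := by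
    refine le_trans ?_ (mul_le_mul_right h _)
    rw [← lintegral_const_mul' _ _ (by simp)]
    refine lintegral_mono fun q => ?_
    rw [← mul_pow, ← ENNReal.ofReal_mul (Real.exp_pos _).le]
    gcongr
    rw [mul_left_comm, ← Real.exp_add]
    refine le_mul_of_one_le_right (torusKernel_nonneg _ _) (Real.one_le_exp ?_)
    linarith [t.2.2, q.1.2.1]
  refine (hle.trans_lt ?_).ne
  exact ENNReal.mul_lt_top (by simp) ENNReal.ofReal_lt_top

end KernelSquare

/-! ### Predictable fields -/

section Predictable

variable {Ω : Type*} [mΩ : MeasurableSpace Ω] {P : Measure Ω} [P.IsComplete] {ξ : WhiteNoise P}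

theorem predictable_le : (ξ.filtration).predictable ≤ (inferInstance : MeasurableSpace unitInterval).prod mΩ :=
  measurableSpace_le_predictable_of_measurableSet
    (fun _ hA => (measurableSet_singleton _).prod (ξ.filtration.le _ _ hA))
    (fun _ _ hA => measurableSet_Ioi.prod (ξ.filtration.le _ _ hA))

theorem IsPredictableField.measurable {f : Ω → unitInterval → UnitAddCircle → ℝ}
    (hf : IsPredictableField ξ f) : Measurable (uncurryField f) := by
  have h : Measurable fun q : (unitInterval × Ω) × UnitAddCircle => f q.1.2 q.1.1 q.2 :=
    Measurable.mono hf (sup_le_sup (MeasurableSpace.comap_mono predictable_le) le_rfl) le_rfl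
  exact h.comp (f := fun q : Ω × unitInterval × UnitAddCircle => ((q.2.1, q.1), q.2.2))
    (by fun_prop)

/-- Predictable sets are progressively measurable, so the section at time r is measurable for the
σ-algebra at time r. -/
theorem IsPredictableField.adapted {f : Ω → unitInterval → UnitAddCircle → ℝ}
    (hf : IsPredictableField ξ f) (r : unitInterval) (y : UnitAddCircle) :
    Measurable[ξ.filtration r] fun ω => f ω r y := by
  have h1 := measurable_inclusion_predictable (𝓕 := ξ.filtration) (i := r)
  have h2 : @Measurable Ω (Set.Iic r × Ω) (ξ.filtration r)
      (Subtype.instMeasurableSpace.prod (ξ.filtration r)) fun ω => (⟨r, Set.self_mem_Iic⟩, ω) :=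
    Measurable.prodMk (@measurable_const _ _ _ (ξ.filtration r) (⟨r, Set.self_mem_Iic⟩ : Set.Iic r))
      (@measurable_id _ (ξ.filtration r))
  have h3 : @Measurable Ω (unitInterval × Ω) (ξ.filtration r) ξ.filtration.predictable
      fun ω => (r, ω) := h1.comp h2
  have h4 : @Measurable Ω ((unitInterval × Ω) × UnitAddCircle) (ξ.filtration r)
      (ξ.filtration.predictable.prod inferInstance) fun ω => ((r, ω), y) :=
    Measurable.prodMk h3 (@measurable_const _ _ _ (ξ.filtration r) y)
  exact Measurable.comp hf h4

end Predictable

/-! ### Stochastic convolutions -/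

section Convolution

variable {Ω : Type*} [mΩ : MeasurableSpace Ω] {P : Measure Ω} [IsProbabilityMeasure P]
  [P.IsComplete] {ξ : WhiteNoise P} {w : Ω → unitInterval → UnitAddCircle → ℝ}
  {s t : unitInterval} {x : UnitAddCircle} {M : ℝ}

variable (P ξ) in
/-- Bounded adapted random fields which are almost surely continuous after time `s`. -/
structure IsContinuousAdapted (s : unitInterval) (M : ℝ)
    (w : Ω → unitInterval → UnitAddCircle → ℝ) : Prop where
  measurable : Measurable (uncurryField w)
  adapted : ∀ r y, Measurable[ξ.filtration r] fun ω => w ω r y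
  bounded : ∀ ω r y, |w ω r y| ≤ M
  continuous : ∀ᵐ ω ∂P, ∀ r y, s < r →
    ContinuousAt (fun q : unitInterval × UnitAddCircle => w ω q.1 q.2) (r, y)

theorem IsContinuousAdapted.nonneg (hw : IsContinuousAdapted P ξ s M w) : 0 ≤ M := by
  have := ξ.gaussian.isProbabilityMeasure
  obtain ⟨ω⟩ := P.nonempty_of_neZero
  exact (abs_nonneg _).trans (hw.bounded ω 0 0)

open Classical in
/-- The integrand `p_{t - r}(x, y) w(r, y)`, restricted to `s < r < t'`. -/
noncomputable def convField (s t : unitInterval) (t' : ℝ) (x : UnitAddCircle)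
    (w : Ω → unitInterval → UnitAddCircle → ℝ) (ω : Ω) (r : unitInterval) (y : UnitAddCircle) : ℝ :=
  if s < r ∧ (r : ℝ) < t' then torusKernel ((t : ℝ) - r) (x - y) * w ω r y else 0

open Classical in
/-- The function `p_{t - r}(x, y) h(r)`, restricted to `s < r < t'`. -/
noncomputable def convKernel (s t : unitInterval) (t' : ℝ) (x : UnitAddCircle)
    (h : unitInterval → ℝ) (r : unitInterval) (y : UnitAddCircle) : ℝ :=
  if s < r ∧ (r : ℝ) < t' then torusKernel ((t : ℝ) - r) (x - y) * h r else 0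

theorem measurableSet_cut (s : unitInterval) (t' : ℝ) :
    MeasurableSet {r : unitInterval | s < r ∧ (r : ℝ) < t'} :=
  (measurableSet_lt measurable_const measurable_id).inter
    (measurableSet_lt measurable_subtype_coe measurable_const)

theorem measurable_torusKernel_sub (t : unitInterval) (x : UnitAddCircle) :
    Measurable fun q : unitInterval × UnitAddCircle => torusKernel ((t : ℝ) - q.1) (x - q.2) :=
  measurable_torusKernel.comp (f := fun q : unitInterval × UnitAddCircle =>
      ((t : ℝ) - q.1, x - q.2)) (by fun_prop)

theorem measurable_convField (t' : ℝ) (hw : Measurable (uncurryField w)) :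
    Measurable (uncurryField (convField s t t' x w)) :=
  Measurable.ite ((measurableSet_cut s t').preimage (measurable_fst.comp measurable_snd))
    (((measurable_torusKernel_sub t x).comp measurable_snd).mul hw) measurable_const

theorem measurable_convKernel (t' : ℝ) {h : unitInterval → ℝ} (hh : Continuous h) :
    Measurable fun q : unitInterval × UnitAddCircle => convKernel s t t' x h q.1 q.2 :=
  Measurable.ite ((measurableSet_cut s t').preimage measurable_fst)
    ((measurable_torusKernel_sub t x).mul (hh.measurable.comp measurable_fst)) measurable_const

theorem exists_torusKernel_le_of_lt {t' : ℝ} (ht' : t' < t) :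
    ∃ C : ℝ, 0 ≤ C ∧ ∀ (r : unitInterval) (a : UnitAddCircle), (r : ℝ) < t' →
      torusKernel ((t : ℝ) - r) a ≤ C := by
  obtain ⟨C, hC0, hC⟩ := exists_torusKernel_le
  have h0 : 0 < (t : ℝ) - t' := by linarith
  refine ⟨C * ((t : ℝ) - t') ^ (-(1 / 2) : ℝ), by positivity, fun r a hr => ?_⟩
  refine (hC _ (by linarith) (by linarith [t.2.2, r.2.1]) a).trans ?_
  gcongr 1
  exact Real.rpow_le_rpow_of_nonpos h0 (by linarith) (by norm_num)

/-- Stopping at t' < t keeps the kernel away from its singularity at r = t. This is why the cutoff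
is a parameter separate from the kernel time. -/
theorem isBoundedAdapted_convField {t' : ℝ} (ht' : t' < t) (hw : IsContinuousAdapted P ξ s M w) :
    IsBoundedAdapted ξ (convField s t t' x w) := by
  constructor
  · intro r y
    unfold convField
    by_cases h : s < r ∧ (r : ℝ) < t'
    · simp only [if_pos h]
      exact (hw.adapted r y).const_mul _
    · simp only [if_neg h]
      exact measurable_const
  · obtain ⟨C, hC0, hC⟩ := exists_torusKernel_le_of_lt ht'
    have hM := hw.nonneg
    refine ⟨C * M, fun ω r y => ?_⟩
    unfold convField
    split_ifs with h
    · rw [abs_mul, abs_of_nonneg (torusKernel_nonneg _ _)]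
      exact mul_le_mul (hC r _ h.2) (hw.bounded ω r y) (abs_nonneg _) hC0
    · rw [abs_zero]
      positivity

theorem convField_of_lt {t' : ℝ} (ω : Ω) {r : unitInterval} (y : UnitAddCircle) (h : r < s) :
    convField s t t' x w ω r y = 0 :=
  if_neg fun hr => absurd hr.1 (not_lt.2 h.le)

theorem ae_fst_ne (s : unitInterval) (t' : ℝ) :
    ∀ᵐ q : unitInterval × UnitAddCircle, q.1 ≠ s ∧ (q.1 : ℝ) ≠ t' := by
  have h1 : ∀ᵐ r : unitInterval, r ≠ s := by simp [ae_iff, measure_singleton]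
  have h2 : ∀ᵐ r : unitInterval, (r : ℝ) ≠ t' := by
    have : Set.Subsingleton {r : unitInterval | (r : ℝ) = t'} := fun a ha b hb =>
      Subtype.ext (ha.trans hb.symm)
    simpa [ae_iff] using this.measure_zero volume
  exact Measure.quasiMeasurePreserving_fst.ae (h1.and h2)

open Classical in
-- Off the two cut times the cutoff is locally constant.
theorem continuousAt_cut {t' : ℝ} {g : unitInterval × UnitAddCircle → ℝ}
    {q : unitInterval × UnitAddCircle} (hq : q.1 ≠ s ∧ (q.1 : ℝ) ≠ t')
    (h : s < q.1 → (q.1 : ℝ) < t' → ContinuousAt g q) :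
    ContinuousAt (fun q => if s < q.1 ∧ (q.1 : ℝ) < t' then g q else 0) q := by
  by_cases hc : s < q.1 ∧ (q.1 : ℝ) < t'
  · refine (h hc.1 hc.2).congr ?_
    have ho : IsOpen {q : unitInterval × UnitAddCircle | s < q.1 ∧ (q.1 : ℝ) < t'} :=
      (isOpen_lt continuous_const continuous_fst).inter
        (isOpen_lt (continuous_subtype_val.comp continuous_fst) continuous_const)
    filter_upwards [ho.mem_nhds hc] with a ha
    rw [if_pos ha]
  · have ho : IsOpen {q : unitInterval × UnitAddCircle | q.1 < s ∨ t' < (q.1 : ℝ)} :=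
      (isOpen_lt continuous_fst continuous_const).union
        (isOpen_lt continuous_const (continuous_subtype_val.comp continuous_fst))
    have hm : q.1 < s ∨ t' < (q.1 : ℝ) := by
      by_contra hn
      push Not at hn
      exact hc ⟨lt_of_le_of_ne hn.1 hq.1.symm, lt_of_le_of_ne hn.2 hq.2⟩
    refine (continuousAt_const : ContinuousAt (fun _ => (0 : ℝ)) q).congr ?_
    filter_upwards [ho.mem_nhds hm] with a ha
    rw [if_neg]
    rintro ⟨h1, h2⟩
    rcases ha with ha | ha
    · exact absurd h1 (not_lt.2 ha.le)
    · exact absurd h2 (not_lt.2 ha.le)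

theorem continuousAt_torusKernel_sub {q : unitInterval × UnitAddCircle} (h : (q.1 : ℝ) < t) :
    ContinuousAt (fun q : unitInterval × UnitAddCircle => torusKernel ((t : ℝ) - q.1) (x - q.2))
      q :=
  ContinuousAt.comp (f := fun q : unitInterval × UnitAddCircle => ((t : ℝ) - q.1, x - q.2))
    (continuousAt_torusKernel ((t : ℝ) - q.1, x - q.2) (by simpa using h)) (by fun_prop)

theorem ae_continuousAt_convField {t' : ℝ} (ht' : t' < t) (hw : IsContinuousAdapted P ξ s M w) :
    ∀ᵐ q ∂(P.prod (volume : Measure (unitInterval × UnitAddCircle))),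
      ContinuousAt (fun q' : unitInterval × UnitAddCircle => convField s t t' x w q.1 q'.1 q'.2)
        q.2 := by
  filter_upwards [Measure.quasiMeasurePreserving_fst.ae hw.continuous,
    Measure.quasiMeasurePreserving_snd.ae (ae_fst_ne s t')] with q h1 h2
  refine continuousAt_cut h2 fun h3 h4 => ?_
  exact (continuousAt_torusKernel_sub (h4.trans ht')).mul (h1 q.2.1 q.2.2 h3)

theorem ae_continuousAt_convKernel {t' : ℝ} (ht' : t' < t) {h : unitInterval → ℝ}
    (hh : Continuous h) : ∀ᵐ q : unitInterval × UnitAddCircle,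
      ContinuousAt (fun q' : unitInterval × UnitAddCircle => convKernel s t t' x h q'.1 q'.2)
        q := by
  filter_upwards [ae_fst_ne s t'] with q h2
  refine continuousAt_cut h2 fun h3 h4 => ?_
  exact (continuousAt_torusKernel_sub (h4.trans ht')).mul (hh.comp continuous_fst).continuousAt

theorem memLp_torusKernel_sub (t : unitInterval) (x : UnitAddCircle) :
    MemLp (fun q : unitInterval × UnitAddCircle => torusKernel ((t : ℝ) - q.1) (x - q.2)) 2
      volume := by
  refine ⟨(measurable_torusKernel_sub t x).aestronglyMeasurable, ?_⟩
  rw [eLpNorm_lt_top_iff_lintegral_rpow_enorm_lt_top two_ne_zero ENNReal.ofNat_ne_top]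
  refine lt_of_le_of_lt (lintegral_mono fun q => ?_)
    (lintegral_torusKernel_sq_ne_top t x).lt_top
  rw [Real.enorm_eq_ofReal (torusKernel_nonneg _ _)]
  simp

theorem abs_convField_le (hw : IsContinuousAdapted P ξ s M w) (t' : ℝ) (ω : Ω) (r : unitInterval)
    (y : UnitAddCircle) :
    |convField s t t' x w ω r y| ≤ torusKernel ((t : ℝ) - r) (x - y) * M := by
  unfold convField
  have h0 := torusKernel_nonneg ((t : ℝ) - r) (x - y)
  split_ifs with h
  · rw [abs_mul, abs_of_nonneg h0]
    exact mul_le_mul_of_nonneg_left (hw.bounded ω r y) h0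
  · rw [abs_zero]
    exact mul_nonneg h0 hw.nonneg

theorem CondBound.const_mul {p : ℝ} {X : Ω → ℝ} {c : ℝ≥0∞} (hX : CondBound P ξ p s X c) {a : ℝ}
    (ha : 0 ≤ a) : CondBound P ξ p s (fun ω => a * X ω) (ENNReal.ofReal a * c) := by
  intro A hA
  have h : (fun ω => a * X ω) = a • X := rfl
  rw [h, eLpNorm_const_smul, Real.enorm_eq_ofReal ha, mul_assoc]
  gcongr
  exact hX A hA

theorem isStochasticConvolution_iff {J : Ω → ℝ} :
    IsStochasticConvolution ξ s t x w J ↔ IsStochasticIntegral ξ (convField s t t x w) J := by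
  unfold IsStochasticConvolution
  refine iff_of_eq (congrArg (fun f => IsStochasticIntegral ξ f J) ?_)
  funext ω r y
  simp only [convField, Subtype.coe_lt_coe]

/-- Approximation of stochastic convolutions by simple integrals with moment bounds. -/
theorem exists_simple_approx_convField {p : ℝ} (hp : 2 ≤ p) (hst : s < t)
    (hw : IsContinuousAdapted P ξ s M w) {h : unitInterval → ℝ} (hh : Continuous h)
    (hh0 : ∀ r, 0 ≤ h r)
    (hwh : ∀ r y, s < r → r < t → CondBound P ξ p s (fun ω => w ω r y) (ENNReal.ofReal (h r)))
    {ε : ℝ≥0∞} (hε : 0 < ε) :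
    ∃ l : List (Elementary ξ), eLpNorm (uncurryField (convField s t t x w) - fieldSum l) 2
        (P.prod (volume : Measure (unitInterval × UnitAddCircle))) ≤ ε ∧
      ∀ A, MeasurableSet[ξ.filtration s] A →
        eLpNorm (integralSum l) (ENNReal.ofReal p) (P.restrict A) ^ 2
          ≤ ENNReal.ofReal (momentConst p) * (P A ^ (1 / p)) ^ 2 *
            ((∫⁻ q : unitInterval × UnitAddCircle,
              ENNReal.ofReal (convKernel s t t x h q.1 q.2) ^ 2) + ε) := by
  -- Half of the tolerance pays for cutting the kernel off before t, the other half for sampling on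
  -- the grid.
  have hε2 : 0 < ε / 2 := ENNReal.half_pos hε.ne'
  have hlim : Tendsto (fun n : ℕ => eLpNorm (uncurryField (convField s t t x w)
      - uncurryField (convField s t ((t : ℝ) - 1 / ((n : ℝ) + 1)) x w)) 2
      (P.prod (volume : Measure (unitInterval × UnitAddCircle)))) atTop (𝓝 0) := by
    -- The dominating function is 2M times the kernel, square integrable in space-time.
    have hg : MemLp (fun q : Ω × unitInterval × UnitAddCircle =>
        torusKernel ((t : ℝ) - q.2.1) (x - q.2.2) * M + torusKernel ((t : ℝ) - q.2.1) (x - q.2.2) * M)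
        2 (P.prod (volume : Measure (unitInterval × UnitAddCircle))) := by
      have h1 := (memLp_torusKernel_sub t x).comp_measurePreserving
        (measurePreserving_snd (μ := P)
          (ν := (volume : Measure (unitInterval × UnitAddCircle))))
      exact (h1.mul_const M).add (h1.mul_const M)
    refine tendsto_eLpNorm_of_dominated hg
      (measurable_convField _ hw.measurable).aestronglyMeasurable
      (fun n => (measurable_convField _ hw.measurable).aestronglyMeasurable)
      (fun n => .of_forall fun q => ?_) (.of_forall fun q => ?_)
    · exact (abs_sub _ _).trans (add_le_add (abs_convField_le hw _ _ _ _)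
        (abs_convField_le hw _ _ _ _))
    · refine tendsto_const_nhds.congr' ?_
      have h2 : Tendsto (fun n : ℕ => (t : ℝ) - 1 / ((n : ℝ) + 1)) atTop (𝓝 (t - 0)) :=
        tendsto_const_nhds.sub tendsto_one_div_add_atTop_nhds_zero_nat
      rw [sub_zero] at h2
      by_cases h3 : (q.2.1 : ℝ) < t
      · filter_upwards [h2.eventually (lt_mem_nhds h3)] with n hn
        simp only [uncurryField, convField, h3, hn]
      · refine .of_forall fun n => ?_
        have hn : ¬ (q.2.1 : ℝ) < (t : ℝ) - 1 / ((n : ℝ) + 1) := by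
          have : (0 : ℝ) < 1 / ((n : ℝ) + 1) := by positivity
          linarith
        simp only [uncurryField, convField, h3, hn]
  obtain ⟨n, hn⟩ := (hlim.eventually (ge_mem_nhds hε2)).exists
  have ht' : (t : ℝ) - 1 / ((n : ℝ) + 1) < t := by
    have : (0 : ℝ) < 1 / ((n : ℝ) + 1) := by positivity
    linarith
  set t' := (t : ℝ) - 1 / ((n : ℝ) + 1) with ht'_def
  have hHb : ∃ C : ℝ, ∀ r y, |convKernel s t t' x h r y| ≤ C := by
    obtain ⟨C, hC0, hC⟩ := exists_torusKernel_le_of_lt ht'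
    obtain ⟨D, hD⟩ := isCompact_univ.exists_bound_of_continuousOn (f := h) hh.continuousOn
    have hD0 : 0 ≤ D := (norm_nonneg _).trans (hD 0 trivial)
    refine ⟨C * D, fun r y => ?_⟩
    unfold convKernel
    split_ifs with h1
    · rw [abs_mul, abs_of_nonneg (torusKernel_nonneg _ _)]
      exact mul_le_mul (hC r _ h1.2) (hD r trivial) (abs_nonneg _) hC0
    · rw [abs_zero]; positivity
  obtain ⟨l, hl1, hl2⟩ := exists_simple_approx hp (isBoundedAdapted_convField (x := x) ht' hw)
    (measurable_convField _ hw.measurable) (ae_continuousAt_convField ht' hw)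
    (fun ω r y hr => convField_of_lt ω y hr) (measurable_convKernel t' hh) hHb
    (ae_continuousAt_convKernel ht' hh) (fun r y A hA => by
      by_cases h1 : s < r ∧ (r : ℝ) < t'
      · simp only [convField, convKernel, if_pos h1]

        rw [ENNReal.ofReal_mul (torusKernel_nonneg _ _)]
        exact (hwh r y h1.1 (h1.2.trans ht')).const_mul (torusKernel_nonneg _ _) A hA
      · simp only [convField, if_neg h1]
        simp) hε2
  refine ⟨l, ?_, fun A hA => (hl2 A hA).trans ?_⟩
  · have : uncurryField (convField s t t x w) - fieldSum l
        = (uncurryField (convField s t t x w) - uncurryField (convField s t t' x w))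
          + (uncurryField (convField s t t' x w) - fieldSum l) := by abel
    rw [this]
    refine (eLpNorm_add_le ((measurable_convField _ hw.measurable).sub
      (measurable_convField _ hw.measurable)).aestronglyMeasurable
      ((measurable_convField _ hw.measurable).sub (measurable_fieldSum l)).aestronglyMeasurable
      (by norm_num)).trans ?_
    exact (add_le_add hn hl1).trans_eq (ENNReal.add_halves ε)
  · gcongr with q
    · unfold convKernel
      split_ifs with h1 h2 h2
      · exact le_rfl
      · exact absurd ⟨h1.1, h1.2.trans ht'⟩ h2
      · exact mul_nonneg (torusKernel_nonneg _ _) (hh0 _)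
      · exact le_rfl
    · exact ENNReal.half_le_self

/-- The conditional moment bound for stochastic convolutions. -/
theorem condBound_convolution {p : ℝ} (hp : 2 ≤ p) (hst : s < t)
    (hw : IsContinuousAdapted P ξ s M w) {h : unitInterval → ℝ} (hh : Continuous h)
    (hh0 : ∀ r, 0 ≤ h r)
    (hwh : ∀ r y, s < r → r < t → CondBound P ξ p s (fun ω => w ω r y) (ENNReal.ofReal (h r)))
    {J : Ω → ℝ} (hJ : IsStochasticConvolution ξ s t x w J) (hJm : Measurable J) :
    CondBound P ξ p s J ((ENNReal.ofReal (momentConst p) * ∫⁻ q : unitInterval × UnitAddCircle,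
      ENNReal.ofReal (convKernel s t t x h q.1 q.2) ^ 2) ^ (1 / 2 : ℝ)) := by
  intro A hA
  have := eLpNorm_stochasticIntegral_sq_le hp (measurable_convField _ hw.measurable)
    (isStochasticConvolution_iff.1 hJ) hJm
    (fun ε hε => exists_simple_approx_convField hp hst hw hh hh0 hwh hε) hA
  have h2 := ENNReal.rpow_le_rpow this (show (0 : ℝ) ≤ 1 / 2 by norm_num)
  rw [← ENNReal.rpow_natCast, ← ENNReal.rpow_mul, show ((2 : ℕ) : ℝ) * (1 / 2) = 1 by norm_num,
    ENNReal.rpow_one, mul_right_comm, ENNReal.mul_rpow_of_nonneg _ _ (by norm_num),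
    ← ENNReal.rpow_natCast (P A ^ _), ← ENNReal.rpow_mul,
    show ((2 : ℕ) : ℝ) * (1 / 2) = 1 by norm_num, ENNReal.rpow_one] at h2
  exact h2

end Convolution

/-! ### Averages of square integrable functions -/

section Average

variable {α Z : Type*} [MeasurableSpace α] [MeasurableSpace Z] {ν : Measure α} [SFinite ν]
  {μ : Measure Z} [IsProbabilityMeasure μ] {W : α → Z → ℝ}

theorem memLp_prod_of_forall (hW : Measurable fun q : α × Z => W q.1 q.2) {C : ℝ≥0∞}
    (hC : C ≠ ∞) (h : ∀ z, eLpNorm (fun a => W a z) 2 ν ≤ C) :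
    MemLp (fun q : α × Z => W q.1 q.2) 2 (ν.prod μ) := by
  refine ⟨hW.aestronglyMeasurable, ?_⟩
  rw [eLpNorm_lt_top_iff_lintegral_rpow_enorm_lt_top two_ne_zero ENNReal.ofNat_ne_top,
    lintegral_prod_symm _ (hW.enorm.pow_const _).aemeasurable]
  refine lt_of_le_of_lt (lintegral_mono (g := fun _ => C ^ (2 : ℝ)) fun z => ?_) ?_
  · have h1 := h z
    rw [eLpNorm_eq_lintegral_rpow_enorm_toReal two_ne_zero ENNReal.ofNat_ne_top] at h1
    have h2 := ENNReal.rpow_le_rpow h1 (show (0 : ℝ) ≤ 2 by norm_num)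
    rw [← ENNReal.rpow_mul] at h2
    simpa using h2
  · rw [lintegral_const, measure_univ, mul_one]
    exact ENNReal.rpow_lt_top_of_nonneg (by norm_num) hC

theorem integrable_mul_of_memLp_prod (hW : MemLp (fun q : α × Z => W q.1 q.2) 2 (ν.prod μ)) :
    Integrable (fun q : α × Z × Z => W q.1 q.2.1 * W q.1 q.2.2) (ν.prod (μ.prod μ)) := by
  have h1 : MeasurePreserving (fun q : α × Z × Z => (q.1, q.2.1)) (ν.prod (μ.prod μ))
      (ν.prod μ) := (MeasurePreserving.id ν).prod measurePreserving_fst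
  have h2 : MeasurePreserving (fun q : α × Z × Z => (q.1, q.2.2)) (ν.prod (μ.prod μ))
      (ν.prod μ) := (MeasurePreserving.id ν).prod measurePreserving_snd
  exact integrable_fun_mul (hW.comp_measurePreserving h1) (hW.comp_measurePreserving h2)

theorem integral_mul_integral_self (a : α) :
    (∫ z, W a z ∂μ) * (∫ z, W a z ∂μ) = ∫ z, W a z.1 * W a z.2 ∂(μ.prod μ) :=
  (integral_prod_mul _ _).symm

theorem memLp_average (hW : MemLp (fun q : α × Z => W q.1 q.2) 2 (ν.prod μ))
    (hm : Measurable fun q : α × Z => W q.1 q.2) :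
    MemLp (fun a => ∫ z, W a z ∂μ) 2 ν := by
  have hm' : Measurable fun a => ∫ z, W a z ∂μ :=
    (hm.stronglyMeasurable.integral_prod_right' (ν := μ)).measurable
  rw [memLp_two_iff_integrable_sq hm'.aestronglyMeasurable]
  simp_rw [pow_two, integral_mul_integral_self]
  exact (integrable_mul_of_memLp_prod hW).integral_prod_left

theorem integral_average_sq (hW : MemLp (fun q : α × Z => W q.1 q.2) 2 (ν.prod μ)) :
    ∫ a, (∫ z, W a z ∂μ) * (∫ z, W a z ∂μ) ∂ν
      = ∫ z, ∫ a, W a z.1 * W a z.2 ∂ν ∂(μ.prod μ) := by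
  simp_rw [integral_mul_integral_self]
  exact integral_integral_swap (f := fun a (z : Z × Z) => W a z.1 * W a z.2)
    (integrable_mul_of_memLp_prod hW)

/-- The square of an average is a double integral, so the norm depends on W only through the
pairings of W(·, z) with W(·, z'). These are what the Itô isometry preserves. -/
theorem eLpNorm_average (hW : MemLp (fun q : α × Z => W q.1 q.2) 2 (ν.prod μ))
    (hm : Measurable fun q : α × Z => W q.1 q.2) :
    eLpNorm (fun a => ∫ z, W a z ∂μ) 2 ν
      = ENNReal.ofReal ((∫ z, ∫ a, W a z.1 * W a z.2 ∂ν ∂(μ.prod μ)) ^ (1 / 2 : ℝ)) := by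
  rw [(memLp_average hW hm).eLpNorm_eq_integral_rpow_norm two_ne_zero ENNReal.ofNat_ne_top,
    ← integral_average_sq hW]
  simp only [ENNReal.toReal_ofNat, Real.rpow_ofNat, Real.norm_eq_abs, sq_abs]
  simp only [pow_two, one_div]

end Average

/-! ### The stochastic Fubini theorem -/

section Fubini

variable {Ω : Type*} [mΩ : MeasurableSpace Ω] {P : Measure Ω} [IsProbabilityMeasure P]
  [P.IsComplete] {ξ : WhiteNoise P} {Z : Type*} [MeasurableSpace Z] {μ : Measure Z}
  [IsProbabilityMeasure μ]

/-- For every simple integrand, the averaged integrand and the averaged integral are at the same L_2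
distance from it and from its integral, because by the isometry their pairings agree for each pair
of parameters. So any simple approximation of the averaged integrand serves for both limits. -/
theorem IsStochasticIntegral.average {f : Z → Ω → unitInterval → UnitAddCircle → ℝ}
    {V : Z → Ω → ℝ}
    (hf : Measurable fun q : (Ω × unitInterval × UnitAddCircle) × Z => uncurryField (f q.2) q.1)
    (hV : Measurable fun q : Ω × Z => V q.2 q.1)
    (h : ∀ z, IsStochasticIntegral ξ (f z) (V z)) {C : ℝ≥0∞} (hC : C ≠ ∞)
    (hfC : ∀ z, eLpNorm (uncurryField (f z)) 2
      (P.prod (volume : Measure (unitInterval × UnitAddCircle))) ≤ C)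
    {l : ℕ → List (Elementary ξ)}
    (hl : Tendsto (fun n => eLpNorm (uncurryField (fun ω r y => ∫ z, f z ω r y ∂μ)
      - fieldSum (l n)) 2 (P.prod (volume : Measure (unitInterval × UnitAddCircle)))) atTop (𝓝 0)) :
    IsStochasticIntegral ξ (fun ω r y => ∫ z, f z ω r y ∂μ) (fun ω => ∫ z, V z ω ∂μ) := by
  have hfz : ∀ z, Measurable (uncurryField (f z)) := fun z =>
    hf.comp (measurable_id.prodMk measurable_const)
  have hVz : ∀ z, Measurable (V z) := fun z => hV.comp (measurable_id.prodMk measurable_const)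
  have hVC : ∀ z, eLpNorm (V z) 2 P ≤ C := fun z =>
    ((h z).eLpNorm_eq (hfz z) (hVz z)).trans_le (hfC z)
  have hfL := memLp_prod_of_forall (μ := μ) (W := fun q z => uncurryField (f z) q) hf hC hfC
  have hVL := memLp_prod_of_forall (μ := μ) (W := fun ω z => V z ω) hV hC hVC
  refine (isStochasticIntegral_iff _ _).2 ⟨l, hl, hl.congr fun n => ?_⟩
  have hsub := fun z => (h z).sub (isStochasticIntegral_fieldSum (l n)) (hfz z)
    (measurable_fieldSum _) (hVz z) (measurable_integralSum _)
  have hm1 : Measurable fun q : (Ω × unitInterval × UnitAddCircle) × Z =>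
      uncurryField (f q.2) q.1 - fieldSum (l n) q.1 :=
    hf.sub ((measurable_fieldSum _).comp measurable_fst)
  have hm2 : Measurable fun q : Ω × Z => V q.2 q.1 - integralSum (l n) q.1 :=
    hV.sub ((measurable_integralSum _).comp measurable_fst)
  have hL1 : MemLp (fun q : (Ω × unitInterval × UnitAddCircle) × Z =>
      uncurryField (f q.2) q.1 - fieldSum (l n) q.1) 2
      ((P.prod (volume : Measure (unitInterval × UnitAddCircle))).prod μ) :=
    hfL.sub ((memLp_fieldSum (l n) 2).comp_measurePreserving measurePreserving_fst)
  have hL2 : MemLp (fun q : Ω × Z => V q.2 q.1 - integralSum (l n) q.1) 2 (P.prod μ) :=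
    hVL.sub ((memLp_integralSum (l n) ENNReal.ofNat_ne_top).comp_measurePreserving
      measurePreserving_fst)
  have e1 := eLpNorm_average (W := fun q z => uncurryField (f z) q - fieldSum (l n) q) hL1 hm1
  have e2 := eLpNorm_average (W := fun ω z => V z ω - integralSum (l n) ω) hL2 hm2
  have e3 : (∫ z : Z × Z, ∫ ω, (V z.1 ω - integralSum (l n) ω) * (V z.2 ω - integralSum (l n) ω) ∂P
      ∂(μ.prod μ)) = ∫ z : Z × Z, ∫ q, (uncurryField (f z.1) q - fieldSum (l n) q)
        * (uncurryField (f z.2) q - fieldSum (l n) q)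
          ∂(P.prod (volume : Measure (unitInterval × UnitAddCircle))) ∂(μ.prod μ) := by
    congr 1
    funext z
    exact (hsub z.1).integral_mul (hsub z.2) ((hfz _).sub (measurable_fieldSum _))
      ((hfz _).sub (measurable_fieldSum _)) ((hVz _).sub (measurable_integralSum _))
      ((hVz _).sub (measurable_integralSum _))
  rw [← e3, ← e2] at e1
  have c1 : (uncurryField (fun ω r y => ∫ z, f z ω r y ∂μ) - fieldSum (l n))
      =ᵐ[P.prod (volume : Measure (unitInterval × UnitAddCircle))]
      fun q => ∫ z, uncurryField (f z) q - fieldSum (l n) q ∂μ := by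
    filter_upwards [(hfL.integrable (by norm_num)).prod_right_ae] with q hq
    rw [integral_sub hq (integrable_const _)]
    simp [uncurryField]
  have c2 : ((fun ω => ∫ z, V z ω ∂μ) - integralSum (l n))
      =ᵐ[P] fun ω => ∫ z, V z ω - integralSum (l n) ω ∂μ := by
    filter_upwards [(hVL.integrable (by norm_num)).prod_right_ae] with q hq
    rw [integral_sub hq (integrable_const _)]
    simp
  rw [eLpNorm_congr_ae c1, eLpNorm_congr_ae c2, e1]

end Fubini

/-! ### The heat semigroup acting on a stochastic convolution -/

section ConvolutionFubini

variable {Ω : Type*} [mΩ : MeasurableSpace Ω] {P : Measure Ω} [IsProbabilityMeasure P]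
  [P.IsComplete] {ξ : WhiteNoise P} {w : Ω → unitInterval → UnitAddCircle → ℝ}
  {s t : unitInterval} {x : UnitAddCircle} {M : ℝ}

/-- The measure on the torus with density `p_t(x, ·)`. -/
noncomputable def kernelMeasure (t : ℝ) (x : UnitAddCircle) : Measure UnitAddCircle :=
  volume.withDensity fun z => ENNReal.ofReal (torusKernel t (x - z))

theorem isProbabilityMeasure_kernelMeasure {t : ℝ} (ht : 0 < t) (x : UnitAddCircle) :
    IsProbabilityMeasure (kernelMeasure t x) := by
  constructor
  rw [kernelMeasure, withDensity_apply _ MeasurableSet.univ, Measure.restrict_univ,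
    lintegral_torusKernel ht]

theorem measurable_torusKernel_const_sub (t : ℝ) (x : UnitAddCircle) :
    Measurable fun z => torusKernel t (x - z) :=
  measurable_torusKernel.comp (f := fun z : UnitAddCircle => (t, x - z)) (by fun_prop)

theorem integral_kernelMeasure (t : ℝ) (x : UnitAddCircle) (g : UnitAddCircle → ℝ) :
    ∫ z, g z ∂kernelMeasure t x = ∫ z, torusKernel t (x - z) * g z := by
  rw [kernelMeasure, integral_withDensity_eq_integral_toReal_smul
    (measurable_torusKernel_const_sub t x).ennreal_ofReal (.of_forall fun _ => by simp)]
  simp_rw [ENNReal.toReal_ofReal (torusKernel_nonneg _ _), smul_eq_mul]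

theorem integral_torusKernel_mul_torusKernel {s t : ℝ} (hs : 0 < s) (ht : 0 < t)
    (x y : UnitAddCircle) :
    ∫ z, torusKernel t (x - z) * torusKernel s (z - y) = torusKernel (t + s) (x - y) := by
  have hm : Measurable fun z => torusKernel s (z - y) :=
    measurable_torusKernel.comp (f := fun z : UnitAddCircle => (s, z - y)) (by fun_prop)
  rw [integral_eq_lintegral_of_nonneg_ae
    (.of_forall fun z => mul_nonneg (torusKernel_nonneg _ _) (torusKernel_nonneg _ _))
    ((measurable_torusKernel_const_sub t x).mul hm).aestronglyMeasurable]
  simp_rw [ENNReal.ofReal_mul (torusKernel_nonneg _ _)]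
  rw [lintegral_torusKernel_mul_torusKernel hs ht,
    ENNReal.toReal_ofReal (torusKernel_nonneg _ _)]

/-- Chapman-Kolmogorov: averaging over the end point moves the kernel time from s to t, while the
cutoff stays at s. -/
theorem average_convField (hst : s < t) (w : Ω → unitInterval → UnitAddCircle → ℝ) (ω : Ω)
    (r : unitInterval) (y : UnitAddCircle) :
    ∫ z, convField 0 s s z w ω r y ∂kernelMeasure ((t : ℝ) - s) x = convField 0 t s x w ω r y := by
  unfold convField
  split_ifs with h
  · have h1 : (0 : ℝ) < (s : ℝ) - r := sub_pos.2 h.2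
    have h2 : (0 : ℝ) < (t : ℝ) - s := sub_pos.2 hst
    rw [integral_mul_const, integral_kernelMeasure, integral_torusKernel_mul_torusKernel h1 h2,
      sub_add_sub_cancel]
  · simp

theorem exists_eLpNorm_convField_le (hw : IsContinuousAdapted P ξ s M w) :
    ∃ C : ℝ≥0∞, C ≠ ∞ ∧ ∀ (t : unitInterval) (t' : ℝ) (x : UnitAddCircle),
      eLpNorm (uncurryField (convField s t t' x w)) 2
        (P.prod (volume : Measure (unitInterval × UnitAddCircle))) ≤ C := by
  obtain ⟨C, hC0, hC⟩ := exists_lintegral_torusKernel_sq_le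
  refine ⟨‖M‖ₑ * (ENNReal.ofReal (Real.exp 1) ^ 2 * ENNReal.ofReal C) ^ (1 / 2 : ℝ), ?_,
    fun t t' x => ?_⟩
  · exact ENNReal.mul_ne_top enorm_ne_top (ENNReal.rpow_ne_top_of_nonneg (by norm_num)
      (ENNReal.mul_ne_top (ENNReal.pow_ne_top ENNReal.ofReal_ne_top) ENNReal.ofReal_ne_top))
  set k : unitInterval × UnitAddCircle → ℝ := fun q => torusKernel ((t : ℝ) - q.1) (x - q.2)
  have h1 : eLpNorm (uncurryField (convField s t t' x w)) 2
      (P.prod (volume : Measure (unitInterval × UnitAddCircle)))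
      ≤ eLpNorm ((M • k) ∘ Prod.snd) 2
        (P.prod (volume : Measure (unitInterval × UnitAddCircle))) := by
    refine eLpNorm_mono_real fun q => ?_
    exact (abs_convField_le hw t' q.1 q.2.1 q.2.2).trans_eq (mul_comm _ _)
  refine h1.trans ?_
  rw [eLpNorm_comp_measurePreserving (g := M • k)
    ((measurable_torusKernel_sub t x).const_mul M).aestronglyMeasurable measurePreserving_snd,
    eLpNorm_const_smul]
  gcongr
  rw [eLpNorm_eq_lintegral_rpow_enorm_toReal two_ne_zero ENNReal.ofNat_ne_top]
  simp only [ENNReal.toReal_ofNat, ENNReal.rpow_ofNat]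
  gcongr
  have h2 := hC 1 one_pos t x
  rw [Real.one_rpow, mul_one] at h2
  refine le_trans ?_ (mul_le_mul_right h2 _)
  rw [← lintegral_const_mul' _ _ (ENNReal.pow_ne_top ENNReal.ofReal_ne_top)]
  refine lintegral_mono fun q => ?_
  rw [← mul_pow, Real.enorm_eq_ofReal (torusKernel_nonneg _ _),
    ← ENNReal.ofReal_mul (Real.exp_pos _).le]
  gcongr
  have h3 : 1 ≤ Real.exp 1 * Real.exp (-(1 * ((t : ℝ) - q.1))) := by
    rw [← Real.exp_add]
    exact Real.one_le_exp (by linarith [t.2.2, q.1.2.1])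
  calc k q = k q * 1 := (mul_one _).symm
    _ ≤ k q * (Real.exp 1 * Real.exp (-(1 * ((t : ℝ) - q.1)))) :=
      mul_le_mul_of_nonneg_left h3 (torusKernel_nonneg _ _)
    _ = _ := by ring

/-- The heat semigroup applied to a stochastic convolution. -/
theorem IsStochasticConvolution.heatSemigroup (hst : s < t) (hw : IsContinuousAdapted P ξ 0 M w)
    {V : Ω → UnitAddCircle → ℝ} (hV : Measurable fun q : Ω × UnitAddCircle => V q.1 q.2)
    (h : ∀ z, IsStochasticConvolution ξ 0 s z w fun ω => V ω z) :
    IsStochasticIntegral ξ (convField 0 t s x w)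
      (fun ω => heatSemigroup ((t : ℝ) - s) (V ω) x) := by
  have ht : (0 : ℝ) < (t : ℝ) - s := sub_pos.2 hst
  have := isProbabilityMeasure_kernelMeasure ht x
  obtain ⟨C, hC, hfC⟩ := exists_eLpNorm_convField_le hw
  have he : (fun ω r y => ∫ z, convField 0 s s z w ω r y ∂kernelMeasure ((t : ℝ) - s) x)
      = convField 0 t s x w := by
    funext ω r y
    exact average_convField hst w ω r y
  have hJ : (fun ω => SHE.heatSemigroup ((t : ℝ) - s) (V ω) x)
      = fun ω => ∫ z, V ω z ∂kernelMeasure ((t : ℝ) - s) x := by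
    funext ω
    rw [SHE.heatSemigroup, if_pos ht, integral_kernelMeasure]
  rw [hJ, ← he]
  have hst' : (s : ℝ) < t := hst
  -- The averaged integrand has kernel time t but stops at s < t, hence is bounded, and the grid
  -- supplies its approximating sequence directly.
  refine IsStochasticIntegral.average (V := fun z ω => V ω z) ?_ hV
    (fun z => isStochasticConvolution_iff.1 (h z)) hC (fun z => hfC s s z)
    (l := gridList (isBoundedAdapted_convField (x := x) hst' hw)) ?_
  · refine Measurable.ite ((measurableSet_cut 0 s).preimage (by fun_prop)) (Measurable.mul ?_ ?_)
      measurable_const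
    · exact measurable_torusKernel.comp
        (f := fun q : (Ω × unitInterval × UnitAddCircle) × UnitAddCircle =>
          ((s : ℝ) - q.1.2.1, q.2 - q.1.2.2)) (by fun_prop)
    · exact hw.measurable.comp measurable_fst
  · rw [he]
    exact tendsto_fieldSum_gridList _ (measurable_convField _ hw.measurable)
      (ae_continuousAt_convField hst' hw)

end ConvolutionFubini

/-! ### Conditional norms -/

section CondNorm

variable {Ω : Type*} [mΩ : MeasurableSpace Ω] {P : Measure Ω} [IsProbabilityMeasure P]
  [P.IsComplete] {ξ : WhiteNoise P} {p : ℝ} {s : unitInterval} {X Y : Ω → ℝ} {c c' : ℝ≥0∞}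

theorem condBound_iff_setLIntegral (hp : 0 < p) : CondBound P ξ p s X c ↔
    ∀ A, MeasurableSet[ξ.filtration s] A → ∫⁻ ω in A, ‖X ω‖ₑ ^ p ∂P ≤ c ^ p * P A := by
  refine forall₂_congr fun A hA => ?_
  rw [eLpNorm_eq_lintegral_rpow_enorm_toReal (by simpa using hp) ENNReal.ofReal_ne_top,
    ENNReal.toReal_ofReal hp.le, ← ENNReal.rpow_le_rpow_iff hp, ← ENNReal.rpow_mul,
    one_div_mul_cancel hp.ne', ENNReal.rpow_one, ENNReal.mul_rpow_of_nonneg _ _ hp.le,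
    ← ENNReal.rpow_mul, one_div_mul_cancel hp.ne', ENNReal.rpow_one]

/-- A conditional expectation is at most c^p almost surely exactly when its integral over every
event of the σ-algebra is at most c^p times the probability. The argument can thus work with
ordinary norms on events in place of conditional expectations. -/
theorem condNorm_le_iff (hp : 0 < p) :
    condNorm P (ξ.filtration s) p ∞ X ≤ c ↔ CondBound P ξ p s X c := by
  have hle := ξ.filtration.le s
  have h1 : condNorm P (ξ.filtration s) p ∞ X ≤ c ↔
      ∀ᵐ ω ∂P, condLExp (ξ.filtration s) P (fun ω' => ‖X ω'‖ₑ ^ p) ω ≤ c ^ p := by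
    have h2 : ∀ ω, condLExp (ξ.filtration s) P (fun ω' => ‖X ω'‖ₑ ^ p) ω ≤ c ^ p ↔
        condLExp (ξ.filtration s) P (fun ω' => ‖X ω'‖ₑ ^ p) ω ^ (1 / p) ≤ c := fun ω => by
      rw [one_div, ENNReal.rpow_inv_le_iff hp]
    simp_rw [h2]
    rw [condNorm, eLpNorm_exponent_top, eLpNormEssSup]
    simp only [enorm_eq_self]
    exact ⟨fun h => (ENNReal.ae_le_essSup _).mono fun ω hω => hω.trans h,
      fun h => essSup_le_of_ae_le _ h⟩
  rw [h1, condBound_iff_setLIntegral hp]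
  constructor
  · intro h A hA
    rw [← setLIntegral_condLExp hle P _ hA]
    refine (lintegral_mono_ae (ae_restrict_of_ae h)).trans_eq ?_
    rw [lintegral_const, Measure.restrict_apply_univ]
  · intro h
    refine ae_of_ae_trim hle ?_
    refine ae_le_of_forall_setLIntegral_le_of_sigmaFinite (measurable_condLExp _ _ _)
      fun A hA _ => ?_
    rw [setLIntegral_condLExp_trim hle P _ hA, lintegral_const, Measure.restrict_apply_univ,
      trim_measurableSet_eq hle hA]
    exact h A hA

theorem condBound_condNorm (hp : 0 < p) :
    CondBound P ξ p s X (condNorm P (ξ.filtration s) p ∞ X) := (condNorm_le_iff hp).1 le_rfl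

theorem CondBound.mono (h : CondBound P ξ p s X c) (hc : c ≤ c') : CondBound P ξ p s X c' :=
  fun A hA => (h A hA).trans (by gcongr)

theorem CondBound.add (hp : 1 ≤ p) (hX : CondBound P ξ p s X c) (hY : CondBound P ξ p s Y c')
    (hXm : Measurable X) (hYm : Measurable Y) :
    CondBound P ξ p s (fun ω => X ω + Y ω) (c + c') := fun A hA => by
  rw [add_mul]
  refine (eLpNorm_add_le hXm.aestronglyMeasurable hYm.aestronglyMeasurable ?_).trans
    (add_le_add (hX A hA) (hY A hA))
  rw [← ENNReal.ofReal_one]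
  exact ENNReal.ofReal_le_ofReal hp

theorem CondBound.congr_ae (hX : CondBound P ξ p s X c) (h : X =ᵐ[P] Y) :
    CondBound P ξ p s Y c := fun A hA =>
  (eLpNorm_congr_ae (ae_restrict_of_ae h)).symm.trans_le (hX A hA)

theorem CondBound.of_abs_le {K : ℝ} (hK : 0 ≤ K) (hX : CondBound P ξ p s X c)
    (h : ∀ ω, |Y ω| ≤ K * |X ω|) : CondBound P ξ p s Y (ENNReal.ofReal K * c) := fun A hA =>
  (eLpNorm_mono_real fun ω => by
    rw [Real.norm_eq_abs]
    refine (h ω).trans (le_of_eq ?_)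
    rfl).trans ((CondBound.const_mul (X := fun ω => |X ω|) (fun A hA =>
      (eLpNorm_norm X).trans_le (hX A hA)) hK) A hA)

theorem condBound_of_bounded (hp : 0 < p) {K : ℝ} (hK : 0 ≤ K) (h : ∀ ω, |X ω| ≤ K) :
    CondBound P ξ p s X (ENNReal.ofReal K) := by
  rw [condBound_iff_setLIntegral hp]
  intro A hA
  refine (lintegral_mono (g := fun _ => ENNReal.ofReal K ^ p) fun ω => ?_).trans_eq ?_
  · dsimp only
    gcongr
    rw [← ofReal_norm]
    exact ENNReal.ofReal_le_ofReal (h ω)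
  · rw [lintegral_const, Measure.restrict_apply_univ]

theorem condNorm_le_bracketV {β : ℝ} {S T t : unitInterval}
    {f : Ω → unitInterval → UnitAddCircle → ℝ} (hS : S ≤ s) (hst : s < t) (hT : t ≤ T)
    (x : UnitAddCircle) :
    condNorm P (ξ.filtration s) p ∞ (fun ω => f ω t x - heatSemigroup ((t : ℝ) - s) (f ω s) x)
      ≤ bracketV ξ p β S T f * ENNReal.ofReal (((t : ℝ) - s) ^ β) := by
  have hts : (0 : ℝ) < (t : ℝ) - s := sub_pos.2 hst
  rw [← ENNReal.div_le_iff (by simpa using Real.rpow_pos_of_pos hts β) ENNReal.ofReal_ne_top]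
  unfold bracketV
  exact le_iSup_of_le x (le_iSup_of_le s (le_iSup_of_le t (le_iSup_of_le hS
    (le_iSup_of_le hst (le_iSup_of_le hT le_rfl)))))

theorem bracketV_mono {β : ℝ} {S T S' T' : unitInterval}
    (f : Ω → unitInterval → UnitAddCircle → ℝ) (hS : S' ≤ S) (hT : T ≤ T') :
    bracketV ξ p β S T f ≤ bracketV ξ p β S' T' f := by
  unfold bracketV
  refine iSup_mono fun x => iSup_mono fun s => iSup_mono fun t => ?_
  refine iSup_le fun h1 => iSup_le fun h2 => iSup_le fun h3 => ?_
  exact le_iSup_of_le (hS.trans h1) (le_iSup_of_le h2 (le_iSup_of_le (h3.trans hT) le_rfl))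

end CondNorm

/-! ### The heat semigroup -/

section HeatSemigroup

variable {Ω : Type*} [mΩ : MeasurableSpace Ω]

theorem heatSemigroup_of_pos {t : ℝ} (ht : 0 < t) (g : UnitAddCircle → ℝ) (x : UnitAddCircle) :
    heatSemigroup t g x = ∫ y, torusKernel t (x - y) * g y := if_pos ht

theorem heatSemigroup_zero (g : UnitAddCircle → ℝ) (x : UnitAddCircle) :
    heatSemigroup 0 g x = g x := if_neg (lt_irrefl _)

theorem measurable_heatSemigroup {t : ℝ} {g : Ω → UnitAddCircle → ℝ}
    (hg : Measurable fun q : Ω × UnitAddCircle => g q.1 q.2) :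
    Measurable fun q : Ω × UnitAddCircle => heatSemigroup t (g q.1) q.2 := by
  by_cases ht : 0 < t
  · simp_rw [heatSemigroup_of_pos ht]
    have h : Measurable fun q : (Ω × UnitAddCircle) × UnitAddCircle =>
        torusKernel t (q.1.2 - q.2) * g q.1.1 q.2 :=
      (measurable_torusKernel.comp (f := fun q : (Ω × UnitAddCircle) × UnitAddCircle =>
        (t, q.1.2 - q.2)) (by fun_prop)).mul
        (hg.comp (f := fun q : (Ω × UnitAddCircle) × UnitAddCircle => (q.1.1, q.2)) (by fun_prop))
    exact (h.stronglyMeasurable.integral_prod_right' (ν := volume)).measurable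
  · unfold heatSemigroup
    simp only [if_neg ht]
    exact hg

theorem integrable_torusKernel_mul {t : ℝ} (ht : 0 < t) (ht1 : t ≤ 1) (x : UnitAddCircle)
    {g : UnitAddCircle → ℝ} (hg : Integrable g) :
    Integrable fun y => torusKernel t (x - y) * g y := by
  obtain ⟨C, hC0, hC⟩ := exists_torusKernel_le
  exact hg.bdd_mul (measurable_torusKernel_const_sub t x).aestronglyMeasurable
    (.of_forall fun y => by
      rw [Real.norm_of_nonneg (torusKernel_nonneg _ _)]
      exact hC t ht ht1 _)

theorem heatSemigroup_sub {t : ℝ} (ht : 0 < t) (ht1 : t ≤ 1) (x : UnitAddCircle)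
    {g h : UnitAddCircle → ℝ} (hg : Integrable g) (hh : Integrable h) :
    heatSemigroup t (fun y => g y - h y) x = heatSemigroup t g x - heatSemigroup t h x := by
  simp_rw [heatSemigroup_of_pos ht, mul_sub]
  exact integral_sub (integrable_torusKernel_mul ht ht1 x hg)
    (integrable_torusKernel_mul ht ht1 x hh)

theorem integrable_of_continuous (g : C(UnitAddCircle, ℝ)) : Integrable g :=
  g.continuous.integrable_of_hasCompactSupport (HasCompactSupport.of_compactSpace _)

theorem integrable_prod_torusKernel {s t : ℝ} (hs : 0 < s) (hs1 : s ≤ 1) (ht : 0 < t) (ht1 : t ≤ 1)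
    (x : UnitAddCircle) {g : UnitAddCircle → ℝ} (hg : Integrable g) :
    Integrable (fun q : UnitAddCircle × UnitAddCircle =>
      torusKernel t (x - q.1) * (torusKernel s (q.1 - q.2) * g q.2)) (volume.prod volume) := by
  obtain ⟨C, hC0, hC⟩ := exists_torusKernel_le
  have hg2 : Integrable (fun q : UnitAddCircle × UnitAddCircle => g q.2) (volume.prod volume) :=
    hg.comp_snd volume
  refine (hg2.bdd_mul (c := C * s ^ (-(1 / 2) : ℝ)) ?_ (.of_forall fun q => ?_)).bdd_mul
    (c := C * t ^ (-(1 / 2) : ℝ)) ?_ (.of_forall fun q => ?_)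
  · exact (measurable_torusKernel.comp (f := fun q : UnitAddCircle × UnitAddCircle =>
      (s, q.1 - q.2)) (by fun_prop)).aestronglyMeasurable
  · rw [Real.norm_of_nonneg (torusKernel_nonneg _ _)]
    exact hC s hs hs1 _
  · exact (measurable_torusKernel.comp (f := fun q : UnitAddCircle × UnitAddCircle =>
      (t, x - q.1)) (by fun_prop)).aestronglyMeasurable
  · rw [Real.norm_of_nonneg (torusKernel_nonneg _ _)]
    exact hC t ht ht1 _

theorem heatSemigroup_integrable {s : ℝ} (hs : 0 ≤ s) (hs1 : s ≤ 1) {g : UnitAddCircle → ℝ}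
    (hg : Integrable g) : Integrable (heatSemigroup s g) := by
  rcases hs.eq_or_lt with rfl | hs
  · exact hg.congr (.of_forall fun x => (heatSemigroup_zero g x).symm)
  · obtain ⟨C, hC0, hC⟩ := exists_torusKernel_le
    have hg2 : Integrable (fun q : UnitAddCircle × UnitAddCircle => g q.2)
      (volume.prod volume) := hg.comp_snd volume
    have h := hg2.bdd_mul (c := C * s ^ (-(1 / 2) : ℝ))
      (f := fun q : UnitAddCircle × UnitAddCircle => torusKernel s (q.1 - q.2))
      (measurable_torusKernel.comp (f := fun q : UnitAddCircle × UnitAddCircle =>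
        (s, q.1 - q.2)) (by fun_prop)).aestronglyMeasurable (.of_forall fun q => by
          rw [Real.norm_of_nonneg (torusKernel_nonneg _ _)]
          exact hC s hs hs1 _)
    exact h.integral_prod_left.congr (.of_forall fun x => (heatSemigroup_of_pos hs g x).symm)

theorem heatSemigroup_heatSemigroup {s t : ℝ} (hs : 0 ≤ s) (hs1 : s ≤ 1) (ht : 0 < t) (ht1 : t ≤ 1)
    (x : UnitAddCircle) {g : UnitAddCircle → ℝ} (hg : Integrable g) :
    heatSemigroup t (heatSemigroup s g) x = heatSemigroup (t + s) g x := by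
  rcases hs.eq_or_lt with rfl | hs
  · rw [add_zero]
    congr 1
    funext y
    exact heatSemigroup_zero g y
  · rw [heatSemigroup_of_pos ht, heatSemigroup_of_pos (by linarith)]
    simp_rw [heatSemigroup_of_pos hs, ← integral_const_mul]
    rw [integral_integral_swap (f := fun z y => torusKernel t (x - z) * (torusKernel s (z - y) * g y))
      (integrable_prod_torusKernel hs hs1 ht ht1 x hg)]
    congr 1
    funext y
    simp_rw [← mul_assoc]
    rw [integral_mul_const, integral_torusKernel_mul_torusKernel hs ht]

end HeatSemigroup

/-! ### Comparison with the driftless flow -/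

theorem abs_le_of_c1Norm_le {σ : ℝ → ℝ} {M : ℝ≥0} (h : c1Norm σ ≤ M) (x : ℝ) : |σ x| ≤ M := by
  have h1 : ‖σ x‖ₑ ≤ (M : ℝ≥0∞) :=
    ((le_iSup (fun x => ‖σ x‖ₑ) x).trans le_self_add).trans h
  rw [enorm_le_coe] at h1
  exact_mod_cast h1

theorem lipschitzWith_of_c1Norm_le {σ : ℝ → ℝ} {M : ℝ≥0} (hσ : ContDiff ℝ 1 σ)
    (h : c1Norm σ ≤ M) : LipschitzWith M σ := by
  refine lipschitzWith_of_nnnorm_deriv_le (hσ.differentiable one_ne_zero) fun x => ?_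
  have h1 : ‖deriv σ x‖ₑ ≤ (M : ℝ≥0∞) :=
    ((le_iSup (fun x => ‖deriv σ x‖ₑ) x).trans le_add_self).trans h
  rwa [enorm_le_coe] at h1

section Driftless

variable {Ω : Type*} [mΩ : MeasurableSpace Ω] {P : Measure Ω} [IsProbabilityMeasure P]
  [P.IsComplete] {ξ : WhiteNoise P} {p α β : ℝ} {M : ℝ≥0} {σ : ℝ → ℝ} {b : RealDistribution}
  {u₀ : C(UnitAddCircle, ℝ)} {u D φ : Ω → unitInterval → UnitAddCircle → ℝ} {s t : unitInterval}

theorem measurable_slice {f : Ω → unitInterval → UnitAddCircle → ℝ}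
    (hf : Measurable (uncurryField f)) (r : unitInterval) :
    Measurable fun q : Ω × UnitAddCircle => f q.1 r q.2 :=
  hf.comp (f := fun q : Ω × UnitAddCircle => (q.1, r, q.2)) (by fun_prop)

theorem measurable_apply {f : Ω → unitInterval → UnitAddCircle → ℝ}
    (hf : Measurable (uncurryField f)) (r : unitInterval) (x : UnitAddCircle) :
    Measurable fun ω => f ω r x :=
  hf.comp (f := fun ω : Ω => (ω, r, x)) (by fun_prop)

theorem measurable_heatSemigroup_apply {a : ℝ} {g : Ω → UnitAddCircle → ℝ}
    (hg : Measurable fun q : Ω × UnitAddCircle => g q.1 q.2) (x : UnitAddCircle) :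
    Measurable fun ω => heatSemigroup a (g ω) x :=
  (measurable_heatSemigroup hg).comp (measurable_id.prodMk measurable_const)

theorem IsRegularisedSolution.isContinuousAdapted (hu : IsRegularisedSolution ξ α b σ u₀ u D)
    (hσ : Continuous σ) {K : ℝ} (hK : ∀ x, |σ x| ≤ K) (s : unitInterval) :
    IsContinuousAdapted P ξ s K fun ω r y => σ (u ω r y) where
  measurable := hσ.measurable.comp hu.predictable.measurable
  adapted r y := hσ.measurable.comp (hu.predictable.adapted r y)
  bounded ω r y := hK _
  continuous := .of_forall fun ω r y _ =>
    ContinuousAt.comp (f := fun q : unitInterval × UnitAddCircle => u ω q.1 q.2)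
      hσ.continuousAt (hu.continuous ω).continuousAt

theorem IsDriftlessFlow.isContinuousAdapted {Z : Ω → UnitAddCircle → ℝ}
    (hφ : IsDriftlessFlow ξ σ s Z φ) (hσ : Continuous σ) {K : ℝ} (hK : ∀ x, |σ x| ≤ K) :
    IsContinuousAdapted P ξ s K fun ω r y => σ (φ ω r y) where
  measurable := hσ.measurable.comp hφ.predictable.measurable
  adapted r y := hσ.measurable.comp (hφ.predictable.adapted r y)
  bounded ω r y := hK _
  continuous := by
    filter_upwards [hφ.continuous] with ω hω r y hr
    refine ContinuousAt.comp (f := fun q : unitInterval × UnitAddCircle => φ ω q.1 q.2)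
      hσ.continuousAt (hω.continuousAt ?_)
    exact prod_mem_nhds (Ici_mem_nhds hr) univ_mem

theorem IsContinuousAdapted.sub {w w' : Ω → unitInterval → UnitAddCircle → ℝ} {K K' : ℝ}
    (hw : IsContinuousAdapted P ξ s K w) (hw' : IsContinuousAdapted P ξ s K' w') :
    IsContinuousAdapted P ξ s (K + K') fun ω r y => w ω r y - w' ω r y where
  measurable := hw.measurable.sub hw'.measurable
  adapted r y := (hw.adapted r y).sub (hw'.adapted r y)
  bounded ω r y := (abs_sub _ _).trans (add_le_add (hw.bounded ω r y) (hw'.bounded ω r y))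
  continuous := by
    filter_upwards [hw.continuous, hw'.continuous] with ω h h' r y hr
    exact (h r y hr).sub (h' r y hr)

/-- The drift is not assumed continuous in space. Its uniform moment bound gives joint square
integrability in (ω, x), hence integrable slices for almost every ω, as linearity of the semigroup
requires. -/
theorem MemV.ae_integrable (hD : MemV ξ p β D) (hp : 2 ≤ p) (r : unitInterval) :
    ∀ᵐ ω ∂P, Integrable (D ω r) := by
  have hm := measurable_slice hD.predictable.measurable r
  have hC : ∀ z, eLpNorm (fun ω => D ω r z) 2 P
      ≤ ⨆ (t : unitInterval) (x : UnitAddCircle), eLpNorm (fun ω => D ω t x) (ENNReal.ofReal p) P :=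
    fun z => (eLpNorm_le_eLpNorm_of_exponent_le (by
      rw [← ENNReal.ofReal_ofNat]
      exact ENNReal.ofReal_le_ofReal hp)
      (measurable_apply hD.predictable.measurable r z).aestronglyMeasurable).trans
      (le_iSup₂_of_le r z le_rfl)
  have : IsProbabilityMeasure (volume : Measure UnitAddCircle) := ⟨UnitAddCircle.measure_univ⟩
  have := memLp_prod_of_forall (μ := (volume : Measure UnitAddCircle))
    (W := fun ω z => D ω r z) hm hD.bounded.ne hC
  exact (this.integrable (by norm_num)).prod_right_ae

theorem continuous_slice {f : unitInterval → UnitAddCircle → ℝ}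
    (hf : Continuous fun q : unitInterval × UnitAddCircle => f q.1 q.2) (r : unitInterval) :
    Continuous (f r) :=
  hf.comp (continuous_const.prodMk continuous_id)

/-- The difference of `u` and the driftless flow is, up to the drift, a stochastic convolution. -/
theorem isStochasticConvolution_sub_driftless (hp : 2 ≤ p) (hu : MemU ξ p β α b σ u₀ u D)
    (hφ : IsDriftlessFlow ξ σ s (fun ω => u ω s) φ) (hσ : Continuous σ) {K : ℝ}
    (hK : ∀ x, |σ x| ≤ K) (hst : s < t) (x : UnitAddCircle) :
    IsStochasticConvolution ξ s t x (fun ω r y => σ (u ω r y) - σ (φ ω r y))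
      fun ω => (u ω t x - φ ω t x)
        - (D ω t x - heatSemigroup ((t : ℝ) - s) (D ω s) x) := by
  have hts : (0 : ℝ) < (t : ℝ) - s := sub_pos.2 hst
  have hts1 : (t : ℝ) - s ≤ 1 := by linarith [t.2.2, s.2.1]
  have hum := hu.solution.predictable.measurable
  have hDm := hu.solution.predictable_drift.measurable
  have hφm := hφ.predictable.measurable
  have hwu := hu.solution.isContinuousAdapted hσ hK
  have hwφ := hφ.isContinuousAdapted hσ hK
  have hVm : Measurable fun q : Ω × UnitAddCircle =>
      u q.1 s q.2 - heatSemigroup s u₀ q.2 - D q.1 s q.2 :=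
    ((measurable_slice hum s).sub ((measurable_heatSemigroup (Ω := Ω) (g := fun _ => u₀)
      (u₀.continuous.measurable.comp measurable_snd)))).sub (measurable_slice hDm s)
  have hI := isStochasticConvolution_iff.1 (hu.solution.mild t x)
  have hIm : Measurable fun ω => u ω t x - heatSemigroup t u₀ x - D ω t x :=
    ((measurable_apply hum t x).sub_const _).sub (measurable_apply hDm t x)
  -- The mild equation at time s, transported to time t: the integral over r < s with kernel
  -- p_{t-r}.
  have hY := IsStochasticConvolution.heatSemigroup (x := x) hst (hwu 0) hVm
    (fun z => hu.solution.mild s z)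
  have hYm := measurable_heatSemigroup_apply (a := (t : ℝ) - s)
    (g := fun ω z => u ω s z - heatSemigroup s u₀ z - D ω s z) hVm x
  have hF := isStochasticConvolution_iff.1 (hφ.mild t hst.le x)
  have hFm : Measurable fun ω => φ ω t x - heatSemigroup ((t : ℝ) - s) (u ω s) x :=
    (measurable_apply hφm t x).sub (measurable_heatSemigroup_apply (measurable_slice hum s) x)
  -- Only the noise between s and t survives here; the equation of the flow is subtracted next.
  have h1 := hI.sub hY (measurable_convField _ (hwu 0).measurable)
    (measurable_convField _ (hwu 0).measurable) hIm hYm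
  have h2 := h1.sub hF ((measurable_convField _ (hwu 0).measurable).sub
    (measurable_convField _ (hwu 0).measurable)) (measurable_convField _ hwφ.measurable)
    (hIm.sub hYm) hFm
  rw [isStochasticConvolution_iff]
  refine h2.congr_ae ?_ ?_
  -- The integrands are compared off the null set of times 0 and s; at r = s the left endpoint
  -- conventions disagree.
  · filter_upwards [Measure.quasiMeasurePreserving_snd.ae (ae_fst_ne s s),
      Measure.quasiMeasurePreserving_snd.ae ae_pos_fst] with q hq hq0
    rcases lt_or_gt_of_ne hq.1 with h | h
    · have h3 : (q.2.1 : ℝ) < t := h.trans hst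
      have h4 : (q.2.1 : ℝ) < s := h
      simp [uncurryField, convField, hq0, h3, h4, not_lt.2 h.le]
    · have h4 : ¬ (q.2.1 : ℝ) < s := not_lt.2 (le_of_lt h)
      by_cases h3 : (q.2.1 : ℝ) < t
      · simp [uncurryField, convField, hq0, h3, h4, h, mul_sub]
      · simp [uncurryField, convField, h3, h4]
  -- The random variables agree by linearity of the semigroup and P_{t-s} P_s u₀ = P_t u₀; the u₀
  -- terms cancel.
  · filter_upwards [hu.drift_mem.ae_integrable hp s] with ω hω
    have hi1 : Integrable (u ω s) :=
      integrable_of_continuous ⟨_, continuous_slice (hu.solution.continuous ω) s⟩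
    have hi2 := heatSemigroup_integrable s.2.1 s.2.2 (integrable_of_continuous u₀)
    have e1 : heatSemigroup ((t : ℝ) - s)
        (fun z => u ω s z - heatSemigroup s u₀ z - D ω s z) x
        = heatSemigroup ((t : ℝ) - s) (u ω s) x - heatSemigroup t u₀ x
          - heatSemigroup ((t : ℝ) - s) (D ω s) x := by
      rw [heatSemigroup_sub hts hts1 x (g := fun z => u ω s z - heatSemigroup s u₀ z)
        (hi1.sub hi2) hω, heatSemigroup_sub hts hts1 x hi1 hi2,
        heatSemigroup_heatSemigroup s.2.1 s.2.2 hts hts1 x (integrable_of_continuous u₀),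
        sub_add_cancel]
    simp only [e1]
    ring

/-- Over an empty time interval the integrand is zero, and the isometry forces the integral to
vanish. -/
theorem ae_eq_of_driftless {Z : Ω → UnitAddCircle → ℝ} (hφ : IsDriftlessFlow ξ σ s Z φ)
    (hZ : Measurable fun q : Ω × UnitAddCircle => Z q.1 q.2) (x : UnitAddCircle) :
    (fun ω => φ ω s x) =ᵐ[P] fun ω => Z ω x := by
  have hm : Measurable fun ω => φ ω s x - heatSemigroup ((s : ℝ) - s) (Z ω) x :=
    (measurable_apply hφ.predictable.measurable s x).sub (measurable_heatSemigroup_apply hZ x)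
  have h := isStochasticConvolution_iff.1 (hφ.mild s le_rfl x)
  have h0 : convField s s s x (fun ω r y => σ (φ ω r y)) = fun _ _ _ => 0 := by
    funext ω r y
    exact if_neg fun hr => absurd hr.1 (not_lt.2 (le_of_lt hr.2))
  rw [h0] at h
  have h1 := h.eLpNorm_eq (f := fun _ _ _ => 0) measurable_const hm
  have h2 : uncurryField (fun (_ : Ω) (_ : unitInterval) (_ : UnitAddCircle) => (0 : ℝ)) = 0 := rfl
  rw [h2, eLpNorm_zero, eLpNorm_eq_zero_iff hm.aestronglyMeasurable two_ne_zero] at h1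
  filter_upwards [h1] with ω hω
  rw [sub_self, heatSemigroup_zero] at hω
  exact sub_eq_zero.1 hω

/-- Writing e^{l(r-s)} = e^{l(t-s)} e^{-l(t-r)} converts growth from s into decay towards t, the
form in which the kernel integral is of order l^{-1/2}. -/
theorem lintegral_convKernel_exp_le {C : ℝ} (hC : ∀ (l : ℝ), 0 < l →
    ∀ (t : unitInterval) (x : UnitAddCircle),
      ∫⁻ q : unitInterval × UnitAddCircle, ENNReal.ofReal
        (torusKernel ((t : ℝ) - q.1) (x - q.2) * Real.exp (-(l * ((t : ℝ) - q.1)))) ^ 2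
      ≤ ENNReal.ofReal (C * l ^ (-(1 / 2) : ℝ))) {l : ℝ} (hl : 0 < l) {c : ℝ} (hc : 0 ≤ c)
    (s t : unitInterval) (x : UnitAddCircle) :
    ∫⁻ q : unitInterval × UnitAddCircle, ENNReal.ofReal
        (convKernel s t t x (fun r => c * Real.exp (l * ((r : ℝ) - s))) q.1 q.2) ^ 2
      ≤ ENNReal.ofReal (c * Real.exp (l * ((t : ℝ) - s))) ^ 2
        * ENNReal.ofReal (C * l ^ (-(1 / 2) : ℝ)) := by
  refine le_trans ?_ (mul_le_mul_right (hC l hl t x) _)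
  rw [← lintegral_const_mul' _ _ (ENNReal.pow_ne_top ENNReal.ofReal_ne_top)]
  refine lintegral_mono fun q => ?_
  rw [← mul_pow, ← ENNReal.ofReal_mul (mul_nonneg hc (Real.exp_pos _).le)]
  gcongr
  have h0 := torusKernel_nonneg ((t : ℝ) - q.1) (x - q.2)
  unfold convKernel
  split_ifs
  · refine le_of_eq ?_
    have : Real.exp (l * ((q.1 : ℝ) - s)) =
        Real.exp (l * ((t : ℝ) - s)) * Real.exp (-(l * ((t : ℝ) - q.1))) := by
      rw [← Real.exp_add]
      congr 1
      ring
    dsimp only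
    rw [this]
    ring
  · positivity

/-- One step of the Gronwall argument. -/
theorem condNorm_sub_driftless_le (hp : 2 ≤ p) (hβ : 0 ≤ β) (hu : MemU ξ p β α b σ u₀ u D)
    (hφ : IsDriftlessFlow ξ σ s (fun ω => u ω s) φ) (hσ : Continuous σ) {K : ℝ}
    (hK : ∀ x, |σ x| ≤ K) {C : ℝ} (hC : ∀ (l : ℝ), 0 < l →
    ∀ (t : unitInterval) (x : UnitAddCircle),
      ∫⁻ q : unitInterval × UnitAddCircle, ENNReal.ofReal
        (torusKernel ((t : ℝ) - q.1) (x - q.2) * Real.exp (-(l * ((t : ℝ) - q.1)))) ^ 2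
      ≤ ENNReal.ofReal (C * l ^ (-(1 / 2) : ℝ))) {l : ℝ} (hl : 0 < l) {c : ℝ} (hc : 0 ≤ c)
    {r : unitInterval} (hsr : s < r) (hrt : r ≤ t)
    (hwc : ∀ r' y, s < r' → r' < r → CondBound P ξ p s (fun ω => σ (u ω r' y) - σ (φ ω r' y))
      (ENNReal.ofReal (c * Real.exp (l * ((r' : ℝ) - s))))) (x : UnitAddCircle) :
    condNorm P (ξ.filtration s) p ∞ (fun ω => u ω r x - φ ω r x)
      ≤ bracketV ξ p β s t D * ENNReal.ofReal (((t : ℝ) - s) ^ β)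
        + ENNReal.ofReal (c * Real.exp (l * ((r : ℝ) - s)))
          * ENNReal.ofReal (momentConst p * (C * l ^ (-(1 / 2) : ℝ))) ^ (1 / 2 : ℝ) := by
  have hp0 : 0 < p := by linarith
  have hum := hu.solution.predictable.measurable
  have hDm := hu.solution.predictable_drift.measurable
  have hφm := hφ.predictable.measurable
  have hJ := isStochasticConvolution_sub_driftless hp hu hφ hσ hK hsr x
  have hm1 : Measurable fun ω => D ω r x - heatSemigroup ((r : ℝ) - s) (D ω s) x :=
    (measurable_apply hDm r x).sub (measurable_heatSemigroup_apply (measurable_slice hDm s) x)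
  have hm2 : Measurable fun ω => (u ω r x - φ ω r x)
      - (D ω r x - heatSemigroup ((r : ℝ) - s) (D ω s) x) :=
    ((measurable_apply hum r x).sub (measurable_apply hφm r x)).sub hm1
  have hw := (hu.solution.isContinuousAdapted hσ hK s).sub (hφ.isContinuousAdapted hσ hK)
  have hB := condBound_convolution hp hsr hw
    (h := fun r' => c * Real.exp (l * ((r' : ℝ) - s))) (by fun_prop)
    (fun r' => mul_nonneg hc (Real.exp_pos _).le) hwc hJ hm2
  have hV : CondBound P ξ p s (fun ω => D ω r x - heatSemigroup ((r : ℝ) - s) (D ω s) x)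
      (bracketV ξ p β s t D * ENNReal.ofReal (((t : ℝ) - s) ^ β)) := by
    rw [← condNorm_le_iff hp0]
    refine (condNorm_le_bracketV (β := β) le_rfl hsr hrt x).trans ?_
    -- Since β ≥ 0, (r-s)^β is at most (t-s)^β, so one bound K serves for all intermediate times.
    have h1 : (0 : ℝ) < (r : ℝ) - s := sub_pos.2 hsr
    have h2 : (r : ℝ) ≤ t := hrt
    gcongr
  have hsum := hV.add (by linarith) hB hm1 hm2
  have he : (fun ω => D ω r x - heatSemigroup ((r : ℝ) - s) (D ω s) x
      + ((u ω r x - φ ω r x) - (D ω r x - heatSemigroup ((r : ℝ) - s) (D ω s) x)))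
      = fun ω => u ω r x - φ ω r x := by
    funext ω
    ring
  rw [he] at hsum
  rw [condNorm_le_iff hp0]
  refine hsum.mono (add_le_add le_rfl ?_)
  have h3 := ENNReal.rpow_le_rpow (mul_le_mul_right
    (lintegral_convKernel_exp_le hC hl hc s r x) (ENNReal.ofReal (momentConst p)))
    (show (0 : ℝ) ≤ 1 / 2 by norm_num)
  refine h3.trans_eq ?_
  rw [mul_left_comm, ← ENNReal.ofReal_mul (momentConst_nonneg p),
    ENNReal.mul_rpow_of_nonneg _ _ (by norm_num), ← ENNReal.rpow_natCast, ← ENNReal.rpow_mul]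
  norm_num

/-- Absorption of the half into the left side, legitimate only for finite G. -/
theorem le_two_mul_of_le_add_half {G K : ℝ≥0∞} (hG : G ≠ ∞) (h : G ≤ K + G / 2) :
    G ≤ 2 * K := by
  have h1 : G / 2 + G / 2 ≤ K + G / 2 := by rwa [ENNReal.add_halves]
  have h2 : G / 2 ≤ K :=
    (ENNReal.add_le_add_iff_right (ENNReal.div_ne_top hG two_ne_zero)).1 h1
  calc G = 2 * (G / 2) := (ENNReal.mul_div_cancel two_ne_zero ENNReal.ofNat_ne_top).symm
    _ ≤ 2 * K := by gcongr

/-- The bound on the driftless approximation, with the constant expressed through the exponential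
weight `l` of the Gronwall argument. -/
theorem condNorm_sub_driftless_le_exp (hp : 2 ≤ p) (hβ : 0 ≤ β) (hu : MemU ξ p β α b σ u₀ u D)
    (hφ : IsDriftlessFlow ξ σ s (fun ω => u ω s) φ) (hσ : ContDiff ℝ 1 σ) (hσM : c1Norm σ ≤ M)
    {C : ℝ} (hC : ∀ (l : ℝ), 0 < l → ∀ (t : unitInterval) (x : UnitAddCircle),
      ∫⁻ q : unitInterval × UnitAddCircle, ENNReal.ofReal
        (torusKernel ((t : ℝ) - q.1) (x - q.2) * Real.exp (-(l * ((t : ℝ) - q.1)))) ^ 2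
      ≤ ENNReal.ofReal (C * l ^ (-(1 / 2) : ℝ))) {l : ℝ} (hl : 0 < l)
    (hlM : (M : ℝ≥0∞) * ENNReal.ofReal (momentConst p * (C * l ^ (-(1 / 2) : ℝ))) ^ (1 / 2 : ℝ)
      ≤ 1 / 2) (hst : s < t) (x : UnitAddCircle) :
    condNorm P (ξ.filtration s) p ∞ (fun ω => u ω t x - φ ω t x)
      ≤ ENNReal.ofReal (2 * Real.exp l) * (bracketV ξ p β s t D
        * ENNReal.ofReal (((t : ℝ) - s) ^ β)) := by
  have hp0 : 0 < p := by linarith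
  have hM := abs_le_of_c1Norm_le hσM
  have hLip := lipschitzWith_of_c1Norm_le hσ hσM
  set K := bracketV ξ p β s t D * ENNReal.ofReal (((t : ℝ) - s) ^ β) with hKdef
  set R := ENNReal.ofReal (momentConst p * (C * l ^ (-(1 / 2) : ℝ))) ^ (1 / 2 : ℝ) with hRdef
  have hKtop : K ≠ ∞ := ENNReal.mul_ne_top
    ((bracketV_mono D bot_le le_top).trans_lt hu.drift_mem.bracket).ne ENNReal.ofReal_ne_top
  have hRtop : R ≠ ∞ := ENNReal.rpow_ne_top_of_nonneg (by norm_num) ENNReal.ofReal_ne_top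
  set a : unitInterval → UnitAddCircle → ℝ≥0∞ := fun r y =>
    condNorm P (ξ.filtration s) p ∞ (fun ω => u ω r y - φ ω r y) with ha
  -- The supremum runs over times in (s, t] and over all of space, because the convolution uses u -
  -- φ at every earlier point.
  set G : ℝ≥0∞ := ⨆ (r : unitInterval) (y : UnitAddCircle) (_ : s < r) (_ : r ≤ t),
    ENNReal.ofReal (Real.exp (-(l * ((r : ℝ) - s)))) * a r y with hG
  have hexp : ∀ r : unitInterval, ENNReal.ofReal (Real.exp (-(l * ((r : ℝ) - s))))
      * ENNReal.ofReal (Real.exp (l * ((r : ℝ) - s))) = 1 := fun r => by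
    rw [← ENNReal.ofReal_mul (Real.exp_pos _).le, ← Real.exp_add, neg_add_cancel, Real.exp_zero,
      ENNReal.ofReal_one]
  have haG : ∀ r y, s < r → r ≤ t → a r y ≤ G * ENNReal.ofReal (Real.exp (l * ((r : ℝ) - s))) :=
    fun r y h1 h2 => by
      have h3 : ENNReal.ofReal (Real.exp (-(l * ((r : ℝ) - s)))) * a r y ≤ G := by
        rw [hG]
        exact le_iSup_of_le r (le_iSup_of_le y (le_iSup_of_le h1 (le_iSup_of_le h2 le_rfl)))
      calc a r y = ENNReal.ofReal (Real.exp (-(l * ((r : ℝ) - s)))) * a r y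
            * ENNReal.ofReal (Real.exp (l * ((r : ℝ) - s))) := by
            rw [mul_right_comm, hexp, one_mul]
        _ ≤ _ := by gcongr
  -- A bound c e^{l(r'-s)} for the integrand gives G ≤ K + cR. It is used twice: with a crude c to
  -- see that G is finite, then with c = MG to close the estimate.
  have hstep : ∀ c : ℝ, 0 ≤ c → (∀ r' y, s < r' → r' < t → CondBound P ξ p s
      (fun ω => σ (u ω r' y) - σ (φ ω r' y))
        (ENNReal.ofReal (c * Real.exp (l * ((r' : ℝ) - s))))) →
      G ≤ K + ENNReal.ofReal c * R := fun c hc hcb => by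
    rw [hG]
    refine iSup_le fun r => iSup_le fun y => iSup_le fun h1 => iSup_le fun h2 => ?_
    have h3 := condNorm_sub_driftless_le hp hβ hu hφ hσ.continuous hM hC hl hc h1 h2
      (fun r' y h4 h5 => hcb r' y h4 (h5.trans_le h2)) y
    have h6 : ENNReal.ofReal (Real.exp (-(l * ((r : ℝ) - s)))) ≤ 1 := by
      rw [← ENNReal.ofReal_one]
      refine ENNReal.ofReal_le_ofReal (Real.exp_le_one_iff.2 ?_)
      have : (0 : ℝ) < (r : ℝ) - s := sub_pos.2 h1
      have := mul_pos hl this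
      linarith
    calc _ ≤ ENNReal.ofReal (Real.exp (-(l * ((r : ℝ) - s)))) * (K +
          ENNReal.ofReal (c * Real.exp (l * ((r : ℝ) - s))) * R) := by gcongr
      _ = ENNReal.ofReal (Real.exp (-(l * ((r : ℝ) - s)))) * K
          + (ENNReal.ofReal (Real.exp (-(l * ((r : ℝ) - s))))
            * ENNReal.ofReal (Real.exp (l * ((r : ℝ) - s)))) * (ENNReal.ofReal c * R) := by
          rw [ENNReal.ofReal_mul hc]
          ring
      _ ≤ 1 * K + 1 * (ENNReal.ofReal c * R) := by
          rw [hexp]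
          gcongr
      _ = _ := by rw [one_mul, one_mul]
  -- The crude constant is 2M, since |σ| ≤ M and the weight e^{l(r'-s)} is at least 1.
  have hGtop : G ≠ ∞ := by
    refine ne_top_of_le_ne_top ?_ (hstep (M + M) (by positivity) fun r' y h1 h2 => ?_)
    · exact ENNReal.add_ne_top.2 ⟨hKtop, ENNReal.mul_ne_top ENNReal.ofReal_ne_top hRtop⟩
    · have h3 : 1 ≤ Real.exp (l * ((r' : ℝ) - s)) := by
        have h4 : (0 : ℝ) < (r' : ℝ) - s := sub_pos.2 h1
        exact Real.one_le_exp (mul_pos hl h4).le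
      refine condBound_of_bounded hp0 (by positivity) fun ω => ?_
      refine ((abs_sub _ _).trans (add_le_add (hM _) (hM _))).trans ?_
      exact le_mul_of_one_le_right (by positivity) h3
  -- The Lipschitz bound turns G into the constant c = MG, and MR ≤ 1/2 by the choice of l.
  have hGK : G ≤ K + G / 2 := by
    refine (hstep (M * G.toReal) (by positivity) fun r' y h1 h2 => ?_).trans ?_
    · have h3 : CondBound P ξ p s (fun ω => u ω r' y - φ ω r' y) (a r' y) :=
        condBound_condNorm hp0
      refine (h3.of_abs_le (K := M) (by positivity) fun ω => ?_).mono ?_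
      · exact hLip.dist_le_mul _ _
      · rw [mul_assoc, ENNReal.ofReal_mul (by positivity), ENNReal.ofReal_mul (by positivity),
          ENNReal.ofReal_toReal hGtop]
        gcongr
        exact haG r' y h1 h2.le
    · gcongr
      rw [ENNReal.ofReal_mul (by positivity), ENNReal.ofReal_toReal hGtop, ENNReal.ofReal_coe_nnreal,
        mul_right_comm, ENNReal.div_eq_inv_mul]
      gcongr
      rwa [one_div] at hlM
  have hG2 := le_two_mul_of_le_add_half hGtop hGK
  have hexpl : Real.exp (l * ((t : ℝ) - s)) ≤ Real.exp l := by
    refine Real.exp_le_exp.2 (mul_le_of_le_one_right hl.le ?_)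
    linarith [t.2.2, s.2.1]
  -- Undoing the weight at the final time costs at most e^l, as t - s ≤ 1.
  calc a t x ≤ G * ENNReal.ofReal (Real.exp (l * ((t : ℝ) - s))) := haG t x hst le_rfl
    _ ≤ 2 * K * ENNReal.ofReal (Real.exp l) := by gcongr
    _ = _ := by
      rw [ENNReal.ofReal_mul zero_le_two, ENNReal.ofReal_ofNat]
      ring

end Driftless

/-- The factor l^{-1/2} tends to zero as l grows. The choice of l depends on M and A alone, hence
eventually only on p and the bound for σ. -/
theorem exists_weight (M : ℝ≥0) (A : ℝ) : ∃ l : ℝ, 0 < l ∧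
    (M : ℝ≥0∞) * ENNReal.ofReal (A * l ^ (-(1 / 2) : ℝ)) ^ (1 / 2 : ℝ) ≤ 1 / 2 := by
  have h1 : Tendsto (fun l : ℝ => A * l ^ (-(1 / 2) : ℝ)) atTop (𝓝 (A * 0)) :=
    (tendsto_rpow_neg_atTop (by norm_num)).const_mul A
  rw [mul_zero] at h1
  have h2 := (ENNReal.continuous_ofReal.tendsto _).comp h1
  have h3 := (ENNReal.continuous_rpow_const (y := 1 / 2)).tendsto _ |>.comp h2
  have h4 := ENNReal.Tendsto.const_mul (a := (M : ℝ≥0∞)) h3 (Or.inr ENNReal.coe_ne_top)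
  rw [ENNReal.ofReal_zero, ENNReal.zero_rpow_of_pos (by norm_num), mul_zero] at h4
  have h5 := h4.eventually (ge_mem_nhds (show (0 : ℝ≥0∞) < 1 / 2 by simp))
  obtain ⟨l, hl, hl0⟩ := (h5.and (eventually_gt_atTop 0)).exists
  exact ⟨l, hl0, hl⟩

end SHE

theorem lemma6p3 (p α β : ℝ) (M : ℝ≥0) (hp : 2 ≤ p) (hα : -1 < α) (hα' : α < 0)
    (hβ : 0 ≤ β) (hβ' : β ≤ 1 + α / 4) :
    ∃ N : ℝ≥0, ∀ {Ω : Type*} [MeasurableSpace Ω] (P : Measure Ω) [IsProbabilityMeasure P]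
      [P.IsComplete] (ξ : SHE.WhiteNoise P) (σ : ℝ → ℝ) (b : SHE.RealDistribution)
      (u₀ : C(UnitAddCircle, ℝ)) (u D : Ω → unitInterval → UnitAddCircle → ℝ),
      ContDiff ℝ 1 σ → SHE.c1Norm σ ≤ M → SHE.negHolderNorm α b < ∞ →
      SHE.MemU ξ p β α b σ u₀ u D →
      ∀ s t : unitInterval, s ≤ t → ∀ φ : Ω → unitInterval → UnitAddCircle → ℝ,
        SHE.IsDriftlessFlow ξ σ s (fun ω => u ω s) φ →
        (⨆ x : UnitAddCircle, SHE.condNorm P (ξ.filtration s) p ∞ (fun ω => u ω t x - φ ω t x))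
          ≤ N * SHE.bracketV ξ p β s t D * ENNReal.ofReal (((t : ℝ) - s) ^ β) := by
  obtain ⟨C, hC0, hC⟩ := SHE.exists_lintegral_torusKernel_sq_le
  obtain ⟨l, hl, hlM⟩ := SHE.exists_weight M (SHE.momentConst p * C)
  -- The factor 2 comes from the absorption step and e^l from removing the weight. It is fixed
  -- before the probability space and the solution are introduced.
  refine ⟨Real.toNNReal (2 * Real.exp l), ?_⟩
  intro Ω _ P _ _ ξ σ b u₀ u D hσ hσM _ hu s t hst φ hφ
  refine iSup_le fun x => ?_
  rcases hst.eq_or_lt with rfl | hst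
  -- For s = t the bracket is an empty supremum, so the left side has to vanish: the flow starts
  -- from u(s, ·) almost surely.
  · have h := SHE.ae_eq_of_driftless hφ
      (SHE.measurable_slice hu.solution.predictable.measurable s) x
    refine le_trans ?_ zero_le
    rw [SHE.condNorm_le_iff (by linarith)]
    have h0 : SHE.CondBound P ξ p s (fun _ => (0 : ℝ)) 0 := fun A hA => by simp
    refine h0.congr_ae ?_
    filter_upwards [h] with ω hω
    exact (sub_eq_zero.2 hω.symm).symm
  · rw [mul_assoc]
    refine SHE.condNorm_sub_driftless_le_exp hp hβ hu hφ hσ hσM hC hl ?_ hst x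
    rwa [← mul_assoc]
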